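/- **Theorem (Stability of ULISE).** Consider the system $x_{k+1}=A_kx_k+B_ku_k+G_kd_k+w_k$, $y_k=C_kx_k+D_ku_k+H_kd_k+v_k$ ($k\ge 0$), with state $x_k\in\mathbb R^n$, known input $u_k\in\mathbb R^m$, arbitrary unknown input $d_k\in\mathbb R^p$ and output $y_k\in\mathbb R^l$; $w_k,v_k$ are zero-mean, white, mutually uncorrelated, with covariances $Q_k\succeq0$, $R_k\succ0$, and $x_0$ is square integrable and independent of each $w_k$ and each $v_k$. Let $p_{H_k}=\mathrm{rk}\,H_k$, and let $H_k=[U_{1,k}\ U_{2,k}]\begin{bmatrix}\Sigma_k&0\\0&0\end{bmatrix}[V_{1,k}\ V_{2,k}]^\top$ be singular value decompositions with $\Sigma_k$ diagonal, positive, of size $p_{H_k}$. Put $G_{i,k}=G_kV_{i,k}$, $d_{i,k}=V_{i,k}^\top d_k$, $T_{2,k}=U_{2,k}^\top$, $T_{1,k}=U_{1,k}^\top-U_{1,k}^\top R_kU_{2,k}(U_{2,k}^\top R_kU_{2,k})^{-1}U_{2,k}^\top$, $C_{i,k}=T_{i,k}C_k$, $D_{i,k}=T_{i,k}D_k$, $z_{i,k}=T_{i,k}y_k$,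 $R_{i,k}=T_{i,k}R_kT_{i,k}^\top$, $M_{1,k}=\Sigma_k^{-1}$, $\hat A_k=A_k-G_{1,k}M_{1,k}C_{1,k}$, $\hat Q_k=G_{1,k}M_{1,k}R_{1,k}M_{1,k}^\top G_{1,k}^\top+Q_k$, $\tilde M_{2,k}=(C_{2,k}G_{2,k-1})^\dagger$ (Moore–Penrose), $E_k=G_{2,k-1}\tilde M_{2,k}C_{2,k}$ and, for $k\ge1$, $$\tilde A_k=(I-E_{k+1})\hat A_k+E_k,\qquad \tilde Q_k=(I-E_{k+1})\hat Q_k(I-E_{k+1})^\top .$$ The ULISE filter with initial values $\hat x_{0|0}\in\mathbb R^n$ and $P^x_{0|0}\succeq0$ is, for $k\ge1$: $\tilde P_k=\hat A_{k-1}P^x_{k-1|k-1}\hat A_{k-1}^\top+\hat Q_{k-1}$; $\tilde R_{2,k}=C_{2,k}\tilde P_kC_{2,k}^\top+R_{2,k}$; $M_{2,k}=(G_{2,k-1}^\top C_{2,k}^\top\tilde R_{2,k}^{-1}C_{2,k}G_{2,k-1})^{-1}G_{2,k-1}^\top C_{2,k}^\top\tilde R_{2,k}^{-1}$; with $J_k=G_{2,k-1}M_{2,k}$,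 $P^{\star x}_{k|k}=J_kR_{2,k}J_k^\top+(I-J_kC_{2,k})\tilde P_k(I-J_kC_{2,k})^\top$; $\tilde R^\star_k=C_kP^{\star x}_{k|k}C_k^\top+R_k-C_kJ_kU_{2,k}^\top R_k-R_kU_{2,k}J_k^\top C_k^\top$; $K_k=P^{\star x}_{k|k}C_k^\top-J_kU_{2,k}^\top R_k$; $M^\star_{1,k}=\Sigma_k^{-1}(U_{1,k}^\top\tilde R_k^{\star\dagger}U_{1,k})^{-1}U_{1,k}^\top\tilde R_k^{\star\dagger}$; $L_k=K_k(I-U_{1,k}\Sigma_kM^\star_{1,k})^\top\tilde R_k^{\star\dagger}$; $P^x_{k|k}=(I-L_kC_k)J_kU_{2,k}^\top R_kL_k^\top+L_kR_kU_{2,k}J_k^\top(I-L_kC_k)^\top+(I-L_kC_k)P^{\star x}_{k|k}(I-L_kC_k)^\top+L_kR_kL_k^\top$; and for the estimates: $\hat d_{1,k}=M_{1,k}(z_{1,k}-C_{1,k}\hat x_{k|k}-D_{1,k}u_k)$ ($k\ge0$), and for $k\ge1$: $\hat x_{k|k-1}=A_{k-1}\hat x_{k-1|k-1}+B_{k-1}u_{k-1}+G_{1,k-1}\hat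 d_{1,k-1}$, $\hat d_{2,k-1}=M_{2,k}(z_{2,k}-C_{2,k}\hat x_{k|k-1}-D_{2,k}u_k)$, $\hat d_{k-1}=V_{1,k-1}\hat d_{1,k-1}+V_{2,k-1}\hat d_{2,k-1}$, $\hat x^\star_{k|k}=\hat x_{k|k-1}+G_{2,k-1}\hat d_{2,k-1}$, $\hat x_{k|k}=\hat x^\star_{k|k}+L_k(y_k-C_k\hat x^\star_{k|k}-D_ku_k)$. Write $\tilde x_{k|k}=x_k-\hat x_{k|k}$, $\tilde d_k=d_k-\hat d_k$. For a pair $(A_k,C_k)$ let $\Phi(j,i)=A_{j-1}\cdots A_i$. The pair is *uniformly detectable* if there are integers $s,t\ge0$ and constants $0\le d<1$, $b>0$ such that for all $k,\xi$: $\|\Phi(k+t,k)\xi\|\ge d\|\xi\|$ implies $\xi^\top\sum_{i=k}^{k+s}\Phi(i,k)^\top C_i^\top C_i\Phi(i,k)\,\xi\ge b\,\xi^\top\xi$. A pair $(A_k,B_k)$ is *uniformly stabilizable* if there are such $s,t,d,b$ such that for all $\xi$ and all $k$ for which the indices lie in the time range: $\|\Phi(k,k-t)^\top\xi\|\ge d\|\xi\|$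 implies $\xi^\top\sum_{i=k-s-1}^{k-1}\Phi(k,i+1)B_iB_i^\top\Phi(k,i+1)^\top\,\xi\ge b\,\xi^\top\xi$. Assume that $A_k,B_k,C_k,D_k,G_k,H_k,Q_k,R_k$ and also $R_k^{-1}$, $\Sigma_k^{-1}$, $\tilde M_{2,k}$ are bounded in $k$, and that $\mathrm{rk}(C_{2,k}G_{2,k-1})=p-p_{H_{k-1}}$ for all $k\ge1$. 1. If $(\tilde A_k,C_{2,k})_{k\ge1}$ is uniformly detectable, then for every $P^x_{0|0}\succeq0$ the ULISE error covariance is bounded: there is $c$ with $|(P^x_{k|k})_{ij}|\le c$ for all $k,i,j$, and, for every such stochastic system with $\hat x_{0|0}=\mathbb E[x_0]$ and $P^x_{0|0}=\mathrm{Cov}(x_0)$, $\tilde x_{k|k}$ is square integrable with $|\mathbb E[\tilde x_{k|k}\tilde x_{k|k}^\top]_{ij}|\le c$. 2. If in addition $(\tilde A_k,\tilde Q_k^{1/2})_{k\ge1}$ is uniformly stabilizable, then ULISE is exponentially stable: for every $P^x_{0|0}\succeq0$ there are $K$ and $0\le\rho<1$ such that for every such stochastic system, every $\hat x_{0|0}$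 and all $j\le k$, the errors are integrable and $$\|\mathbb E[\tilde x_{k|k}]\|\le K\rho^{k-j}\|\mathbb E[\tilde x_{j|j}]\|,\qquad \|\mathbb E[\tilde d_k]\|\le K\rho^{k-j}\|\mathbb E[\tilde x_{j|j}]\|.$$ -/

import Mathlib

open Matrix MeasureTheory ProbabilityTheory
open scoped MatrixOrder

universe u

noncomputable section

/-! ### Moore-Penrose pseudoinverse -/

/-- The four Penrose equations: `X` is a Moore-Penrose inverse of the real matrix `A`. -/
def IsMoorePenrose {a b : Type*} [Fintype a] [Fintype b]
    (A : Matrix a b ℝ) (X : Matrix b a ℝ) : Prop :=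
  A * X * A = A ∧ X * A * X = X ∧ (A * X)ᵀ = A * X ∧ (X * A)ᵀ = X * A

theorem exists_isMoorePenrose {a b : Type*} [Fintype a] [Fintype b]
    (A : Matrix a b ℝ) : ∃ X, IsMoorePenrose A X := by
  classical
  have hB : (Aᵀ * A).IsHermitian := by
    simpa using Matrix.isHermitian_conjTranspose_mul_self A
  obtain ⟨U, D, hU, hU', hD⟩ : ∃ (U : Matrix b b ℝ) (D : b → ℝ),
      Uᵀ * U = 1 ∧ U * Uᵀ = 1 ∧ Aᵀ * A = U * diagonal D * Uᵀ := by
    refine ⟨hB.eigenvectorUnitary, hB.eigenvalues, ?_, ?_, ?_⟩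
    · simpa [star_eq_conjTranspose] using Unitary.coe_star_mul_self hB.eigenvectorUnitary
    · simpa [star_eq_conjTranspose] using Unitary.coe_mul_star_self hB.eigenvectorUnitary
    · have h := hB.spectral_theorem
      rw [Unitary.conjStarAlgAut_apply] at h
      simpa [star_eq_conjTranspose, Function.comp_def] using h
  have e1 : diagonal (fun i => (D i)⁻¹) * diagonal D * diagonal (fun i => (D i)⁻¹)
      = diagonal (fun i => (D i)⁻¹) := by
    rw [diagonal_mul_diagonal, diagonal_mul_diagonal]
    congr 1; ext i
    by_cases h : D i = 0 <;> simp [h]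
  have e2 : diagonal D * diagonal (fun i => (D i)⁻¹) * diagonal D = diagonal D := by
    rw [diagonal_mul_diagonal, diagonal_mul_diagonal]
    congr 1; ext i
    by_cases h : D i = 0 <;> simp [h]
  have e3 : diagonal D * diagonal (fun i => (D i)⁻¹) =
      diagonal (fun i => (D i)⁻¹) * diagonal D := by
    rw [diagonal_mul_diagonal, diagonal_mul_diagonal]
    congr 1; ext i; ring
  set D' : Matrix b b ℝ := diagonal (fun i => (D i)⁻¹) with hD'
  have tD' : D'ᵀ = D' := diagonal_transpose _
  set E : Matrix b b ℝ := diagonal D with hE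
  have tE : Eᵀ = E := diagonal_transpose _
  have cU : ∀ M : Matrix b b ℝ, Uᵀ * (U * M) = M := fun M => by
    rw [← Matrix.mul_assoc, hU, Matrix.one_mul]
  have hXA : U * D' * Uᵀ * Aᵀ * A = U * (D' * E) * Uᵀ := by
    rw [Matrix.mul_assoc _ Aᵀ A, hD]
    simp only [Matrix.mul_assoc, cU]
  have e1' : D' * (E * D') = D' := by rw [← Matrix.mul_assoc, e1]
  have e2' : E * (D' * E) = E := by rw [← Matrix.mul_assoc, e2]
  refine ⟨U * D' * Uᵀ * Aᵀ, ?_, ?_, ?_, ?_⟩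
  · have hz : Aᵀ * A * (U * (D' * E) * Uᵀ - 1) = 0 := by
      have h : Aᵀ * A * (U * (D' * E) * Uᵀ) = U * (E * (D' * E)) * Uᵀ := by
        rw [hD]
        simp only [Matrix.mul_assoc, cU]
      rw [Matrix.mul_sub, h, e2', hD, Matrix.mul_one, sub_self]
    rw [← conjTranspose_eq_transpose_of_trivial, conjTranspose_mul_self_mul_eq_zero,
      Matrix.mul_sub, Matrix.mul_one, sub_eq_zero] at hz
    rw [Matrix.mul_assoc, hXA]
    exact hz
  · have h : U * (D' * E) * Uᵀ * (U * D' * Uᵀ) = U * (D' * (E * D')) * Uᵀ := by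
      simp only [Matrix.mul_assoc, cU]
    rw [hXA, ← Matrix.mul_assoc, h, e1']
  · simp only [transpose_mul, transpose_transpose, tD', Matrix.mul_assoc]
  · rw [hXA]
    simp only [transpose_mul, transpose_transpose, tD', tE, e3, Matrix.mul_assoc]

/-- The Moore-Penrose pseudoinverse `A†` of a real matrix. -/
def pinv {a b : Type*} [Fintype a] [Fintype b] (A : Matrix a b ℝ) : Matrix b a ℝ :=
  Classical.choose (exists_isMoorePenrose A)

theorem pinv_spec {a b : Type*} [Fintype a] [Fintype b] (A : Matrix a b ℝ) :
    IsMoorePenrose A (pinv A) :=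
  Classical.choose_spec (exists_isMoorePenrose A)

/-! ### Boundedness, uniform detectability and uniform stabilizability -/

/-- A sequence of real matrices (of possibly varying size) is bounded: all entries of all the
matrices are bounded by one constant. -/
def BoundedSeq {a b : ℕ → ℕ} (M : ∀ k, Matrix (Fin (a k)) (Fin (b k)) ℝ) : Prop :=
  ∃ c : ℝ, ∀ k i j, |M k i j| ≤ c

/-- Euclidean norm of a coordinate vector. -/
def euclNorm {n : ℕ} (v : Fin n → ℝ) : ℝ := ‖(WithLp.toLp 2 v : EuclideanSpace ℝ (Fin n))‖

/-- State transition matrix `Φ(k + j, k) = A_{k+j-1} ⋯ A_k` of `x_{k+1} = A_k x_k`. -/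
def transition {n : ℕ} (A : ℕ → Matrix (Fin n) (Fin n) ℝ) (k : ℕ) : ℕ → Matrix (Fin n) (Fin n) ℝ
  | 0 => 1
  | j + 1 => A (k + j) * transition A k j

/-- Observability Gramian
`W(k+s, k) = ∑_{i=k}^{k+s} Φ(i,k)ᵀ C_iᵀ C_i Φ(i,k)` of `x_{k+1} = A_k x_k`, `y_k = C_k x_k`. -/
def obsGramian {n : ℕ} {q : ℕ → ℕ} (A : ℕ → Matrix (Fin n) (Fin n) ℝ)
    (C : ∀ k, Matrix (Fin (q k)) (Fin n) ℝ) (k s : ℕ) : Matrix (Fin n) (Fin n) ℝ :=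
  ∑ i ∈ Finset.range (s + 1),
    (C (k + i) * transition A k i)ᵀ * (C (k + i) * transition A k i)

/-- Controllability Gramian
`Y(k, k-s-1) = ∑_{i=0}^{s} Φ(k,k-i) B_{k-i-1} B_{k-i-1}ᵀ Φ(k,k-i)ᵀ` of
`x_{k+1} = A_k x_k + B_k w_k`; used for `s < k` only. -/
def ctrGramian {n : ℕ} {q : ℕ → ℕ} (A : ℕ → Matrix (Fin n) (Fin n) ℝ)
    (B : ∀ k, Matrix (Fin n) (Fin (q k)) ℝ) (k s : ℕ) : Matrix (Fin n) (Fin n) ℝ :=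
  ∑ i ∈ Finset.range (s + 1),
    (transition A (k - i) i * B (k - i - 1)) * (transition A (k - i) i * B (k - i - 1))ᵀ

/-- Uniform detectability of the pair `(A_k, C_k)` (Anderson and Moore): there are
`s, t ≥ 0`, `0 ≤ d < 1` and `b > 0` such that whenever `‖Φ(k+t,k) ξ‖ ≥ d ‖ξ‖`, one has
`ξᵀ W(k+s,k) ξ ≥ b ξᵀ ξ`. -/
def UniformlyDetectable {n : ℕ} {q : ℕ → ℕ} (A : ℕ → Matrix (Fin n) (Fin n) ℝ)
    (C : ∀ k, Matrix (Fin (q k)) (Fin n) ℝ) : Prop :=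
  ∃ (s t : ℕ) (d b : ℝ), 0 ≤ d ∧ d < 1 ∧ 0 < b ∧
    ∀ (k : ℕ) (ξ : Fin n → ℝ),
      d * euclNorm ξ ≤ euclNorm (transition A k t *ᵥ ξ) →
      b * (ξ ⬝ᵥ ξ) ≤ ξ ⬝ᵥ (obsGramian A C k s *ᵥ ξ)

/-- Uniform stabilizability of the pair `(A_k, B_k)`, the dual notion, over all
windows that lie in the time range: there are `s, t ≥ 0`, `0 ≤ d < 1` and `b > 0` such that
whenever `‖Φ(k,k-t)ᵀ ξ‖ ≥ d ‖ξ‖`, one has `ξᵀ Y(k,k-s-1) ξ ≥ b ξᵀ ξ`. -/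
def UniformlyStabilizable {n : ℕ} {q : ℕ → ℕ} (A : ℕ → Matrix (Fin n) (Fin n) ℝ)
    (B : ∀ k, Matrix (Fin n) (Fin (q k)) ℝ) : Prop :=
  ∃ (s t : ℕ) (d b : ℝ), 0 ≤ d ∧ d < 1 ∧ 0 < b ∧
    ∀ (k : ℕ) (ξ : Fin n → ℝ), s < k → t ≤ k →
      d * euclNorm ξ ≤ euclNorm ((transition A (k - t) t)ᵀ *ᵥ ξ) →
      b * (ξ ⬝ᵥ ξ) ≤ ξ ⬝ᵥ (ctrGramian A B k s *ᵥ ξ)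

/-! ### The system and its transformation -/

/-- The matrices of
`x_{k+1} = A_k x_k + B_k u_k + G_k d_k + w_k`, `y_k = C_k x_k + D_k u_k + H_k d_k + v_k`,
with `n` states, `m` known inputs, `p` unknown inputs and `l` outputs, together with the
covariance matrices `Q_k` of `w_k` and `R_k` of `v_k`. -/
structure LinSys (n m p l : ℕ) where
  A : ℕ → Matrix (Fin n) (Fin n) ℝ
  B : ℕ → Matrix (Fin n) (Fin m) ℝ
  C : ℕ → Matrix (Fin l) (Fin n) ℝ
  D : ℕ → Matrix (Fin l) (Fin m) ℝ
  G : ℕ → Matrix (Fin n) (Fin p) ℝ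
  H : ℕ → Matrix (Fin l) (Fin p) ℝ
  Q : ℕ → Matrix (Fin n) (Fin n) ℝ
  R : ℕ → Matrix (Fin l) (Fin l) ℝ

/-- A singular value decomposition
`H = [U₁ U₂] [Σ 0; 0 0] [V₁ V₂]ᵀ`, `Σ = diag σ` of size `rk H`, `σ > 0`. -/
structure SVD {l p : ℕ} (H : Matrix (Fin l) (Fin p) ℝ) where
  U1 : Matrix (Fin l) (Fin H.rank) ℝ
  U2 : Matrix (Fin l) (Fin (l - H.rank)) ℝ
  V1 : Matrix (Fin p) (Fin H.rank) ℝ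
  V2 : Matrix (Fin p) (Fin (p - H.rank)) ℝ
  σ : Fin H.rank → ℝ
  σ_pos : ∀ i, 0 < σ i
  U_left : (fromCols U1 U2)ᵀ * fromCols U1 U2 = 1
  U_right : fromCols U1 U2 * (fromCols U1 U2)ᵀ = 1
  V_left : (fromCols V1 V2)ᵀ * fromCols V1 V2 = 1
  V_right : fromCols V1 V2 * (fromCols V1 V2)ᵀ = 1
  eq : H = fromCols U1 U2 *
    (fromBlocks (diagonal σ) 0 0 0 :
      Matrix (Fin H.rank ⊕ Fin (l - H.rank)) (Fin H.rank ⊕ Fin (p - H.rank)) ℝ) *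
    (fromCols V1 V2)ᵀ

namespace LinSys

section

variable {n m p l : ℕ} (S : LinSys n m p l) (F : ∀ k, SVD (S.H k))

/-- `p_{H_k} = rk H_k`. -/
abbrev pH (k : ℕ) : ℕ := (S.H k).rank

/-- `Σ_k`. -/
def Sig (k : ℕ) : Matrix (Fin (S.pH k)) (Fin (S.pH k)) ℝ := diagonal (F k).σ

/-- `G_{1,k} = G_k V_{1,k}`. -/
def G1 (k : ℕ) : Matrix (Fin n) (Fin (S.pH k)) ℝ := S.G k * (F k).V1

/-- `G_{2,k} = G_k V_{2,k}`. -/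
def G2 (k : ℕ) : Matrix (Fin n) (Fin (p - S.pH k)) ℝ := S.G k * (F k).V2

/-- `T_{1,k} = U_{1,k}ᵀ - U_{1,k}ᵀ R_k U_{2,k} (U_{2,k}ᵀ R_k U_{2,k})⁻¹ U_{2,k}ᵀ`. -/
def T1 (k : ℕ) : Matrix (Fin (S.pH k)) (Fin l) ℝ :=
  (F k).U1ᵀ - (F k).U1ᵀ * S.R k * (F k).U2 * ((F k).U2ᵀ * S.R k * (F k).U2)⁻¹ * (F k).U2ᵀ

/-- `T_{2,k} = U_{2,k}ᵀ`. -/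
def T2 (k : ℕ) : Matrix (Fin (l - S.pH k)) (Fin l) ℝ := (F k).U2ᵀ

def C1 (k : ℕ) : Matrix (Fin (S.pH k)) (Fin n) ℝ := S.T1 F k * S.C k

def C2 (k : ℕ) : Matrix (Fin (l - S.pH k)) (Fin n) ℝ := S.T2 F k * S.C k

def D1 (k : ℕ) : Matrix (Fin (S.pH k)) (Fin m) ℝ := S.T1 F k * S.D k

def D2 (k : ℕ) : Matrix (Fin (l - S.pH k)) (Fin m) ℝ := S.T2 F k * S.D k

def R1 (k : ℕ) : Matrix (Fin (S.pH k)) (Fin (S.pH k)) ℝ := S.T1 F k * S.R k * (S.T1 F k)ᵀ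

def R2 (k : ℕ) : Matrix (Fin (l - S.pH k)) (Fin (l - S.pH k)) ℝ :=
  S.T2 F k * S.R k * (S.T2 F k)ᵀ

/-- `M_{1,k} = Σ_k⁻¹`. -/
def M1 (k : ℕ) : Matrix (Fin (S.pH k)) (Fin (S.pH k)) ℝ := (S.Sig F k)⁻¹

/-- `Â_k = A_k - G_{1,k} M_{1,k} C_{1,k}`. -/
def Ahat (k : ℕ) : Matrix (Fin n) (Fin n) ℝ := S.A k - S.G1 F k * S.M1 F k * S.C1 F k

/-- `Q̂_k = G_{1,k} M_{1,k} R_{1,k} M_{1,k}ᵀ G_{1,k}ᵀ + Q_k`. -/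
def Qhat (k : ℕ) : Matrix (Fin n) (Fin n) ℝ :=
  S.G1 F k * S.M1 F k * S.R1 F k * (S.M1 F k)ᵀ * (S.G1 F k)ᵀ + S.Q k

/-- `Mtil k` is `M̃_{2,k+1} = (C_{2,k+1} G_{2,k})†`. -/
def Mtil (k : ℕ) : Matrix (Fin (p - S.pH k)) (Fin (l - S.pH (k + 1))) ℝ :=
  pinv (S.C2 F (k + 1) * S.G2 F k)

/-- `Etil k` is `G_{2,k} M̃_{2,k+1} C_{2,k+1}`. -/
def Etil (k : ℕ) : Matrix (Fin n) (Fin n) ℝ := S.G2 F k * S.Mtil F k * S.C2 F (k + 1)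

/-- `Atil k` is `Ã_{k+1}`, where, for `k ≥ 1`,
`Ã_k = (I - G_{2,k} M̃_{2,k+1} C_{2,k+1}) Â_k + G_{2,k-1} M̃_{2,k} C_{2,k}`. -/
def Atil (k : ℕ) : Matrix (Fin n) (Fin n) ℝ :=
  (1 - S.Etil F (k + 1)) * S.Ahat F (k + 1) + S.Etil F k

/-- `Qtil k` is `Q̃_{k+1}`, where, for `k ≥ 1`,
`Q̃_k = (I - G_{2,k} M̃_{2,k+1} C_{2,k+1}) Q̂_k (I - G_{2,k} M̃_{2,k+1} C_{2,k+1})ᵀ`. -/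
def Qtil (k : ℕ) : Matrix (Fin n) (Fin n) ℝ :=
  (1 - S.Etil F (k + 1)) * S.Qhat F (k + 1) * (1 - S.Etil F (k + 1))ᵀ

/-! ### The ULISE gains and error covariance recursion

The argument `P` stands for `P^x_{k|k}`; the matrices are those of the step from `k` to `k+1`. -/

/-- `P̃_{k+1}`. -/
def Ptil (k : ℕ) (P : Matrix (Fin n) (Fin n) ℝ) : Matrix (Fin n) (Fin n) ℝ :=
  S.Ahat F k * P * (S.Ahat F k)ᵀ + S.Qhat F k

/-- `R̃_{2,k+1}`. -/
def Rtil2 (k : ℕ) (P : Matrix (Fin n) (Fin n) ℝ) :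
    Matrix (Fin (l - S.pH (k + 1))) (Fin (l - S.pH (k + 1))) ℝ :=
  S.C2 F (k + 1) * S.Ptil F k P * (S.C2 F (k + 1))ᵀ + S.R2 F (k + 1)

/-- `P^d_{2,k}`. -/
def Pd2 (k : ℕ) (P : Matrix (Fin n) (Fin n) ℝ) :
    Matrix (Fin (p - S.pH k)) (Fin (p - S.pH k)) ℝ :=
  ((S.G2 F k)ᵀ * (S.C2 F (k + 1))ᵀ * (S.Rtil2 F k P)⁻¹ * S.C2 F (k + 1) * S.G2 F k)⁻¹

/-- `M_{2,k+1}`. -/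
def M2 (k : ℕ) (P : Matrix (Fin n) (Fin n) ℝ) :
    Matrix (Fin (p - S.pH k)) (Fin (l - S.pH (k + 1))) ℝ :=
  S.Pd2 F k P * (S.G2 F k)ᵀ * (S.C2 F (k + 1))ᵀ * (S.Rtil2 F k P)⁻¹

/-- `P^{⋆x}_{k+1|k+1}`. -/
def Pstar (k : ℕ) (P : Matrix (Fin n) (Fin n) ℝ) : Matrix (Fin n) (Fin n) ℝ :=
  S.G2 F k * S.M2 F k P * S.R2 F (k + 1) * (S.M2 F k P)ᵀ * (S.G2 F k)ᵀ
    + (1 - S.G2 F k * S.M2 F k P * S.C2 F (k + 1)) * S.Ptil F k P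
      * (1 - S.G2 F k * S.M2 F k P * S.C2 F (k + 1))ᵀ

/-- `R̃^⋆_{k+1}`. -/
def Rstar (k : ℕ) (P : Matrix (Fin n) (Fin n) ℝ) : Matrix (Fin l) (Fin l) ℝ :=
  S.C (k + 1) * S.Pstar F k P * (S.C (k + 1))ᵀ + S.R (k + 1)
    - S.C (k + 1) * S.G2 F k * S.M2 F k P * (F (k + 1)).U2ᵀ * S.R (k + 1)
    - S.R (k + 1) * (F (k + 1)).U2 * (S.M2 F k P)ᵀ * (S.G2 F k)ᵀ * (S.C (k + 1))ᵀ

/-- `K_{k+1}`. -/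
def Kgain (k : ℕ) (P : Matrix (Fin n) (Fin n) ℝ) : Matrix (Fin n) (Fin l) ℝ :=
  S.Pstar F k P * (S.C (k + 1))ᵀ - S.G2 F k * S.M2 F k P * (F (k + 1)).U2ᵀ * S.R (k + 1)

/-- `M^⋆_{1,k+1}`. -/
def M1star (k : ℕ) (P : Matrix (Fin n) (Fin n) ℝ) : Matrix (Fin (S.pH (k + 1))) (Fin l) ℝ :=
  (S.Sig F (k + 1))⁻¹ * ((F (k + 1)).U1ᵀ * pinv (S.Rstar F k P) * (F (k + 1)).U1)⁻¹
    * (F (k + 1)).U1ᵀ * pinv (S.Rstar F k P)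

/-- `L_{k+1}`. -/
def Lgain (k : ℕ) (P : Matrix (Fin n) (Fin n) ℝ) : Matrix (Fin n) (Fin l) ℝ :=
  S.Kgain F k P * (1 - (F (k + 1)).U1 * S.Sig F (k + 1) * S.M1star F k P)ᵀ
    * pinv (S.Rstar F k P)

/-- `P^x_{k+1|k+1}`, computed from `P = P^x_{k|k}`. -/
def Pnext (k : ℕ) (P : Matrix (Fin n) (Fin n) ℝ) : Matrix (Fin n) (Fin n) ℝ :=
  (1 - S.Lgain F k P * S.C (k + 1)) * S.G2 F k * S.M2 F k P * (F (k + 1)).U2ᵀ * S.R (k + 1)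
      * (S.Lgain F k P)ᵀ
    + S.Lgain F k P * S.R (k + 1) * (F (k + 1)).U2 * (S.M2 F k P)ᵀ * (S.G2 F k)ᵀ
      * (1 - S.Lgain F k P * S.C (k + 1))ᵀ
    + (1 - S.Lgain F k P * S.C (k + 1)) * S.Pstar F k P * (1 - S.Lgain F k P * S.C (k + 1))ᵀ
    + S.Lgain F k P * S.R (k + 1) * (S.Lgain F k P)ᵀ

/-- The ULISE error covariance `P^x_{k|k}`, initialized at `P^x_{0|0} = P0`. -/
def Px (P0 : Matrix (Fin n) (Fin n) ℝ) : ℕ → Matrix (Fin n) (Fin n) ℝ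
  | 0 => P0
  | k + 1 => S.Pnext F k (Px P0 k)

/-! ### The ULISE estimates, for given known inputs `u` and measurements `y` -/

section

variable (P0 : Matrix (Fin n) (Fin n) ℝ) (u : ℕ → Fin m → ℝ) (y : ℕ → Fin l → ℝ)

/-- `d̂_{1,k}`, computed from `xh = x̂_{k|k}`; here `z_{1,k} = T_{1,k} y_k`. -/
def d1est (k : ℕ) (xh : Fin n → ℝ) : Fin (S.pH k) → ℝ :=
  S.M1 F k *ᵥ (S.T1 F k *ᵥ y k - S.C1 F k *ᵥ xh - S.D1 F k *ᵥ u k)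

/-- `x̂_{k+1|k}`, computed from `xh = x̂_{k|k}`. -/
def xpred (k : ℕ) (xh : Fin n → ℝ) : Fin n → ℝ :=
  S.A k *ᵥ xh + S.B k *ᵥ u k + S.G1 F k *ᵥ S.d1est F u y k xh

/-- `d̂_{2,k}`, computed from `xh = x̂_{k|k}` and the measurement at time `k+1`;
here `z_{2,k+1} = T_{2,k+1} y_{k+1}`. -/
def d2est (k : ℕ) (xh : Fin n → ℝ) : Fin (p - S.pH k) → ℝ :=
  S.M2 F k (S.Px F P0 k) *ᵥ (S.T2 F (k + 1) *ᵥ y (k + 1)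
    - S.C2 F (k + 1) *ᵥ S.xpred F u y k xh - S.D2 F (k + 1) *ᵥ u (k + 1))

/-- `x̂^⋆_{k+1|k+1}`, computed from `xh = x̂_{k|k}`. -/
def xstar (k : ℕ) (xh : Fin n → ℝ) : Fin n → ℝ :=
  S.xpred F u y k xh + S.G2 F k *ᵥ S.d2est F P0 u y k xh

/-- `x̂_{k|k}`, initialized at `x̂_{0|0} = xh0`. -/
def xhat (xh0 : Fin n → ℝ) : ℕ → Fin n → ℝ
  | 0 => xh0
  | k + 1 =>
    S.xstar F P0 u y k (xhat xh0 k) + S.Lgain F k (S.Px F P0 k) *ᵥ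
      (y (k + 1) - S.C (k + 1) *ᵥ S.xstar F P0 u y k (xhat xh0 k) - S.D (k + 1) *ᵥ u (k + 1))

/-- `d̂_k = V_{1,k} d̂_{1,k} + V_{2,k} d̂_{2,k}`. -/
def dhat (xh0 : Fin n → ℝ) (k : ℕ) : Fin p → ℝ :=
  (F k).V1 *ᵥ S.d1est F u y k (S.xhat F P0 u y xh0 k)
    + (F k).V2 *ᵥ S.d2est F P0 u y k (S.xhat F P0 u y xh0 k)

end

/-! ### The stochastic system -/

section

variable {Ω : Type u} (x0 : Ω → Fin n → ℝ) (u : ℕ → Ω → Fin m → ℝ) (d : ℕ → Ω → Fin p → ℝ)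
  (w : ℕ → Ω → Fin n → ℝ) (v : ℕ → Ω → Fin l → ℝ)

/-- The state `x_k`. -/
def state : ℕ → Ω → Fin n → ℝ
  | 0 => x0
  | k + 1 => fun ω => S.A k *ᵥ state k ω + S.B k *ᵥ u k ω + S.G k *ᵥ d k ω + w k ω

/-- The measurement `y_k`. -/
def output (k : ℕ) (ω : Ω) : Fin l → ℝ :=
  S.C k *ᵥ S.state x0 u d w k ω + S.D k *ᵥ u k ω + S.H k *ᵥ d k ω + v k ω

/-- The state estimation error `x̃_{k|k} = x_k - x̂_{k|k}` of ULISE initialized at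
`x̂_{0|0} = xh0`, `P^x_{0|0} = P0`. -/
def xErr (P0 : Matrix (Fin n) (Fin n) ℝ) (xh0 : Fin n → ℝ) (k : ℕ) (ω : Ω) : Fin n → ℝ :=
  S.state x0 u d w k ω
    - S.xhat F P0 (fun j => u j ω) (fun j => S.output x0 u d w v j ω) xh0 k

/-- The input estimation error `d̃_k = d_k - d̂_k`. -/
def dErr (P0 : Matrix (Fin n) (Fin n) ℝ) (xh0 : Fin n → ℝ) (k : ℕ) (ω : Ω) : Fin p → ℝ :=
  d k ω - S.dhat F P0 (fun j => u j ω) (fun j => S.output x0 u d w v j ω) xh0 k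

/-- The noises are zero mean, white and mutually uncorrelated with covariances `Q_k`, `R_k`,
and the (square integrable) initial state is independent of each of them. -/
structure Noise [MeasurableSpace Ω] (μ : Measure Ω) : Prop where
  memLp_x0 : MemLp x0 2 μ
  memLp_w : ∀ k, MemLp (w k) 2 μ
  memLp_v : ∀ k, MemLp (v k) 2 μ
  mean_w : ∀ k, ∫ ω, w k ω ∂μ = 0
  mean_v : ∀ k, ∫ ω, v k ω ∂μ = 0
  cov_w : ∀ k i j, ∫ ω, w k ω i * w k ω j ∂μ = S.Q k i j
  cov_v : ∀ k i j, ∫ ω, v k ω i * v k ω j ∂μ = S.R k i j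
  white_w : ∀ k k', k ≠ k' → ∀ i j, ∫ ω, w k ω i * w k' ω j ∂μ = 0
  white_v : ∀ k k', k ≠ k' → ∀ i j, ∫ ω, v k ω i * v k' ω j ∂μ = 0
  uncorr_wv : ∀ k k' i j, ∫ ω, w k ω i * v k' ω j ∂μ = 0
  indep_w : ∀ k, IndepFun x0 (w k) μ
  indep_v : ∀ k, IndepFun x0 (v k) μ

end

/-- Standing assumptions: `Q_k ⪰ 0`, `R_k ≻ 0`, and all the matrices of the problem are bounded,
including the inverses `R_k⁻¹`, `Σ_k⁻¹` and the pseudoinverses `M̃_{2,k}`. -/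
structure Standing : Prop where
  Q_posSemidef : ∀ k, (S.Q k).PosSemidef
  R_posDef : ∀ k, (S.R k).PosDef
  bdd_A : BoundedSeq S.A
  bdd_B : BoundedSeq S.B
  bdd_C : BoundedSeq S.C
  bdd_D : BoundedSeq S.D
  bdd_G : BoundedSeq S.G
  bdd_H : BoundedSeq S.H
  bdd_Q : BoundedSeq S.Q
  bdd_R : BoundedSeq S.R
  bdd_Rinv : BoundedSeq fun k => (S.R k)⁻¹
  bdd_Siginv : BoundedSeq fun k => (S.Sig F k)⁻¹
  bdd_Mtil : BoundedSeq (S.Mtil F)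

end

end LinSys

end

/-! ### Moore-Penrose inverses -/

/-! The gain `L` annihilates `U₁`, so the two corrections of a step amount to one gain N (`Ngain`)
acting on z₂ alone, and the covariance step is P⁺ = (I - N C₂) P̃ (I - N C₂)ᵀ + N R₂ Nᵀ
(`Pnext_eq`). With X = C₂ G₂, this gain satisfies the unbiasedness constraint N X = G₂ (`Ngain_mul`)
and is orthogonal along ker Xᵀ (`Ngain_orthogonal`); hence it minimises the covariance among all
gains with N X = G₂.

Since M̃ X = I, these gains are G₂ M̃ + Λ with Λ X = 0. Eliminating the constraint leaves an
ordinary filtering problem for the pair (Ã, C₂), whose covariance is (I - E) P̃ (I - E)ᵀ (`Fcov`), E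
= G₂ M̃ C₂ being a projection. Its quadratic forms V_k satisfy V_{k+1}(v) ≤ V_k(Ãᵀv - C₂ᵀu) + κ(|v|²
+ |u|²) for every control u (`quad_Pnext_le`), with an exact cost identity for the control that
ULISE uses (`quad_Pnext_eq`).

Boundedness (`UniformlyDetectable.riccati_bounded`): over a long enough window, detectability gives
|Φξ|² ≤ ½|ξ|² + c·(output energy). By duality, a regularised least-squares control steers the
adjoint state v to some v' with |v'|² ≤ ½|v|² at cost O(|v|²). So V_{k+T}(v) ≤ V_k(v') + O(|v|²),
and the V_k are uniformly bounded.

Decay (`UniformlyStabilizable.closed_loop_decay`): along the adjoint closed loop V drops by at least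
the energy of the Q̃^{1/2} output plus a multiple of the control energy. Over a window, closed and
open loop differ only by the control energy, and stabilizability contracts the open loop up to its
output. Hence a multiple of V plus |v|² is a strict Lyapunov function. The error mean e is tied to
this loop by f = (I - E) Â e, which follows it exactly (`exists_error_decay`).

Stochastically, the error is linear in its predecessor and the noises, free of the unknown input
(`xErr_succ`). Because T₂ R T₁ᵀ = 0, the error is uncorrelated with T₁v at the same time, so its
second moment obeys the covariance recursion (`crossMoment_xErr`). The mean input error is a bounded
linear image of the mean state error (`integral_dErr`, `opBdd_M2`). -/

theorem IsMoorePenrose.unique {a b : Type*} [Fintype a] [Fintype b] {A : Matrix a b ℝ}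
    {X Y : Matrix b a ℝ} (hX : IsMoorePenrose A X) (hY : IsMoorePenrose A Y) : X = Y := by
  obtain ⟨x1, x2, x3, x4⟩ := hX
  obtain ⟨y1, y2, y3, y4⟩ := hY
  have h1 : A * X = A * Y := by
    have : (A * Y) * (A * X) = A * X := by rw [← Matrix.mul_assoc, y1]
    have h := congrArg transpose this
    rw [transpose_mul, x3, y3, ← Matrix.mul_assoc, x1] at h
    exact h.symm
  have h2 : X * A = Y * A := by
    have : (X * A) * (Y * A) = X * A := by
      rw [Matrix.mul_assoc, ← Matrix.mul_assoc A, y1]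
    have h := congrArg transpose this
    rw [transpose_mul, x4, y4, Matrix.mul_assoc, ← Matrix.mul_assoc A, x1] at h
    exact h.symm
  rw [← x2, h2, Matrix.mul_assoc, h1, ← Matrix.mul_assoc, y2]

theorem pinv_transpose_of_symm {a : Type*} [Fintype a] {A : Matrix a a ℝ} (hA : Aᵀ = A) :
    (pinv A)ᵀ = pinv A := by
  obtain ⟨x1, x2, x3, x4⟩ := pinv_spec A
  refine IsMoorePenrose.unique (A := A) ⟨?_, ?_, ?_, ?_⟩ (pinv_spec A)
  · have h := congrArg transpose x1
    simpa only [transpose_mul, hA, Matrix.mul_assoc] using h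
  · have h := congrArg transpose x2
    simpa only [transpose_mul, hA, Matrix.mul_assoc] using h
  · rw [transpose_mul, transpose_transpose, hA, ← x4, transpose_mul, hA]
  · rw [transpose_mul, transpose_transpose, hA, ← x3, transpose_mul, hA]

theorem mulVec_injective_of_rank_eq_card {a b : Type*} [Fintype a] [Fintype b]
    {A : Matrix a b ℝ} (h : A.rank = Fintype.card b) : Function.Injective A.mulVec := by
  have h1 := A.mulVecLin.finrank_range_add_finrank_ker
  have h2 : Module.finrank ℝ (LinearMap.range A.mulVecLin) = Fintype.card b := h
  rw [h2, Module.finrank_fintype_fun_eq_card] at h1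
  have h3 : LinearMap.ker A.mulVecLin = ⊥ := Submodule.finrank_eq_zero.1 (by omega)
  exact LinearMap.ker_eq_bot.1 h3

theorem eq_zero_of_mul_eq_zero_of_injective {a b c : Type*} [Fintype b]
    {A : Matrix a b ℝ} (h : Function.Injective A.mulVec) {Z : Matrix b c ℝ} (hZ : A * Z = 0) :
    Z = 0 := by
  ext i j
  have : A *ᵥ (fun i => Z i j) = A *ᵥ 0 := by
    rw [mulVec_zero]
    ext k
    exact congrFun (congrFun hZ k) j
  exact congrFun (h this) i

theorem pinv_mul_self_of_injective {a b : Type*} [Fintype a] [Fintype b] [DecidableEq b]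
    {A : Matrix a b ℝ} (h : Function.Injective A.mulVec) : pinv A * A = 1 := by
  have h1 := (pinv_spec A).1
  rw [← sub_eq_zero]
  refine eq_zero_of_mul_eq_zero_of_injective h ?_
  rw [Matrix.mul_sub, ← Matrix.mul_assoc, h1, Matrix.mul_one, sub_self]

/-! ### Real quadratic forms -/

section

variable {a b : Type*} [Fintype a] [Fintype b]

theorem Matrix.PosSemidef.mul_mul_transpose {P : Matrix b b ℝ} (hP : P.PosSemidef)
    (M : Matrix a b ℝ) : (M * P * Mᵀ).PosSemidef := by
  simpa using hP.mul_mul_conjTranspose_same M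

omit [Fintype a] in
theorem Matrix.PosSemidef.transpose_eq {P : Matrix a a ℝ} (hP : P.PosSemidef) : Pᵀ = P := by
  simpa using hP.1.eq

theorem dotProduct_mul_mul_transpose_mulVec (P : Matrix b b ℝ) (M : Matrix a b ℝ) (x : a → ℝ) :
    x ⬝ᵥ ((M * P * Mᵀ) *ᵥ x) = (Mᵀ *ᵥ x) ⬝ᵥ (P *ᵥ (Mᵀ *ᵥ x)) := by
  rw [← mulVec_mulVec, ← mulVec_mulVec, dotProduct_mulVec, mulVec_transpose]

theorem dotProduct_transpose_mul_mulVec (M : Matrix a b ℝ) (x : b → ℝ) :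
    x ⬝ᵥ ((Mᵀ * M) *ᵥ x) = (M *ᵥ x) ⬝ᵥ (M *ᵥ x) := by
  rw [← mulVec_mulVec, dotProduct_mulVec, vecMul_transpose]

theorem Matrix.PosSemidef.quad_nonneg {P : Matrix a a ℝ} (hP : P.PosSemidef) (x : a → ℝ) :
    0 ≤ x ⬝ᵥ (P *ᵥ x) := by
  simpa using hP.dotProduct_mulVec_nonneg x

theorem Matrix.PosSemidef.mulVec_eq_zero {P : Matrix a a ℝ} (hP : P.PosSemidef) {x : a → ℝ}
    (h : x ⬝ᵥ (P *ᵥ x) = 0) : P *ᵥ x = 0 := by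
  classical
  exact (hP.dotProduct_mulVec_zero_iff x).1 (by simpa using h)

theorem Matrix.PosDef.eq_zero_of_quad {P : Matrix a a ℝ} (hP : P.PosDef) {x : a → ℝ}
    (h : x ⬝ᵥ (P *ᵥ x) = 0) : x = 0 := by
  by_contra hx
  have := hP.dotProduct_mulVec_pos hx
  simp only [star_trivial] at this
  linarith

theorem Matrix.PosDef.transpose_mul_mul_of_injective {P : Matrix a a ℝ} (hP : P.PosDef)
    {M : Matrix a b ℝ} (hM : Function.Injective M.mulVec) : (Mᵀ * P * M).PosDef := by
  simpa using hP.conjTranspose_mul_mul_same hM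

/-- The columns of I - ST lie in ker T, hence in ker M. Any generalised inverse of a singular T thus
acts as an inverse on matrices whose kernel contains that of T. -/
theorem mul_mul_eq_of_ker_le {c : Type*} {T : Matrix a b ℝ} {S : Matrix b a ℝ}
    (h : T * S * T = T) {M : Matrix c b ℝ} (hM : ∀ η, T *ᵥ η = 0 → M *ᵥ η = 0) :
    M * S * T = M := by
  classical
  have hT : T * (1 - S * T) = 0 := by
    rw [Matrix.mul_sub, Matrix.mul_one, ← Matrix.mul_assoc, h, sub_self]
  have : M * (1 - S * T) = 0 := by
    ext i j
    refine congrFun (hM (fun k => (1 - S * T : Matrix b b ℝ) k j) (funext fun k => ?_)) i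
    exact congrFun (congrFun hT k) j
  rw [Matrix.mul_sub, Matrix.mul_one, sub_eq_zero, ← Matrix.mul_assoc] at this
  exact this.symm

theorem mulVec_injective_of_left_inv {M : Matrix a b ℝ} {N : Matrix b a ℝ} [DecidableEq b]
    (h : N * M = 1) : Function.Injective M.mulVec := by
  intro x y hxy
  have := congrArg (N *ᵥ ·) hxy
  simpa [h] using this

end

/-! ### Singular value decompositions -/

namespace SVD

variable {l p : ℕ} {H : Matrix (Fin l) (Fin p) ℝ} (f : SVD H)

theorem U_blocks : f.U1ᵀ * f.U1 = 1 ∧ f.U1ᵀ * f.U2 = 0 ∧ f.U2ᵀ * f.U1 = 0 ∧ f.U2ᵀ * f.U2 = 1 := by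
  have h := f.U_left
  rw [transpose_fromCols, fromRows_mul_fromCols, ← fromBlocks_one, fromBlocks_inj] at h
  exact h

theorem V_blocks : f.V1ᵀ * f.V1 = 1 ∧ f.V1ᵀ * f.V2 = 0 ∧ f.V2ᵀ * f.V1 = 0 ∧ f.V2ᵀ * f.V2 = 1 := by
  have h := f.V_left
  rw [transpose_fromCols, fromRows_mul_fromCols, ← fromBlocks_one, fromBlocks_inj] at h
  exact h

theorem U_sum : f.U1 * f.U1ᵀ + f.U2 * f.U2ᵀ = 1 := by
  have h := f.U_right
  rwa [transpose_fromCols, fromCols_mul_fromRows] at h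

theorem V_sum : f.V1 * f.V1ᵀ + f.V2 * f.V2ᵀ = 1 := by
  have h := f.V_right
  rwa [transpose_fromCols, fromCols_mul_fromRows] at h

theorem H_eq : H = f.U1 * diagonal f.σ * f.V1ᵀ := by
  have h := f.eq
  rw [fromCols_mul_fromBlocks, transpose_fromCols, fromCols_mul_fromRows] at h
  simpa using h

theorem diagonal_inv_mul : (diagonal f.σ)⁻¹ * diagonal f.σ = 1 :=
  nonsing_inv_mul _ (by
    rw [det_diagonal, isUnit_iff_ne_zero]
    exact Finset.prod_ne_zero_iff.2 fun i _ => (f.σ_pos i).ne')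

theorem mul_diagonal_inv : diagonal f.σ * (diagonal f.σ)⁻¹ = 1 :=
  mul_nonsing_inv _ (by
    rw [det_diagonal, isUnit_iff_ne_zero]
    exact Finset.prod_ne_zero_iff.2 fun i _ => (f.σ_pos i).ne')

end SVD

/-! ### The minimum variance gain -/

section

variable {n l q₁ q₂ : Type*} [Fintype n] [Fintype l] [Fintype q₁] [Fintype q₂]
  [DecidableEq n] [DecidableEq l]

/-- The covariance of the partially updated output residual, written as a sum of squares. -/
theorem residual_covariance_eq (C : Matrix l n ℝ) (J : Matrix n q₂ ℝ) (U : Matrix l q₂ ℝ)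
    (P : Matrix n n ℝ) (R : Matrix l l ℝ) :
    C * (J * (Uᵀ * R * U) * Jᵀ + (1 - J * (Uᵀ * C)) * P * (1 - J * (Uᵀ * C))ᵀ) * Cᵀ + R
        - C * J * Uᵀ * R - R * U * Jᵀ * Cᵀ
      = (C * (1 - J * (Uᵀ * C))) * P * (C * (1 - J * (Uᵀ * C)))ᵀ
        + (1 - C * J * Uᵀ) * R * (1 - C * J * Uᵀ)ᵀ := by
  simp only [Matrix.mul_sub, Matrix.sub_mul, Matrix.mul_add, Matrix.add_mul, transpose_sub,
    transpose_mul, transpose_one, transpose_transpose, Matrix.mul_assoc, Matrix.mul_one,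
    Matrix.one_mul]
  abel

/-- The factors match those of `residual_covariance_eq`, so a vector in the kernel of the residual
covariance is also killed by this cross covariance. -/
theorem cross_covariance_eq (C : Matrix l n ℝ) (J : Matrix n q₂ ℝ) (U : Matrix l q₂ ℝ)
    (P : Matrix n n ℝ) (R : Matrix l l ℝ) :
    (J * (Uᵀ * R * U) * Jᵀ + (1 - J * (Uᵀ * C)) * P * (1 - J * (Uᵀ * C))ᵀ) * Cᵀ
        - J * Uᵀ * R
      = (1 - J * (Uᵀ * C)) * P * (C * (1 - J * (Uᵀ * C)))ᵀ
        - J * Uᵀ * R * (1 - C * J * Uᵀ)ᵀ := by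
  simp only [Matrix.mul_sub, Matrix.sub_mul, Matrix.add_mul, transpose_sub,
    transpose_mul, transpose_one, transpose_transpose, Matrix.mul_assoc, Matrix.mul_one,
    Matrix.one_mul]
  abel

/-- The gain `K (1 - U₁ (U₁ᵀ S U₁)⁻¹ U₁ᵀ S)ᵀ S` with `S` the pseudoinverse of the residual
covariance annihilates `U₁` and satisfies the normal equation along `U₂`. -/
theorem constrained_gain_spec [DecidableEq q₁] {C : Matrix l n ℝ} {J : Matrix n q₂ ℝ} {U₁ : Matrix l q₁ ℝ}
    {U₂ : Matrix l q₂ ℝ} {P : Matrix n n ℝ} {R S T : Matrix l l ℝ} {K : Matrix n l ℝ}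
    (h11 : U₁ᵀ * U₁ = 1) (h12 : U₁ᵀ * U₂ = 0) (hP : P.PosSemidef) (hR : R.PosDef)
    (hT : T = (C * (1 - J * (U₂ᵀ * C))) * P * (C * (1 - J * (U₂ᵀ * C)))ᵀ
        + (1 - C * J * U₂ᵀ) * R * (1 - C * J * U₂ᵀ)ᵀ)
    (hK : K = (1 - J * (U₂ᵀ * C)) * P * (C * (1 - J * (U₂ᵀ * C)))ᵀ
        - J * U₂ᵀ * R * (1 - C * J * U₂ᵀ)ᵀ)
    (hS : S = pinv T) :
    K * (1 - U₁ * (U₁ᵀ * S * U₁)⁻¹ * (U₁ᵀ * S))ᵀ * S * U₁ = 0 ∧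
    K * (1 - U₁ * (U₁ᵀ * S * U₁)⁻¹ * (U₁ᵀ * S))ᵀ * S * T * U₂ = K * U₂ := by
  have hT1 := hP.mul_mul_transpose (C * (1 - J * (U₂ᵀ * C)))
  have hT2 := hR.posSemidef.mul_mul_transpose (1 - C * J * U₂ᵀ)
  have hTp : T.PosSemidef := hT ▸ hT1.add hT2
  have hTs : Tᵀ = T := hTp.transpose_eq
  have hSs : Sᵀ = S := by rw [hS, pinv_transpose_of_symm hTs]
  obtain ⟨s1, s2, s3, s4⟩ := pinv_spec T
  rw [← hS] at s1 s2 s3 s4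
  -- the kernel of `T`
  have ker : ∀ η : l → ℝ, T *ᵥ η = 0 → U₁ᵀ *ᵥ η = 0 ∧ K *ᵥ η = 0 := by
    intro η hη
    have h0 : η ⬝ᵥ (T *ᵥ η) = 0 := by rw [hη, dotProduct_zero]
    rw [hT, add_mulVec, dotProduct_add, dotProduct_mul_mul_transpose_mulVec,
      dotProduct_mul_mul_transpose_mulVec] at h0
    have n1 := hP.quad_nonneg ((C * (1 - J * (U₂ᵀ * C)))ᵀ *ᵥ η)
    have n2 := hR.posSemidef.quad_nonneg ((1 - C * J * U₂ᵀ)ᵀ *ᵥ η)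
    have e1 := hP.mulVec_eq_zero (by linarith :
      ((C * (1 - J * (U₂ᵀ * C)))ᵀ *ᵥ η) ⬝ᵥ (P *ᵥ ((C * (1 - J * (U₂ᵀ * C)))ᵀ *ᵥ η)) = 0)
    have e2 := hR.eq_zero_of_quad (by linarith :
      ((1 - C * J * U₂ᵀ)ᵀ *ᵥ η) ⬝ᵥ (R *ᵥ ((1 - C * J * U₂ᵀ)ᵀ *ᵥ η)) = 0)
    constructor
    -- `e2` reads η = U₂ Jᵀ Cᵀ η, and U₁ᵀ U₂ = 0.
    · have e3 := congrArg (U₁ᵀ *ᵥ ·) e2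
      simp only [mulVec_mulVec, mulVec_zero, transpose_sub, transpose_one, transpose_mul,
        transpose_transpose, Matrix.mul_sub, Matrix.mul_one] at e3
      rwa [← Matrix.mul_assoc, h12, Matrix.zero_mul, sub_zero] at e3
    · rw [hK, sub_mulVec, ← mulVec_mulVec, ← mulVec_mulVec, e1, mulVec_zero,
        ← mulVec_mulVec, e2, mulVec_zero, sub_zero]
  -- T may be singular, but its kernel lies in those of U₁ᵀ and K, and no other inversion property
  -- is needed.
  have hU : U₁ᵀ * S * T = U₁ᵀ := mul_mul_eq_of_ker_le (T := T) s1 fun η h => (ker η h).1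
  have hKS : K * S * T = K := mul_mul_eq_of_ker_le (T := T) s1 fun η h => (ker η h).2
  have hTSU : T * S * U₁ = U₁ := by
    have := congrArg transpose hU
    simpa only [transpose_mul, transpose_transpose, hSs, hTs, Matrix.mul_assoc] using this
  -- invertibility of `U₁ᵀ S U₁`
  have hW : (U₁ᵀ * S * U₁) = (S * U₁)ᵀ * T * (S * U₁) := by
    rw [transpose_mul, hSs, hU, Matrix.mul_assoc]
  have hWpd : (U₁ᵀ * S * U₁).PosDef := by
    have hWp : (U₁ᵀ * S * U₁).PosSemidef := by
      rw [hW]; simpa using hTp.mul_mul_transpose (S * U₁)ᵀ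
    refine PosDef.of_dotProduct_mulVec_pos hWp.1 fun x hx => ?_
    refine lt_of_le_of_ne (by simpa using hWp.quad_nonneg x) fun h => hx ?_
    have h1 : ((S * U₁) *ᵥ x) ⬝ᵥ (T *ᵥ ((S * U₁) *ᵥ x)) = 0 := by
      have := dotProduct_mul_mul_transpose_mulVec T (S * U₁)ᵀ x
      rw [transpose_transpose, ← hW] at this
      rw [← this]; simpa using h.symm
    have h2 := hTp.mulVec_eq_zero h1
    rw [mulVec_mulVec, ← Matrix.mul_assoc, hTSU] at h2
    have h3 := congrArg (U₁ᵀ *ᵥ ·) h2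
    simpa only [mulVec_mulVec, h11, one_mulVec, mulVec_zero] using h3
  have hinv : (U₁ᵀ * S * U₁)⁻¹ * (U₁ᵀ * S * U₁) = 1 :=
    nonsing_inv_mul _ ((isUnit_iff_isUnit_det _).1 hWpd.isUnit)
  have hWs : (U₁ᵀ * S * U₁)⁻¹ᵀ = (U₁ᵀ * S * U₁)⁻¹ := hWpd.inv.posSemidef.transpose_eq
  set W := (U₁ᵀ * S * U₁)⁻¹ with hWdef
  have hL : K * (1 - U₁ * W * (U₁ᵀ * S))ᵀ * S = K * S - K * S * U₁ * W * (U₁ᵀ * S) := by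
    simp only [transpose_sub, transpose_one, transpose_mul, transpose_transpose, hWs, hSs,
      Matrix.mul_sub, Matrix.sub_mul, Matrix.mul_one, Matrix.mul_assoc]
  rw [hL]
  constructor
  · rw [Matrix.sub_mul, Matrix.mul_assoc (K * S * U₁ * W), Matrix.mul_assoc (K * S * U₁), hinv,
      Matrix.mul_one, sub_self]
  · rw [Matrix.sub_mul, hKS, Matrix.sub_mul, Matrix.mul_assoc (K * S * U₁ * W), hU,
      Matrix.mul_assoc (K * S * U₁ * W), h12, Matrix.mul_zero, sub_zero]

end

/-! ### One ULISE step as a single constrained minimum variance gain on z₂ -/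

namespace LinSys

variable {n m p l : ℕ} {S : LinSys n m p l} {F : ∀ k, SVD (S.H k)}

theorem R2_posDef (hR : ∀ k, (S.R k).PosDef) (k : ℕ) : (S.R2 F k).PosDef := by
  have h : Function.Injective (F k).U2.mulVec :=
    mulVec_injective_of_left_inv (F k).U_blocks.2.2.2
  have := (hR k).transpose_mul_mul_of_injective h
  rwa [R2, T2, transpose_transpose]

theorem Qhat_posSemidef (hQ : ∀ k, (S.Q k).PosSemidef) (hR : ∀ k, (S.R k).PosDef) (k : ℕ) :
    (S.Qhat F k).PosSemidef := by
  have h1 : (S.R1 F k).PosSemidef := (hR k).posSemidef.mul_mul_transpose _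
  have h2 := h1.mul_mul_transpose (S.G1 F k * S.M1 F k)
  rw [transpose_mul, ← Matrix.mul_assoc] at h2
  exact h2.add (hQ k)

theorem Ptil_posSemidef (hQ : ∀ k, (S.Q k).PosSemidef) (hR : ∀ k, (S.R k).PosDef) (k : ℕ)
    {P : Matrix (Fin n) (Fin n) ℝ} (hP : P.PosSemidef) : (S.Ptil F k P).PosSemidef :=
  (hP.mul_mul_transpose _).add (Qhat_posSemidef hQ hR k)

theorem Rtil2_posDef (hQ : ∀ k, (S.Q k).PosSemidef) (hR : ∀ k, (S.R k).PosDef) (k : ℕ)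
    {P : Matrix (Fin n) (Fin n) ℝ} (hP : P.PosSemidef) : (S.Rtil2 F k P).PosDef :=
  (R2_posDef hR (k + 1)).posSemidef_add ((Ptil_posSemidef hQ hR k hP).mul_mul_transpose _)

variable (S F) in
/-- The total gain `J + L U₂ (1 - C₂ J)`, `J = G₂ M₂`, of a step of ULISE on the transformed
measurement `z₂`. -/
noncomputable def Ngain (k : ℕ) (P : Matrix (Fin n) (Fin n) ℝ) :
    Matrix (Fin n) (Fin (l - S.pH (k + 1))) ℝ :=
  S.G2 F k * S.M2 F k P + S.Lgain F k P * (F (k + 1)).U2 *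
    (1 - S.C2 F (k + 1) * (S.G2 F k * S.M2 F k P))

theorem C2G2_injective (hrank : ∀ k, (S.C2 F (k + 1) * S.G2 F k).rank = p - S.pH k) (k : ℕ) :
    Function.Injective (S.C2 F (k + 1) * S.G2 F k).mulVec :=
  mulVec_injective_of_rank_eq_card (by rw [hrank, Fintype.card_fin])

theorem Mtil_mul (hrank : ∀ k, (S.C2 F (k + 1) * S.G2 F k).rank = p - S.pH k) (k : ℕ) :
    S.Mtil F k * (S.C2 F (k + 1) * S.G2 F k) = 1 :=
  pinv_mul_self_of_injective (C2G2_injective hrank k)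

theorem Pd2_inv_eq (k : ℕ) (P : Matrix (Fin n) (Fin n) ℝ) :
    S.Pd2 F k P = ((S.C2 F (k + 1) * S.G2 F k)ᵀ * (S.Rtil2 F k P)⁻¹ *
      (S.C2 F (k + 1) * S.G2 F k))⁻¹ := by
  rw [Pd2, transpose_mul]; simp only [Matrix.mul_assoc]

theorem M2_eq (k : ℕ) (P : Matrix (Fin n) (Fin n) ℝ) :
    S.M2 F k P = S.Pd2 F k P * ((S.C2 F (k + 1) * S.G2 F k)ᵀ * (S.Rtil2 F k P)⁻¹) := by
  rw [M2, transpose_mul]; simp only [Matrix.mul_assoc]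

section Step

variable (hQ : ∀ k, (S.Q k).PosSemidef) (hR : ∀ k, (S.R k).PosDef)
  (hrank : ∀ k, (S.C2 F (k + 1) * S.G2 F k).rank = p - S.pH k)
  (k : ℕ) {P : Matrix (Fin n) (Fin n) ℝ} (hP : P.PosSemidef)
include hQ hR hrank hP

theorem Pd2_mul_cancel : S.Pd2 F k P * ((S.C2 F (k + 1) * S.G2 F k)ᵀ * (S.Rtil2 F k P)⁻¹ *
      (S.C2 F (k + 1) * S.G2 F k)) = 1 := by
  have h := (Rtil2_posDef (F := F) hQ hR k hP).inv.transpose_mul_mul_of_injective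
    (C2G2_injective hrank k)
  rw [Pd2_inv_eq]
  exact nonsing_inv_mul _ ((isUnit_iff_isUnit_det _).1 h.isUnit)

theorem M2_mul : S.M2 F k P * (S.C2 F (k + 1) * S.G2 F k) = 1 := by
  rw [M2_eq, Matrix.mul_assoc, Pd2_mul_cancel hQ hR hrank k hP]

end Step

theorem Pstar_eq (k : ℕ) (P : Matrix (Fin n) (Fin n) ℝ) : S.Pstar F k P =
    (S.G2 F k * S.M2 F k P) * ((F (k + 1)).U2ᵀ * S.R (k + 1) * (F (k + 1)).U2) *
      (S.G2 F k * S.M2 F k P)ᵀ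
    + (1 - (S.G2 F k * S.M2 F k P) * ((F (k + 1)).U2ᵀ * S.C (k + 1))) * S.Ptil F k P
      * (1 - (S.G2 F k * S.M2 F k P) * ((F (k + 1)).U2ᵀ * S.C (k + 1)))ᵀ := by
  simp only [Pstar, R2, C2, T2, transpose_mul, transpose_transpose, Matrix.mul_assoc]

theorem Rstar_eq (k : ℕ) (P : Matrix (Fin n) (Fin n) ℝ) : S.Rstar F k P =
    (S.C (k + 1) * (1 - (S.G2 F k * S.M2 F k P) * ((F (k + 1)).U2ᵀ * S.C (k + 1)))) *
      S.Ptil F k P *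
      (S.C (k + 1) * (1 - (S.G2 F k * S.M2 F k P) * ((F (k + 1)).U2ᵀ * S.C (k + 1))))ᵀ
    + (1 - S.C (k + 1) * (S.G2 F k * S.M2 F k P) * (F (k + 1)).U2ᵀ) * S.R (k + 1) *
      (1 - S.C (k + 1) * (S.G2 F k * S.M2 F k P) * (F (k + 1)).U2ᵀ)ᵀ := by
  rw [← residual_covariance_eq, ← Pstar_eq, Rstar]
  simp only [transpose_mul, Matrix.mul_assoc]

theorem Kgain_eq (k : ℕ) (P : Matrix (Fin n) (Fin n) ℝ) : S.Kgain F k P =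
    (1 - (S.G2 F k * S.M2 F k P) * ((F (k + 1)).U2ᵀ * S.C (k + 1))) * S.Ptil F k P *
      (S.C (k + 1) * (1 - (S.G2 F k * S.M2 F k P) * ((F (k + 1)).U2ᵀ * S.C (k + 1))))ᵀ
    - (S.G2 F k * S.M2 F k P) * (F (k + 1)).U2ᵀ * S.R (k + 1) *
      (1 - S.C (k + 1) * (S.G2 F k * S.M2 F k P) * (F (k + 1)).U2ᵀ)ᵀ := by
  rw [← cross_covariance_eq, ← Pstar_eq, Kgain]

theorem Lgain_eq (k : ℕ) (P : Matrix (Fin n) (Fin n) ℝ) : S.Lgain F k P =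
    S.Kgain F k P * (1 - (F (k + 1)).U1 *
      ((F (k + 1)).U1ᵀ * pinv (S.Rstar F k P) * (F (k + 1)).U1)⁻¹ *
      ((F (k + 1)).U1ᵀ * pinv (S.Rstar F k P)))ᵀ * pinv (S.Rstar F k P) := by
  have h : (F (k + 1)).U1 * S.Sig F (k + 1) * S.M1star F k P = (F (k + 1)).U1 *
      ((F (k + 1)).U1ᵀ * pinv (S.Rstar F k P) * (F (k + 1)).U1)⁻¹ *
      ((F (k + 1)).U1ᵀ * pinv (S.Rstar F k P)) := by
    have h1 : ∀ Z : Matrix (Fin (S.pH (k + 1))) (Fin l) ℝ,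
        S.Sig F (k + 1) * ((S.Sig F (k + 1))⁻¹ * Z) = Z := fun Z => by
      rw [← Matrix.mul_assoc, Sig, (F (k + 1)).mul_diagonal_inv, Matrix.one_mul]
    rw [M1star]
    simp only [Matrix.mul_assoc, h1]
  rw [Lgain, h]

section Step

variable (hQ : ∀ k, (S.Q k).PosSemidef) (hR : ∀ k, (S.R k).PosDef)
  (k : ℕ) {P : Matrix (Fin n) (Fin n) ℝ} (hP : P.PosSemidef)
include hQ hR hP

theorem Lgain_mul_U1 : S.Lgain F k P * (F (k + 1)).U1 = 0 := by
  rw [Lgain_eq]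
  exact (constrained_gain_spec (F (k + 1)).U_blocks.1 (F (k + 1)).U_blocks.2.1
    (Ptil_posSemidef hQ hR k hP) (hR (k + 1)) (Rstar_eq k P) (Kgain_eq k P) rfl).1

theorem Lgain_mul_Rstar_mul_U2 :
    S.Lgain F k P * S.Rstar F k P * (F (k + 1)).U2 = S.Kgain F k P * (F (k + 1)).U2 := by
  rw [Lgain_eq]
  exact (constrained_gain_spec (F (k + 1)).U_blocks.1 (F (k + 1)).U_blocks.2.1
    (Ptil_posSemidef hQ hR k hP) (hR (k + 1)) (Rstar_eq k P) (Kgain_eq k P) rfl).2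

/-- As L annihilates U₁ and U₁U₁ᵀ + U₂U₂ᵀ = I, the gain sees the measurement only through z₂ = U₂ᵀ
y, which is free of the current unknown input. -/
theorem Lgain_mul_U2_mul : S.Lgain F k P * (F (k + 1)).U2 * (F (k + 1)).U2ᵀ = S.Lgain F k P := by
  have h := congrArg (S.Lgain F k P * ·) (F (k + 1)).U_sum
  simp only [Matrix.mul_add, Matrix.mul_one, ← Matrix.mul_assoc, Lgain_mul_U1 hQ hR k hP,
    Matrix.zero_mul, zero_add] at h
  exact h

/-- Both corrections act through C₂, because L C = L U₂ C₂; their error factors therefore multiply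
to that of one gain. -/
theorem one_sub_Ngain_mul : 1 - S.Ngain F k P * S.C2 F (k + 1) =
    (1 - S.Lgain F k P * S.C (k + 1)) * (1 - S.G2 F k * S.M2 F k P * S.C2 F (k + 1)) := by
  have h : S.Lgain F k P * S.C (k + 1) =
      S.Lgain F k P * (F (k + 1)).U2 * S.C2 F (k + 1) := by
    rw [C2, T2, ← Matrix.mul_assoc, Lgain_mul_U2_mul hQ hR k hP]
  rw [h, Ngain]
  simp only [Matrix.mul_sub, Matrix.sub_mul, Matrix.add_mul, Matrix.mul_assoc, Matrix.mul_one,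
    Matrix.one_mul]
  abel

theorem Ngain_eq : S.Ngain F k P =
    (1 - S.Lgain F k P * S.C (k + 1)) * (S.G2 F k * S.M2 F k P)
      + S.Lgain F k P * (F (k + 1)).U2 := by
  have h : S.Lgain F k P * S.C (k + 1) =
      S.Lgain F k P * (F (k + 1)).U2 * S.C2 F (k + 1) := by
    rw [C2, T2, ← Matrix.mul_assoc, Lgain_mul_U2_mul hQ hR k hP]
  rw [h, Ngain]
  simp only [Matrix.mul_sub, Matrix.sub_mul, Matrix.mul_assoc, Matrix.mul_one,
    Matrix.one_mul]
  abel

/-- The error covariance recursion in terms of the total gain. -/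
theorem Pnext_eq : S.Pnext F k P =
    (1 - S.Ngain F k P * S.C2 F (k + 1)) * S.Ptil F k P *
      (1 - S.Ngain F k P * S.C2 F (k + 1))ᵀ
    + S.Ngain F k P * S.R2 F (k + 1) * (S.Ngain F k P)ᵀ := by
  have h := Lgain_mul_U2_mul (F := F) hQ hR k hP
  rw [one_sub_Ngain_mul hQ hR k hP, Ngain_eq hQ hR k hP, Pnext, Pstar, R2, T2]
  set L := S.Lgain F k P
  set U := (F (k + 1)).U2
  set J := S.G2 F k * S.M2 F k P with hJ
  have hL1 : L * S.R (k + 1) * Lᵀ = L * U * (Uᵀ * S.R (k + 1) * U) * (L * U)ᵀ := by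
    conv_lhs => rw [← h, transpose_mul]
    simp only [transpose_mul, transpose_transpose, Matrix.mul_assoc]
  have hL2 : S.R (k + 1) * Lᵀ = S.R (k + 1) * U * (L * U)ᵀ := by
    conv_lhs => rw [← h]
    simp only [transpose_mul, transpose_transpose, Matrix.mul_assoc]
  have hL3 : L * S.R (k + 1) = L * U * Uᵀ * S.R (k + 1) := by rw [h]
  set I := 1 - L * S.C (k + 1)
  have e1 : I * S.G2 F k * S.M2 F k P * Uᵀ * S.R (k + 1) * Lᵀ
      = I * J * (Uᵀ * S.R (k + 1) * U) * (L * U)ᵀ := by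
    rw [hJ]
    calc _ = I * (S.G2 F k * (S.M2 F k P * (Uᵀ * (S.R (k + 1) * Lᵀ)))) := by
          simp only [Matrix.mul_assoc]
      _ = _ := by rw [hL2]; simp only [Matrix.mul_assoc]
  have e2 : L * S.R (k + 1) * U * (S.M2 F k P)ᵀ * (S.G2 F k)ᵀ * Iᵀ
      = L * U * (Uᵀ * S.R (k + 1) * U) * (I * J)ᵀ := by
    rw [hJ, hL3]
    simp only [transpose_mul, Matrix.mul_assoc]
  rw [e1, e2, hL1]
  have e3 : J * (Uᵀ * S.R (k + 1) * Uᵀᵀ) * (S.M2 F k P)ᵀ * (S.G2 F k)ᵀ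
      = J * (Uᵀ * S.R (k + 1) * U) * Jᵀ := by
    rw [hJ]; simp only [transpose_mul, transpose_transpose, Matrix.mul_assoc]
  rw [e3, transpose_transpose]
  simp only [Matrix.mul_add, Matrix.add_mul, transpose_add, transpose_mul, Matrix.mul_assoc]
  abel

theorem Pnext_posSemidef : (S.Pnext F k P).PosSemidef := by
  rw [Pnext_eq hQ hR k hP]
  exact ((Ptil_posSemidef hQ hR k hP).mul_mul_transpose _).add
    ((R2_posDef hR (k + 1)).posSemidef.mul_mul_transpose _)

/-- With Z = I - C₂J, the residual after the first correction gives U₂ᵀ R̃⋆ U₂ = Z R̃₂ Zᵀ and K U₂ =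
(P̃ C₂ᵀ - J R̃₂) Zᵀ. Inserting these in L R̃⋆ U₂ = K U₂, with L = L U₂ U₂ᵀ and N = J + L U₂ Z,
cancels the J terms. -/
theorem Ngain_mul_normal :
    S.Ngain F k P * S.Rtil2 F k P * (1 - S.C2 F (k + 1) * (S.G2 F k * S.M2 F k P))ᵀ
      = S.Ptil F k P * (S.C2 F (k + 1))ᵀ *
        (1 - S.C2 F (k + 1) * (S.G2 F k * S.M2 F k P))ᵀ := by
  have h0 := Lgain_mul_Rstar_mul_U2 (F := F) hQ hR k hP
  have h := Lgain_mul_U2_mul (F := F) hQ hR k hP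
  set L := S.Lgain F k P
  set J := S.G2 F k * S.M2 F k P with hJ
  set U := (F (k + 1)).U2
  set Z := 1 - S.C2 F (k + 1) * J with hZ
  have hC : Uᵀ * S.C (k + 1) = S.C2 F (k + 1) := rfl
  have e1 : Uᵀ * (S.C (k + 1) * (1 - J * (Uᵀ * S.C (k + 1)))) = Z * S.C2 F (k + 1) := by
    rw [← Matrix.mul_assoc, hC, hZ, Matrix.mul_sub, Matrix.sub_mul, Matrix.mul_one,
      Matrix.one_mul, Matrix.mul_assoc (S.C2 F (k + 1)) J]
  have e2 : Uᵀ * (1 - S.C (k + 1) * J * Uᵀ) = Z * Uᵀ := by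
    rw [hZ, Matrix.mul_sub, Matrix.sub_mul, Matrix.mul_one, Matrix.one_mul, ← hC]
    simp only [Matrix.mul_assoc]
  have t1 : (S.C (k + 1) * (1 - J * (Uᵀ * S.C (k + 1))))ᵀ * U = (Z * S.C2 F (k + 1))ᵀ := by
    rw [← e1, transpose_mul Uᵀ, transpose_transpose]
  have t2 : (1 - S.C (k + 1) * J * Uᵀ)ᵀ * U = (Z * Uᵀ)ᵀ := by
    rw [← e2, transpose_mul Uᵀ, transpose_transpose]
  have hRs : Uᵀ * S.Rstar F k P * U = Z * S.Rtil2 F k P * Zᵀ := by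
    rw [Rstar_eq, ← hJ, Matrix.mul_add, Matrix.add_mul]
    have a1 : Uᵀ * (S.C (k + 1) * (1 - J * (Uᵀ * S.C (k + 1))) * S.Ptil F k P *
        (S.C (k + 1) * (1 - J * (Uᵀ * S.C (k + 1))))ᵀ) * U =
        (Uᵀ * (S.C (k + 1) * (1 - J * (Uᵀ * S.C (k + 1))))) * S.Ptil F k P *
        ((S.C (k + 1) * (1 - J * (Uᵀ * S.C (k + 1))))ᵀ * U) := by
      simp only [Matrix.mul_assoc]
    have a2 : Uᵀ * ((1 - S.C (k + 1) * J * Uᵀ) * S.R (k + 1) * (1 - S.C (k + 1) * J * Uᵀ)ᵀ) * U =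
        (Uᵀ * (1 - S.C (k + 1) * J * Uᵀ)) * S.R (k + 1) *
          ((1 - S.C (k + 1) * J * Uᵀ)ᵀ * U) := by
      simp only [Matrix.mul_assoc]
    have a3 : S.R2 F (k + 1) = Uᵀ * S.R (k + 1) * U := by rw [R2, T2, transpose_transpose]
    rw [a1, a2, e1, e2, t1, t2, Rtil2, a3]
    simp only [transpose_mul, transpose_transpose, Matrix.mul_add, Matrix.add_mul,
      Matrix.mul_assoc]
  have hKs : S.Kgain F k P * U = S.Ptil F k P * (S.C2 F (k + 1))ᵀ * Zᵀ
      - J * S.Rtil2 F k P * Zᵀ := by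
    have a3 : S.R2 F (k + 1) = Uᵀ * S.R (k + 1) * U := by rw [R2, T2, transpose_transpose]
    rw [Kgain_eq, ← hJ, Matrix.sub_mul, Matrix.mul_assoc _ _ U, t1, Matrix.mul_assoc _ _ U, t2,
      Rtil2, a3, hC]
    simp only [transpose_mul, transpose_transpose, Matrix.mul_add, Matrix.add_mul,
      Matrix.mul_assoc, Matrix.sub_mul, Matrix.one_mul]
    abel
  have h1 : L * U * (Z * S.Rtil2 F k P * Zᵀ) = S.Kgain F k P * U := by
    rw [← hRs, ← Matrix.mul_assoc, ← Matrix.mul_assoc, h, h0]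
  rw [Ngain, ← hJ, Matrix.add_mul, Matrix.add_mul]
  have h2 : L * U * Z * S.Rtil2 F k P * Zᵀ = L * U * (Z * S.Rtil2 F k P * Zᵀ) := by
    simp only [Matrix.mul_assoc]
  rw [h2, h1, hKs]
  abel

/-- Orthogonality principle for the total gain. -/
theorem Ngain_orthogonal {δ : Fin (l - S.pH (k + 1)) → ℝ}
    (hδ : (S.C2 F (k + 1) * S.G2 F k)ᵀ *ᵥ δ = 0) :
    (S.Ngain F k P * S.Rtil2 F k P - S.Ptil F k P * (S.C2 F (k + 1))ᵀ) *ᵥ δ = 0 := by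
  have h := Ngain_mul_normal (F := F) hQ hR k hP
  -- C₂J = X M₂ with X = C₂G₂, so its transpose vanishes on ker Xᵀ.
  have h1 : (1 - S.C2 F (k + 1) * (S.G2 F k * S.M2 F k P))ᵀ *ᵥ δ = δ := by
    rw [← Matrix.mul_assoc, transpose_sub, transpose_one, transpose_mul, sub_mulVec, one_mulVec,
      ← mulVec_mulVec, hδ, mulVec_zero, sub_zero]
  have h2 := congrArg (· *ᵥ δ) h
  rw [← mulVec_mulVec, ← mulVec_mulVec (M := S.Ptil F k P * (S.C2 F (k + 1))ᵀ), h1] at h2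
  rw [sub_mulVec, h2, sub_self]

variable (hrank : ∀ k, (S.C2 F (k + 1) * S.G2 F k).rank = p - S.pH k)
include hrank

/-- M₂ X = I gives J X = G₂ and (I - C₂J) X = 0: the first correction removes the unknown input and
the second does not see it. -/
theorem Ngain_mul : S.Ngain F k P * (S.C2 F (k + 1) * S.G2 F k) = S.G2 F k := by
  have h := M2_mul hQ hR hrank k hP
  have h1 : S.G2 F k * S.M2 F k P * (S.C2 F (k + 1) * S.G2 F k) = S.G2 F k := by
    rw [Matrix.mul_assoc, h, Matrix.mul_one]
  have h2 : S.C2 F (k + 1) * (S.G2 F k * S.M2 F k P) * (S.C2 F (k + 1) * S.G2 F k) =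
      S.C2 F (k + 1) * S.G2 F k := by
    rw [Matrix.mul_assoc, h1]
  rw [Ngain, Matrix.add_mul, h1, Matrix.mul_assoc, Matrix.sub_mul, h2, Matrix.one_mul, sub_self,
    Matrix.mul_zero, add_zero]

end Step

theorem Px_posSemidef (hQ : ∀ k, (S.Q k).PosSemidef) (hR : ∀ k, (S.R k).PosDef)
    {P0 : Matrix (Fin n) (Fin n) ℝ} (hP0 : P0.PosSemidef) : ∀ k, (S.Px F P0 k).PosSemidef
  | 0 => hP0
  | k + 1 => Pnext_posSemidef hQ hR k (Px_posSemidef hQ hR hP0 k)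

end LinSys

/-! ### Squared Euclidean norms of coordinate vectors -/

section

variable {a b c : Type*} [Fintype a] [Fintype b] [Fintype c]

theorem dotProduct_self_nonneg' (x : a → ℝ) : 0 ≤ x ⬝ᵥ x :=
  Finset.sum_nonneg fun i _ => mul_self_nonneg (x i)

theorem dotProduct_sq_le (x y : a → ℝ) : (x ⬝ᵥ y) ^ 2 ≤ (x ⬝ᵥ x) * (y ⬝ᵥ y) := by
  simpa only [dotProduct, sq] using Finset.sum_mul_sq_le_sq_mul_sq Finset.univ x y

theorem dotProduct_add_self_le {ε : ℝ} (hε : 0 < ε) (x y : a → ℝ) :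
    (x + y) ⬝ᵥ (x + y) ≤ (1 + ε) * (x ⬝ᵥ x) + (1 + ε⁻¹) * (y ⬝ᵥ y) := by
  simp only [dotProduct, Finset.mul_sum, ← Finset.sum_add_distrib]
  refine Finset.sum_le_sum fun i _ => ?_
  have h : 0 ≤ (ε * x i - y i) ^ 2 / ε := by positivity
  have h2 : (ε * x i - y i) ^ 2 / ε = ε * x i ^ 2 - 2 * (x i * y i) + ε⁻¹ * y i ^ 2 := by
    field_simp
    ring
  simp only [Pi.add_apply]
  nlinarith

theorem dotProduct_add_self_le_two (x y : a → ℝ) :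
    (x + y) ⬝ᵥ (x + y) ≤ 2 * (x ⬝ᵥ x) + 2 * (y ⬝ᵥ y) := by
  have := dotProduct_add_self_le one_pos x y
  rw [inv_one, one_add_one_eq_two] at this
  exact this

theorem dotProduct_sub_self_le_two (x y : a → ℝ) :
    (x - y) ⬝ᵥ (x - y) ≤ 2 * (x ⬝ᵥ x) + 2 * (y ⬝ᵥ y) := by
  have := dotProduct_add_self_le_two x (-y)
  simpa [sub_eq_add_neg] using this

theorem euclNorm_sq {n : ℕ} (v : Fin n → ℝ) : euclNorm v ^ 2 = v ⬝ᵥ v := by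
  rw [euclNorm, EuclideanSpace.norm_sq_eq]
  simp [dotProduct, sq]

theorem euclNorm_nonneg {n : ℕ} (v : Fin n → ℝ) : 0 ≤ euclNorm v := norm_nonneg _

theorem norm_sq_le_dotProduct {n : ℕ} (v : Fin n → ℝ) : ‖v‖ ^ 2 ≤ v ⬝ᵥ v := by
  have h : ‖v‖ ≤ euclNorm v :=
    (pi_norm_le_iff_of_nonneg (euclNorm_nonneg v)).2 fun i =>
      PiLp.norm_apply_le (p := 2) (WithLp.toLp 2 v : EuclideanSpace ℝ (Fin n)) i
  rw [← euclNorm_sq]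
  gcongr

theorem dotProduct_self_le_norm_sq {n : ℕ} (v : Fin n → ℝ) : v ⬝ᵥ v ≤ n * ‖v‖ ^ 2 := by
  have h : ∀ i ∈ (Finset.univ : Finset (Fin n)), v i * v i ≤ ‖v‖ ^ 2 := fun i _ => by
    have := norm_le_pi_norm v i
    rw [Real.norm_eq_abs] at this
    rw [← abs_mul_abs_self, ← sq]
    gcongr
  have := Finset.sum_le_sum h
  simpa [dotProduct] using this

/-- If `|M v|² ≤ c |v|²` for all `v`, then the same holds for the transpose. -/
theorem transpose_mulVec_sq_le {M : Matrix a b ℝ} {c : ℝ} (hc : 0 ≤ c)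
    (h : ∀ v, (M *ᵥ v) ⬝ᵥ (M *ᵥ v) ≤ c * (v ⬝ᵥ v)) (v : a → ℝ) :
    (Mᵀ *ᵥ v) ⬝ᵥ (Mᵀ *ᵥ v) ≤ c * (v ⬝ᵥ v) := by
  set x := Mᵀ *ᵥ v with hx
  have h1 : x ⬝ᵥ x = v ⬝ᵥ (M *ᵥ x) := by
    conv_lhs => rw [hx, mulVec_transpose, ← dotProduct_mulVec, ← mulVec_transpose, ← hx]
  have h2 := dotProduct_sq_le v (M *ᵥ x)
  rw [← h1] at h2
  have h3 := h x
  have h4 := dotProduct_self_nonneg' x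
  have h5 := dotProduct_self_nonneg' v
  by_contra hlt
  push Not at hlt
  have h6 : 0 ≤ c * (v ⬝ᵥ v) := mul_nonneg hc h5
  have h7 : 0 < x ⬝ᵥ x := lt_of_le_of_lt h6 hlt
  nlinarith [mul_le_mul_of_nonneg_left h3 h5]

theorem quad_le_of_mulVec_sq_le {M : Matrix a a ℝ} {c : ℝ}
    (h : ∀ v, (M *ᵥ v) ⬝ᵥ (M *ᵥ v) ≤ c * (v ⬝ᵥ v)) (v : a → ℝ) :
    v ⬝ᵥ (M *ᵥ v) ≤ (1 + c) * (v ⬝ᵥ v) := by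
  have h1 := dotProduct_self_nonneg' (v - M *ᵥ v)
  have h2 := h v
  have h3 : (v - M *ᵥ v) ⬝ᵥ (v - M *ᵥ v) = v ⬝ᵥ v - 2 * (v ⬝ᵥ (M *ᵥ v))
      + (M *ᵥ v) ⬝ᵥ (M *ᵥ v) := by
    rw [sub_dotProduct, dotProduct_sub, dotProduct_sub, dotProduct_comm (M *ᵥ v) v]; ring
  have h4 := dotProduct_self_nonneg' (M *ᵥ v)
  have h5 := dotProduct_self_nonneg' v
  linarith

theorem Matrix.PosSemidef.abs_apply_le {P : Matrix a a ℝ} (hP : P.PosSemidef) {c : ℝ}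
    (h : ∀ v, v ⬝ᵥ (P *ᵥ v) ≤ c * (v ⬝ᵥ v)) (i j : a) : |P i j| ≤ c := by
  classical
  have diag : ∀ i, P i i ≤ c := fun i => by
    have := h (Pi.single i 1)
    simpa using this
  have hs : P j i = P i j := congrFun (congrFun hP.transpose_eq i) j
  -- Testing on eᵢ ± eⱼ gives 2|Pᵢⱼ| ≤ Pᵢᵢ + Pⱼⱼ.
  have h1 := hP.quad_nonneg (Pi.single i 1 + Pi.single j 1)
  have h2 := hP.quad_nonneg (Pi.single i 1 - Pi.single j 1)
  simp only [mulVec_add, mulVec_sub, dotProduct_add, add_dotProduct, dotProduct_sub,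
    sub_dotProduct, mulVec_single_one, single_one_dotProduct, col_apply] at h1 h2
  have := diag i
  have := diag j
  rw [abs_le]
  constructor <;> linarith

end

/-! ### Uniformly bounded sequences of matrices -/

section

/-- A sequence of real matrices is uniformly bounded in (the square of the) operator norm. -/
def OpBdd {α β : ℕ → Type*} [∀ k, Fintype (α k)] [∀ k, Fintype (β k)]
    (M : ∀ k, Matrix (α k) (β k) ℝ) : Prop :=
  ∃ c : ℝ, 0 ≤ c ∧ ∀ k v, (M k *ᵥ v) ⬝ᵥ (M k *ᵥ v) ≤ c * (v ⬝ᵥ v)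

variable {α β γ : ℕ → Type*} [∀ k, Fintype (α k)] [∀ k, Fintype (β k)] [∀ k, Fintype (γ k)]
  {M N : ∀ k, Matrix (α k) (β k) ℝ}

theorem OpBdd.mul (hM : OpBdd M) {L : ∀ k, Matrix (β k) (γ k) ℝ} (hL : OpBdd L) :
    OpBdd fun k => M k * L k := by
  obtain ⟨c, hc, h⟩ := hM
  obtain ⟨d, hd, h'⟩ := hL
  refine ⟨c * d, mul_nonneg hc hd, fun k v => ?_⟩
  rw [← mulVec_mulVec, mul_assoc]
  exact (h k _).trans (mul_le_mul_of_nonneg_left (h' k v) hc)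

theorem OpBdd.add (hM : OpBdd M) (hN : OpBdd N) : OpBdd fun k => M k + N k := by
  obtain ⟨c, hc, h⟩ := hM
  obtain ⟨d, hd, h'⟩ := hN
  refine ⟨2 * c + 2 * d, by positivity, fun k v => ?_⟩
  rw [add_mulVec]
  have := dotProduct_add_self_le_two (M k *ᵥ v) (N k *ᵥ v)
  linarith [h k v, h' k v]

theorem OpBdd.neg (hM : OpBdd M) : OpBdd fun k => -M k := by
  obtain ⟨c, hc, h⟩ := hM
  exact ⟨c, hc, fun k v => by simpa [neg_mulVec] using h k v⟩

theorem OpBdd.sub (hM : OpBdd M) (hN : OpBdd N) : OpBdd fun k => M k - N k := by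
  simpa only [sub_eq_add_neg] using hM.add hN.neg

theorem OpBdd.transpose (hM : OpBdd M) : OpBdd fun k => (M k)ᵀ := by
  obtain ⟨c, hc, h⟩ := hM
  exact ⟨c, hc, fun k => transpose_mulVec_sq_le hc (h k)⟩

theorem OpBdd.succ (hM : OpBdd M) :
    OpBdd (α := fun k => α (k + 1)) (β := fun k => β (k + 1)) fun k => M (k + 1) := by
  obtain ⟨c, hc, h⟩ := hM
  exact ⟨c, hc, fun k => h (k + 1)⟩

theorem OpBdd.of_isometry [∀ k, DecidableEq (β k)] (h : ∀ k, (M k)ᵀ * M k = 1) : OpBdd M :=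
  ⟨1, zero_le_one, fun k v => by
    rw [← dotProduct_transpose_mul_mulVec, h, one_mulVec, one_mul]⟩

theorem OpBdd.one [∀ k, DecidableEq (α k)] :
    OpBdd (α := α) (β := α) fun k => (1 : Matrix (α k) (α k) ℝ) :=
  OpBdd.of_isometry (α := α) (β := α) fun k => by rw [transpose_one, Matrix.one_mul]

theorem OpBdd.of_boundedSeq {a b : ℕ → ℕ} {M : ∀ k, Matrix (Fin (a k)) (Fin (b k)) ℝ}
    (hM : BoundedSeq M) {D : ℕ} (ha : ∀ k, a k ≤ D) (hb : ∀ k, b k ≤ D) : OpBdd M := by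
  obtain ⟨c, h⟩ := hM
  refine ⟨D * (D * c ^ 2), by positivity, fun k v => ?_⟩
  have hv := dotProduct_self_nonneg' v
  have h1 : ∀ i ∈ (Finset.univ : Finset (Fin (a k))),
      (M k *ᵥ v) i * (M k *ᵥ v) i ≤ D * c ^ 2 * (v ⬝ᵥ v) := fun i _ => by
    rw [← sq]
    refine (dotProduct_sq_le (M k i) v).trans (mul_le_mul_of_nonneg_right ?_ hv)
    have h2 : ∀ j ∈ (Finset.univ : Finset (Fin (b k))), M k i j * M k i j ≤ c ^ 2 := fun j _ => by
      rw [← abs_mul_abs_self, ← sq]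
      exact pow_le_pow_left₀ (abs_nonneg _) (h k i j) 2
    have h3 := Finset.sum_le_sum h2
    rw [Finset.sum_const, Finset.card_univ, Fintype.card_fin, nsmul_eq_mul] at h3
    refine h3.trans (mul_le_mul_of_nonneg_right ?_ (sq_nonneg c))
    exact_mod_cast hb k
  have h3 := Finset.sum_le_sum h1
  rw [Finset.sum_const, Finset.card_univ, Fintype.card_fin, nsmul_eq_mul] at h3
  refine h3.trans ?_
  have h4 : (a k : ℝ) ≤ D := by exact_mod_cast ha k
  have h5 := mul_le_mul_of_nonneg_right h4 (by positivity : 0 ≤ D * c ^ 2 * (v ⬝ᵥ v))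
  linarith

theorem OpBdd.quad {P : ∀ k, Matrix (α k) (α k) ℝ} (hP : OpBdd P) :
    ∃ c : ℝ, 0 ≤ c ∧ ∀ k v, v ⬝ᵥ (P k *ᵥ v) ≤ c * (v ⬝ᵥ v) := by
  obtain ⟨c, hc, h⟩ := hP
  exact ⟨1 + c, by positivity, fun k => quad_le_of_mulVec_sq_le (h k)⟩

/-- Positive definite matrices with bounded inverses are uniformly bounded below. -/
theorem OpBdd.quad_ge_of_inv [∀ k, DecidableEq (α k)] {P : ∀ k, Matrix (α k) (α k) ℝ}
    (hP : ∀ k, (P k).PosDef) (h : OpBdd fun k => (P k)⁻¹) :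
    ∃ r : ℝ, 0 < r ∧ ∀ k v, r * (v ⬝ᵥ v) ≤ v ⬝ᵥ (P k *ᵥ v) := by
  obtain ⟨c, hc, h⟩ := h.quad
  refine ⟨(1 + c)⁻¹, by positivity, fun k v => ?_⟩
  have hu : IsUnit (P k).det := (isUnit_iff_isUnit_det _).1 (hP k).isUnit
  -- With s = (1 + c)⁻¹, this expands to vᵀPv - 2s|v|² + s² vᵀP⁻¹v ≥ 0; the last term is at most
  -- s|v|², which leaves vᵀPv ≥ s|v|².
  have h0 := (hP k).inv.posSemidef.quad_nonneg (P k *ᵥ v - (1 + c)⁻¹ • v)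
  have e1 : (P k)⁻¹ *ᵥ (P k *ᵥ v) = v := by
    rw [mulVec_mulVec, nonsing_inv_mul _ hu, one_mulVec]
  have e2 : (P k *ᵥ v) ⬝ᵥ ((P k)⁻¹ *ᵥ v) = v ⬝ᵥ v := by
    rw [dotProduct_mulVec, ← mulVec_transpose, (hP k).inv.posSemidef.transpose_eq, e1]
  rw [mulVec_sub, mulVec_smul, e1, sub_dotProduct, dotProduct_sub, dotProduct_sub,
    dotProduct_smul, smul_dotProduct, smul_dotProduct, dotProduct_smul, e2,
    dotProduct_comm _ v] at h0
  simp only [smul_eq_mul] at h0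
  have h1 := h k v
  have hv := dotProduct_self_nonneg' v
  have h2 : (1 + c)⁻¹ * ((1 + c)⁻¹ * (v ⬝ᵥ ((P k)⁻¹ *ᵥ v))) ≤ (1 + c)⁻¹ * (v ⬝ᵥ v) := by
    refine mul_le_mul_of_nonneg_left ?_ (by positivity)
    rw [inv_mul_le_iff₀ (by positivity)]
    linarith
  linarith

/-- Inverses of positive definite matrices that are uniformly bounded below are bounded. -/
theorem OpBdd.inv_of_quad_ge [∀ k, DecidableEq (α k)] {P : ∀ k, Matrix (α k) (α k) ℝ}
    (hP : ∀ k, (P k).PosDef) {r : ℝ} (hr : 0 < r)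
    (h : ∀ k v, r * (v ⬝ᵥ v) ≤ v ⬝ᵥ (P k *ᵥ v)) : OpBdd fun k => (P k)⁻¹ := by
  refine ⟨(r ^ 2)⁻¹, by positivity, fun k v => ?_⟩
  have hu : IsUnit (P k).det := (isUnit_iff_isUnit_det _).1 (hP k).isUnit
  set x := (P k)⁻¹ *ᵥ v with hx
  have e1 : P k *ᵥ x = v := by rw [hx, mulVec_mulVec, mul_nonsing_inv _ hu, one_mulVec]
  have h1 := h k x
  rw [e1] at h1
  have h2 := dotProduct_sq_le x v
  have hx0 := dotProduct_self_nonneg' x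
  rw [← div_eq_inv_mul, le_div_iff₀ (by positivity)]
  by_contra hlt
  push Not at hlt
  have hv0 := dotProduct_self_nonneg' v
  have hxp : 0 < x ⬝ᵥ x := by
    rcases hx0.eq_or_lt with h0 | h0
    · rw [← h0] at hlt; linarith
    · exact h0
  have h3 : (r * (x ⬝ᵥ x)) ^ 2 ≤ (x ⬝ᵥ v) ^ 2 := pow_le_pow_left₀ (by positivity) h1 2
  nlinarith [mul_lt_mul_of_pos_left hlt hxp]

end

/-! ### Windows of a scalar inequality -/

/-- Here `a` stands for squared state norms and `o` for output energies. Blocks of length t each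
contract by δ up to output, and enough of them beat the growth α^(s+1) of the remaining steps. -/
theorem exists_window_contraction {α δ c : ℝ} (hα : 1 ≤ α) (hδ0 : 0 ≤ δ) (hδ : δ < 1)
    (hc : 0 ≤ c) (s t : ℕ) :
    ∃ (T : ℕ) (c' : ℝ), 1 ≤ T ∧ 0 < c' ∧ ∀ a o : ℕ → ℝ, (∀ i, 0 ≤ o i) → 0 ≤ a 0 →
      (∀ i < T, a (i + 1) ≤ α * a i) →
      (∀ j, j + s + t + 1 ≤ T → a (j + t) ≤ δ * a j + c * ∑ i ∈ Finset.range (s + 1), o (j + i)) →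
      a T ≤ 1 / 2 * a 0 + c' * ∑ i ∈ Finset.range T, o i := by
  have hαs : 0 < α ^ (s + 1) := by positivity
  obtain ⟨r, hr⟩ := exists_pow_lt_of_lt_one (show 0 < (1 / 2) / α ^ (s + 1) by positivity) hδ
  -- The s + 1 steps after the r blocks make the observation window of the last block fit. Each
  -- block may be charged the whole output sum, whence r * c; the final + 1 only ensures positivity.
  refine ⟨r * t + s + 1, α ^ (s + 1) * (r * c) + 1, by omega, by positivity, ?_⟩
  intro a o ho ha0 ha hw
  set T := r * t + s + 1 with hT
  set O := ∑ i ∈ Finset.range T, o i with hO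
  have hO0 : 0 ≤ O := Finset.sum_nonneg fun i _ => ho i
  have h1 : ∀ i ≤ r, a (i * t) ≤ δ ^ i * a 0 + i * c * O := by
    intro i
    induction i with
    | zero => intro _; simp
    | succ i ih =>
      intro hi
      have hi' := ih (by omega)
      have hit : i * t + t ≤ r * t := by
        rw [← Nat.succ_mul]; exact Nat.mul_le_mul_right t hi
      have h2 := hw (i * t) (by omega)
      have h3 : ∑ m ∈ Finset.range (s + 1), o (i * t + m) ≤ O := by
        rw [hO, Finset.range_eq_Ico, Finset.sum_Ico_add]
        refine Finset.sum_le_sum_of_subset_of_nonneg ?_ fun i _ _ => ho i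
        intro m hm
        rw [Finset.mem_Ico] at hm
        rw [Finset.mem_range]
        omega
      have h4 : δ * (i * c * O) ≤ i * c * O := mul_le_of_le_one_left (by positivity) hδ.le
      have h5 := mul_le_mul_of_nonneg_left hi' hδ0
      have h6 := mul_le_mul_of_nonneg_left h3 hc
      rw [Nat.succ_mul, pow_succ]
      push_cast
      nlinarith
  have h2 : ∀ i ≤ s + 1, a (r * t + i) ≤ α ^ i * a (r * t) := by
    intro i
    induction i with
    | zero => intro _; simp
    | succ i ih =>
      intro hi
      have h3 := ha (r * t + i) (by omega)
      have h4 := mul_le_mul_of_nonneg_left (ih (by omega)) (by linarith : 0 ≤ α)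
      rw [pow_succ, ← add_assoc]
      linarith
  have h3 := h2 (s + 1) le_rfl
  have h4 := mul_le_mul_of_nonneg_left (h1 r le_rfl) hαs.le
  have h5 : α ^ (s + 1) * δ ^ r ≤ 1 / 2 := by
    rw [mul_comm]; exact ((lt_div_iff₀ hαs).1 hr).le
  have h6 := mul_le_mul_of_nonneg_right h5 ha0
  rw [hT, add_assoc]
  nlinarith

/-! ### Transition matrices -/

section

variable {n : ℕ} (A : ℕ → Matrix (Fin n) (Fin n) ℝ)

theorem transition_add (k i j : ℕ) :
    transition A k (i + j) = transition A (k + i) j * transition A k i := by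
  induction j with
  | zero => simp [transition]
  | succ j ih => rw [← add_assoc, transition, ih, transition, Matrix.mul_assoc, add_assoc]

theorem transition_succ' (k j : ℕ) :
    transition A k (j + 1) = transition A (k + 1) j * A k := by
  rw [add_comm, transition_add]; simp [transition]

variable {A}

/-- Uniform detectability: over a suitable window, trajectories contract up to their output. -/
theorem UniformlyDetectable.exists_window (hA : OpBdd A) {q : ℕ → ℕ}
    {C : ∀ k, Matrix (Fin (q k)) (Fin n) ℝ} (h : UniformlyDetectable A C) :
    ∃ (T : ℕ) (c : ℝ), 1 ≤ T ∧ 0 < c ∧ ∀ k ξ,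
      (transition A k T *ᵥ ξ) ⬝ᵥ (transition A k T *ᵥ ξ) ≤ 1 / 2 * (ξ ⬝ᵥ ξ) +
        c * ∑ i ∈ Finset.range T, ((C (k + i) * transition A k i) *ᵥ ξ) ⬝ᵥ
          ((C (k + i) * transition A k i) *ᵥ ξ) := by
  obtain ⟨s, t, d, b, hd0, hd1, hb, h⟩ := h
  obtain ⟨α', hα0, hα⟩ := hA
  set α := α' + 1
  have hα1 : ∀ k v, (A k *ᵥ v) ⬝ᵥ (A k *ᵥ v) ≤ α * (v ⬝ᵥ v) := fun k v =>
    (hα k v).trans (mul_le_mul_of_nonneg_right (by simp [α]) (dotProduct_self_nonneg' v))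
  have hαt : ∀ k j ξ, (transition A k j *ᵥ ξ) ⬝ᵥ (transition A k j *ᵥ ξ) ≤ α ^ j * (ξ ⬝ᵥ ξ) := by
    intro k j ξ
    induction j with
    | zero => simp [transition]
    | succ j ih =>
      rw [transition, ← mulVec_mulVec, pow_succ', mul_assoc]
      exact (hα1 _ _).trans (mul_le_mul_of_nonneg_left ih (by positivity))
  obtain ⟨T, c, hT, hc, hw⟩ := exists_window_contraction (α := α) (δ := d ^ 2)
    (c := α ^ t / b) (by simp [α, hα0]) (sq_nonneg d) (by nlinarith) (by positivity) s t
  refine ⟨T, c, hT, hc, fun k ξ => ?_⟩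
  have h1 := hw (fun i => (transition A k i *ᵥ ξ) ⬝ᵥ (transition A k i *ᵥ ξ))
    (fun i => ((C (k + i) * transition A k i) *ᵥ ξ) ⬝ᵥ ((C (k + i) * transition A k i) *ᵥ ξ))
    (fun i => dotProduct_self_nonneg' _) (dotProduct_self_nonneg' _) ?_ ?_
  · simpa [transition] using h1
  · intro i _
    simp only [transition, ← mulVec_mulVec]
    exact hα1 _ _
  · intro j _
    set z := transition A k j *ᵥ ξ with hz
    have e1 : transition A k (j + t) *ᵥ ξ = transition A (k + j) t *ᵥ z := by
      rw [transition_add, ← mulVec_mulVec]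
    have e2 : ∀ i, ((C (k + (j + i)) * transition A k (j + i)) *ᵥ ξ) ⬝ᵥ
          ((C (k + (j + i)) * transition A k (j + i)) *ᵥ ξ) =
        ((C (k + j + i) * transition A (k + j) i) *ᵥ z) ⬝ᵥ
          ((C (k + j + i) * transition A (k + j) i) *ᵥ z) := fun i => by
      rw [transition_add, ← Matrix.mul_assoc, ← mulVec_mulVec, ← add_assoc]
    simp only [e1, e2]
    have hobs : z ⬝ᵥ (obsGramian A C (k + j) s *ᵥ z) = ∑ i ∈ Finset.range (s + 1),
        ((C (k + j + i) * transition A (k + j) i) *ᵥ z) ⬝ᵥ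
          ((C (k + j + i) * transition A (k + j) i) *ᵥ z) := by
      rw [obsGramian, sum_mulVec, dotProduct_sum]
      exact Finset.sum_congr rfl fun i _ => dotProduct_transpose_mul_mulVec _ _
    rw [← hobs]
    have hobs0 : 0 ≤ z ⬝ᵥ (obsGramian A C (k + j) s *ᵥ z) := by
      rw [hobs]; exact Finset.sum_nonneg fun i _ => dotProduct_self_nonneg' _
    -- If the state has not contracted, the Gramian bounds |z|² by output/b, and t steps grow it by
    -- at most α^t; otherwise it contracts by d².
    rcases le_total (d * euclNorm z) (euclNorm (transition A (k + j) t *ᵥ z)) with hle | hle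
    · have h2 := h _ z hle
      have h3 := hαt (k + j) t z
      have h4 : z ⬝ᵥ z ≤ (z ⬝ᵥ (obsGramian A C (k + j) s *ᵥ z)) / b := by
        rw [le_div_iff₀ hb]; linarith
      have h5 := mul_le_mul_of_nonneg_left h4 (by positivity : 0 ≤ α ^ t)
      have h6 := mul_nonneg (sq_nonneg d) (dotProduct_self_nonneg' z)
      have h7 : α ^ t / b * (z ⬝ᵥ (obsGramian A C (k + j) s *ᵥ z)) =
        α ^ t * ((z ⬝ᵥ (obsGramian A C (k + j) s *ᵥ z)) / b) := by ring
      rw [h7]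
      linarith
    · have h2 := pow_le_pow_left₀ (euclNorm_nonneg _) hle 2
      rw [mul_pow, euclNorm_sq, euclNorm_sq] at h2
      have : 0 ≤ α ^ t / b * (z ⬝ᵥ (obsGramian A C (k + j) s *ᵥ z)) := by positivity
      linarith

/-- Uniform stabilizability: over a suitable window, trajectories of the adjoint system contract
up to their output. -/
theorem UniformlyStabilizable.exists_window (hA : OpBdd A) {q : ℕ → ℕ}
    {B : ∀ k, Matrix (Fin n) (Fin (q k)) ℝ} (h : UniformlyStabilizable A B) :
    ∃ (T : ℕ) (c : ℝ), 1 ≤ T ∧ 0 < c ∧ ∀ k, T ≤ k → ∀ ξ,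
      ((transition A (k - T) T)ᵀ *ᵥ ξ) ⬝ᵥ ((transition A (k - T) T)ᵀ *ᵥ ξ) ≤ 1 / 2 * (ξ ⬝ᵥ ξ) +
        c * ∑ i ∈ Finset.range T,
          ((B (k - i - 1))ᵀ *ᵥ ((transition A (k - i) i)ᵀ *ᵥ ξ)) ⬝ᵥ
          ((B (k - i - 1))ᵀ *ᵥ ((transition A (k - i) i)ᵀ *ᵥ ξ)) := by
  obtain ⟨s, t, d, b, hd0, hd1, hb, h⟩ := h
  obtain ⟨α', hα0, hα⟩ := hA.transpose
  set α := α' + 1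
  have hα1 : ∀ k v, ((A k)ᵀ *ᵥ v) ⬝ᵥ ((A k)ᵀ *ᵥ v) ≤ α * (v ⬝ᵥ v) := fun k v =>
    (hα k v).trans (mul_le_mul_of_nonneg_right (by simp [α]) (dotProduct_self_nonneg' v))
  have hαt : ∀ j k ξ, ((transition A k j)ᵀ *ᵥ ξ) ⬝ᵥ ((transition A k j)ᵀ *ᵥ ξ)
      ≤ α ^ j * (ξ ⬝ᵥ ξ) := by
    intro j
    induction j with
    | zero => intro k ξ; simp [transition]
    | succ j ih =>
      intro k ξ
      rw [transition_succ', transpose_mul, ← mulVec_mulVec, pow_succ', mul_assoc]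
      exact (hα1 _ _).trans (mul_le_mul_of_nonneg_left (ih _ _) (by positivity))
  obtain ⟨T, c, hT, hc, hw⟩ := exists_window_contraction (α := α) (δ := d ^ 2)
    (c := α ^ t / b) (by simp [α, hα0]) (sq_nonneg d) (by nlinarith) (by positivity) s t
  refine ⟨T, c, hT, hc, fun k hk ξ => ?_⟩
  have h1 := hw (fun i => ((transition A (k - i) i)ᵀ *ᵥ ξ) ⬝ᵥ ((transition A (k - i) i)ᵀ *ᵥ ξ))
    (fun i => ((B (k - i - 1))ᵀ *ᵥ ((transition A (k - i) i)ᵀ *ᵥ ξ)) ⬝ᵥ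
          ((B (k - i - 1))ᵀ *ᵥ ((transition A (k - i) i)ᵀ *ᵥ ξ)))
    (fun i => dotProduct_self_nonneg' _) (dotProduct_self_nonneg' _) ?_ ?_
  · simpa [transition] using h1
  · intro i hi
    rw [transition_succ', transpose_mul, ← mulVec_mulVec,
      show k - (i + 1) + 1 = k - i by omega]
    exact hα1 _ _
  · intro j hj
    set z := (transition A (k - j) j)ᵀ *ᵥ ξ with hz
    -- Adjoint time runs backwards from k. Since j + s + t + 1 ≤ T ≤ k, all windows used below lie
    -- in the time range and the natural subtractions do not truncate.
    have e0 : ∀ i, j + i ≤ k → (transition A (k - (j + i)) (j + i))ᵀ *ᵥ ξ =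
        (transition A (k - j - i) i)ᵀ *ᵥ z := fun i hi => by
      rw [add_comm j i, transition_add, transpose_mul, ← mulVec_mulVec,
        show k - (i + j) + i = k - j by omega, show k - (i + j) = k - j - i by omega]
    have e2 : ∀ i ∈ Finset.range (s + 1),
        ((B (k - (j + i) - 1))ᵀ *ᵥ ((transition A (k - (j + i)) (j + i))ᵀ *ᵥ ξ)) ⬝ᵥ
          ((B (k - (j + i) - 1))ᵀ *ᵥ ((transition A (k - (j + i)) (j + i))ᵀ *ᵥ ξ)) =
        z ⬝ᵥ ((transition A (k - j - i) i * B (k - j - i - 1)) *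
          (transition A (k - j - i) i * B (k - j - i - 1))ᵀ) *ᵥ z := fun i hi => by
      rw [Finset.mem_range] at hi
      have := dotProduct_transpose_mul_mulVec
        ((transition A (k - j - i) i * B (k - j - i - 1))ᵀ) z
      rw [transpose_transpose] at this
      rw [this, e0 i (by omega), show k - (j + i) - 1 = k - j - i - 1 by omega, transpose_mul,
        mulVec_mulVec]
    rw [e0 t (by omega), Finset.sum_congr rfl e2, ← dotProduct_sum, ← sum_mulVec]
    change _ ≤ _ + _ * (z ⬝ᵥ (ctrGramian A B (k - j) s *ᵥ z))
    have hobs0 : 0 ≤ z ⬝ᵥ (ctrGramian A B (k - j) s *ᵥ z) := by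
      rw [ctrGramian, sum_mulVec, dotProduct_sum, ← Finset.sum_congr rfl e2]
      exact Finset.sum_nonneg fun i _ => dotProduct_self_nonneg' _
    rcases le_total (d * euclNorm z) (euclNorm ((transition A (k - j - t) t)ᵀ *ᵥ z)) with hle | hle
    · have h2 := h _ z (by omega) (by omega) hle
      have h3 := hαt t (k - j - t) z
      have h4 : z ⬝ᵥ z ≤ (z ⬝ᵥ (ctrGramian A B (k - j) s *ᵥ z)) / b := by
        rw [le_div_iff₀ hb]; linarith
      have h5 := mul_le_mul_of_nonneg_left h4 (by positivity : 0 ≤ α ^ t)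
      have h6 := mul_nonneg (sq_nonneg d) (dotProduct_self_nonneg' z)
      have h7 : α ^ t / b * (z ⬝ᵥ (ctrGramian A B (k - j) s *ᵥ z)) =
        α ^ t * ((z ⬝ᵥ (ctrGramian A B (k - j) s *ᵥ z)) / b) := by ring
      rw [h7]
      linarith
    · have h2 := pow_le_pow_left₀ (euclNorm_nonneg _) hle 2
      rw [mul_pow, euclNorm_sq, euclNorm_sq] at h2
      have : 0 ≤ α ^ t / b * (z ⬝ᵥ (ctrGramian A B (k - j) s *ᵥ z)) := by positivity
      linarith

/-! ### Boundedness of the Riccati recursion -/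

/-- Unrolls the one-step inequality along an arbitrary control sequence. `V` need not be quadratic,
and the cost constant depends on T but not on the starting time. -/
theorem quad_transition_le {q : ℕ → ℕ} {C : ∀ k, Matrix (Fin (q k)) (Fin n) ℝ}
    {V : ℕ → (Fin n → ℝ) → ℝ} {α γ κ : ℝ} (hα0 : 0 ≤ α) (hγ0 : 0 ≤ γ) (hκ : 0 ≤ κ)
    (hα : ∀ k v, ((A k)ᵀ *ᵥ v) ⬝ᵥ ((A k)ᵀ *ᵥ v) ≤ α * (v ⬝ᵥ v))
    (hγ : ∀ k v, ((C k)ᵀ *ᵥ v) ⬝ᵥ ((C k)ᵀ *ᵥ v) ≤ γ * (v ⬝ᵥ v))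
    (hV : ∀ k v u, V (k + 1) v ≤ V k ((A k)ᵀ *ᵥ v - (C k)ᵀ *ᵥ u) + κ * (v ⬝ᵥ v + u ⬝ᵥ u))
    (T : ℕ) : ∃ c : ℝ, 0 ≤ c ∧ ∀ k v (u : ∀ i, Fin (q (k + i)) → ℝ),
      V (k + T) v ≤ V k ((transition A k T)ᵀ *ᵥ v -
        ∑ i ∈ Finset.range T, (C (k + i) * transition A k i)ᵀ *ᵥ u i) +
        c * (v ⬝ᵥ v + ∑ i ∈ Finset.range T, u i ⬝ᵥ u i) := by
  induction T with
  | zero => exact ⟨0, le_rfl, fun k v u => by simp [transition]⟩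
  | succ T ih =>
    obtain ⟨c, hc, ih⟩ := ih
    refine ⟨κ + c * (2 * α + 2 * γ + 1), by positivity, fun k v u => ?_⟩
    have h1 := hV (k + T) v (u T)
    set v' := (A (k + T))ᵀ *ᵥ v - (C (k + T))ᵀ *ᵥ u T with hv'
    have h2 := ih k v' u
    have e1 : (transition A k T)ᵀ *ᵥ v' -
        ∑ i ∈ Finset.range T, (C (k + i) * transition A k i)ᵀ *ᵥ u i =
        (transition A k (T + 1))ᵀ *ᵥ v -
        ∑ i ∈ Finset.range (T + 1), (C (k + i) * transition A k i)ᵀ *ᵥ u i := by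
      rw [Finset.sum_range_succ, transition, hv', mulVec_sub, mulVec_mulVec, mulVec_mulVec,
        transpose_mul, transpose_mul (C (k + T))]
      abel
    rw [e1] at h2
    have h3 : v' ⬝ᵥ v' ≤ 2 * (α * (v ⬝ᵥ v)) + 2 * (γ * (u T ⬝ᵥ u T)) := by
      have := dotProduct_sub_self_le_two ((A (k + T))ᵀ *ᵥ v) ((C (k + T))ᵀ *ᵥ u T)
      linarith [hα (k + T) v, hγ (k + T) (u T)]
    have hv := dotProduct_self_nonneg' v
    have hu := dotProduct_self_nonneg' (u T)
    have hs : 0 ≤ ∑ i ∈ Finset.range T, u i ⬝ᵥ u i :=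
      Finset.sum_nonneg fun i _ => dotProduct_self_nonneg' _
    rw [Finset.sum_range_succ fun i => u i ⬝ᵥ u i, ← add_assoc k T 1]
    set Y := V k ((transition A k (T + 1))ᵀ *ᵥ v -
        ∑ i ∈ Finset.range (T + 1), (C (k + i) * transition A k i)ᵀ *ᵥ u i)
    set v2 := v ⬝ᵥ v
    set u2 := u T ⬝ᵥ u T
    set s2 := ∑ i ∈ Finset.range T, u i ⬝ᵥ u i
    have h4 : v' ⬝ᵥ v' + s2 ≤ (2 * α + 2 * γ + 1) * (v2 + (s2 + u2)) := by
      have a1 : 0 ≤ α * s2 := by positivity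
      have a2 : 0 ≤ α * u2 := by positivity
      have a3 : 0 ≤ γ * s2 := by positivity
      have a4 : 0 ≤ γ * v2 := by positivity
      nlinarith
    have h5 := mul_le_mul_of_nonneg_left h4 hc
    have h6 : 0 ≤ κ * s2 := by positivity
    linarith

/-- Uniform detectability bounds every sequence of quadratic costs that satisfies the Riccati
inequality, started from a bounded cost. -/
theorem UniformlyDetectable.riccati_bounded (hA : OpBdd A) {q : ℕ → ℕ}
    {C : ∀ k, Matrix (Fin (q k)) (Fin n) ℝ} (hC : OpBdd C) (h : UniformlyDetectable A C)
    {V : ℕ → (Fin n → ℝ) → ℝ} {κ c₀ : ℝ} (hκ : 0 ≤ κ)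
    (hV : ∀ k v u, V (k + 1) v ≤ V k ((A k)ᵀ *ᵥ v - (C k)ᵀ *ᵥ u) + κ * (v ⬝ᵥ v + u ⬝ᵥ u))
    (hV0 : ∀ v, V 0 v ≤ c₀ * (v ⬝ᵥ v)) :
    ∃ c : ℝ, 0 ≤ c ∧ ∀ k v, V k v ≤ c * (v ⬝ᵥ v) := by
  obtain ⟨T, c₁, hT, hc₁, hw⟩ := h.exists_window hA
  obtain ⟨α, hα0, hα⟩ := hA.transpose
  obtain ⟨γ, hγ0, hγ⟩ := hC.transpose
  -- optimal control over one window
  obtain ⟨c₂, hc₂, hstep⟩ := quad_transition_le hα0 hγ0 hκ hα hγ hV T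
  have key : ∀ k v, ∃ v', v' ⬝ᵥ v' ≤ 1 / 2 * (v ⬝ᵥ v) ∧
      V (k + T) v ≤ V k v' + c₂ * (1 + c₁) * (v ⬝ᵥ v) := by
    intro k v
    set W : Matrix (Fin n) (Fin n) ℝ := ∑ i ∈ Finset.range T,
      (C (k + i) * transition A k i)ᵀ * (C (k + i) * transition A k i) with hW
    have hWp : W.PosSemidef := posSemidef_sum _ fun i _ => by
      simpa using posSemidef_conjTranspose_mul_self (C (k + i) * transition A k i)
    -- Chosen so that ½|x|² + c₁ xᵀWx = c₁(xᵀWx + ε|x|²), and so that ε c₁ = ½.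
    set ε : ℝ := 1 / (2 * c₁) with hε
    have hε0 : 0 < ε := by positivity
    have hpd : (W + ε • (1 : Matrix (Fin n) (Fin n) ℝ)).PosDef :=
      PosDef.posSemidef_add hWp (PosDef.one.smul hε0)
    -- Regularised least squares: the controls CᵢΦᵢx move Φᵀv to Φᵀv - Wx = εx, at energy xᵀWx. The
    -- identity σ = v·Φx with Cauchy–Schwarz and the window bound then gives σ ≤ c₁|v|², which
    -- controls both εx and the energy.
    set x := (W + ε • (1 : Matrix (Fin n) (Fin n) ℝ))⁻¹ *ᵥ ((transition A k T)ᵀ *ᵥ v) with hx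
    have ex : W *ᵥ x + ε • x = (transition A k T)ᵀ *ᵥ v := by
      have : (W + ε • (1 : Matrix (Fin n) (Fin n) ℝ)) *ᵥ x = (transition A k T)ᵀ *ᵥ v := by
        rw [hx, mulVec_mulVec, mul_nonsing_inv _ ((isUnit_iff_isUnit_det _).1 hpd.isUnit),
          one_mulVec]
      rwa [add_mulVec, smul_mulVec, one_mulVec] at this
    have hxW : x ⬝ᵥ (W *ᵥ x) = ∑ i ∈ Finset.range T, ((C (k + i) * transition A k i) *ᵥ x) ⬝ᵥ
          ((C (k + i) * transition A k i) *ᵥ x) := by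
      rw [hW, sum_mulVec, dotProduct_sum]
      exact Finset.sum_congr rfl fun i _ => dotProduct_transpose_mul_mulVec _ _
    set σ := x ⬝ᵥ (W *ᵥ x) + ε * (x ⬝ᵥ x) with hσ
    have hσ1 : σ = v ⬝ᵥ (transition A k T *ᵥ x) := by
      have := congrArg (x ⬝ᵥ ·) ex
      simp only [dotProduct_add, dotProduct_smul, smul_eq_mul] at this
      rw [hσ, this, dotProduct_mulVec, vecMul_transpose, dotProduct_comm]
    have hσ0 : 0 ≤ x ⬝ᵥ (W *ᵥ x) := hWp.quad_nonneg x
    have hx0 := dotProduct_self_nonneg' x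
    have hv0 := dotProduct_self_nonneg' v
    have h1 : (transition A k T *ᵥ x) ⬝ᵥ (transition A k T *ᵥ x) ≤ c₁ * σ := by
      have := hw k x
      rw [← hxW] at this
      have e : c₁ * σ = 1 / 2 * (x ⬝ᵥ x) + c₁ * (x ⬝ᵥ (W *ᵥ x)) := by
        rw [hσ, hε]; field_simp; ring
      rwa [e]
    have h2 : σ ≤ c₁ * (v ⬝ᵥ v) := by
      have h3 := dotProduct_sq_le v (transition A k T *ᵥ x)
      rw [← hσ1] at h3
      by_contra hlt
      push Not at hlt
      have h4 : 0 < σ := lt_of_le_of_lt (by positivity) hlt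
      nlinarith [mul_le_mul_of_nonneg_left h1 hv0]
    have hεx : 0 ≤ ε * (x ⬝ᵥ x) := by positivity
    refine ⟨ε • x, ?_, ?_⟩
    · rw [dotProduct_smul, smul_dotProduct, smul_eq_mul, smul_eq_mul]
      have h3 : ε * (x ⬝ᵥ x) ≤ c₁ * (v ⬝ᵥ v) := by linarith
      have h4 := mul_le_mul_of_nonneg_left h3 hε0.le
      have e : ε * (c₁ * (v ⬝ᵥ v)) = 1 / 2 * (v ⬝ᵥ v) := by rw [hε]; field_simp
      linarith
    · have h3 := hstep k v fun i => (C (k + i) * transition A k i) *ᵥ x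
      rw [← hxW] at h3
      have e : (transition A k T)ᵀ *ᵥ v - ∑ i ∈ Finset.range T,
          (C (k + i) * transition A k i)ᵀ *ᵥ ((C (k + i) * transition A k i) *ᵥ x) = ε • x := by
        rw [← ex, hW, sum_mulVec]
        simp only [mulVec_mulVec]
        abel
      rw [e] at h3
      refine h3.trans ?_
      have : c₂ * (v ⬝ᵥ v + x ⬝ᵥ (W *ᵥ x)) ≤ c₂ * ((1 + c₁) * (v ⬝ᵥ v)) :=
        mul_le_mul_of_nonneg_left (by linarith) hc₂
      linarith
  -- one-step bounds for the first window
  have init : ∀ i, ∃ c : ℝ, 0 ≤ c ∧ ∀ v, V i v ≤ c * (v ⬝ᵥ v) := by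
    intro i
    induction i with
    | zero =>
      exact ⟨|c₀|, abs_nonneg _, fun v => (hV0 v).trans
        (mul_le_mul_of_nonneg_right (le_abs_self _) (dotProduct_self_nonneg' v))⟩
    | succ i ih =>
      obtain ⟨c, hc, ih⟩ := ih
      refine ⟨c * α + κ, by positivity, fun v => ?_⟩
      have h1 := hV i v 0
      rw [mulVec_zero, sub_zero, dotProduct_zero, add_zero] at h1
      have h2 := ih ((A i)ᵀ *ᵥ v)
      have h3 := mul_le_mul_of_nonneg_left (hα i v) hc
      linarith
  choose ci hci0 hci using init
  -- The bound reproduces itself over a window: half of M pays for |v'|² ≤ ½|v|², the other half for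
  -- the cost c₂(1 + c₁)|v|². The sum covers times before T.
  set M := 2 * (c₂ * (1 + c₁)) + ∑ i ∈ Finset.range T, ci i with hM
  have hsum : 0 ≤ ∑ i ∈ Finset.range T, ci i := Finset.sum_nonneg fun i _ => hci0 i
  refine ⟨M, by positivity, fun k => ?_⟩
  induction k using Nat.strong_induction_on with
  | _ k ih =>
    intro v
    have hv0 := dotProduct_self_nonneg' v
    rcases lt_or_ge k T with hk | hk
    · refine (hci k v).trans (mul_le_mul_of_nonneg_right ?_ hv0)
      have := Finset.single_le_sum (f := ci) (fun i _ => hci0 i) (Finset.mem_range.2 hk)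
      have : 0 ≤ 2 * (c₂ * (1 + c₁)) := by positivity
      linarith
    · obtain ⟨v', h1, h2⟩ := key (k - T) v
      rw [Nat.sub_add_cancel hk] at h2
      have h3 := ih (k - T) (by omega) v'
      have hM0 : 0 ≤ M := by positivity
      have h4 := mul_le_mul_of_nonneg_left h1 hM0
      have h5 : c₂ * (1 + c₁) * (v ⬝ᵥ v) ≤ M / 2 * (v ⬝ᵥ v) :=
        mul_le_mul_of_nonneg_right (by linarith) hv0
      linarith

end

/-! ### Exponential decay from a Lyapunov identity and uniform stabilizability -/

theorem sum_bound_of_affine_recursion {a b : ℝ} (ha : 1 ≤ a) (hb : 0 ≤ b) {e f : ℕ → ℝ}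
    (hf : ∀ i, 0 ≤ f i) (h0 : e 0 = 0) {T : ℕ} (h : ∀ i < T, e (i + 1) ≤ a * e i + b * f i) :
    ∀ i ≤ T, e i ≤ a ^ T * b * ∑ j ∈ Finset.range T, f j := by
  have h1 : ∀ i ≤ T, e i ≤ a ^ i * b * ∑ j ∈ Finset.range i, f j := by
    intro i
    induction i with
    | zero => intro _; simp [h0]
    | succ i ih =>
      intro hi
      have h2 := h i (by omega)
      have h3 := mul_le_mul_of_nonneg_left (ih (by omega)) (by linarith : 0 ≤ a)
      have h4 : b * f i ≤ a ^ (i + 1) * (b * f i) :=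
        le_mul_of_one_le_left (mul_nonneg hb (hf i)) (one_le_pow₀ ha)
      rw [Finset.sum_range_succ, mul_add, pow_succ] at *
      linarith
  intro i hi
  refine (h1 i hi).trans ?_
  have h2 : ∑ j ∈ Finset.range i, f j ≤ ∑ j ∈ Finset.range T, f j :=
    Finset.sum_le_sum_of_subset_of_nonneg (Finset.range_mono hi) fun j _ _ => hf j
  have h3 : a ^ i ≤ a ^ T := pow_le_pow_right₀ ha hi
  have h4 : 0 ≤ ∑ j ∈ Finset.range i, f j := Finset.sum_nonneg fun j _ => hf j
  gcongr

section

variable {n : ℕ} {A : ℕ → Matrix (Fin n) (Fin n) ℝ}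

/-- Geometric decay of `Ψ` along a family of transition matrices from decay over windows. -/
theorem geometric_decay_of_window {Ac : ℕ → Matrix (Fin n) (Fin n) ℝ}
    {Ψ : ℕ → (Fin n → ℝ) → ℝ} {T : ℕ} (hT : 1 ≤ T) {η θ : ℝ} (hη : 1 ≤ η) (hθ0 : 0 < θ)
    (hθ1 : θ < 1) (hΨ : ∀ k v, 0 ≤ Ψ k v)
    (h1 : ∀ k v, Ψ k ((Ac k)ᵀ *ᵥ v) ≤ η * Ψ (k + 1) v)
    (hw : ∀ k v, Ψ k ((transition Ac k T)ᵀ *ᵥ v) ≤ θ * Ψ (k + T) v) :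
    ∃ M ρ : ℝ, 0 ≤ M ∧ 0 < ρ ∧ ρ < 1 ∧ ∀ k j v,
      Ψ k ((transition Ac k j)ᵀ *ᵥ v) ≤ M * ρ ^ j * Ψ (k + j) v := by
  -- The T-th root makes ρ^T = θ; the factor η^T / ρ^T below absorbs an incomplete window.
  set ρ : ℝ := θ ^ ((T : ℝ)⁻¹) with hρ
  have hT0 : T ≠ 0 := by omega
  have hρ0 : 0 < ρ := Real.rpow_pos_of_pos hθ0 _
  have hρ1 : ρ < 1 := Real.rpow_lt_one hθ0.le hθ1 (by positivity)
  have hρT : ρ ^ T = θ := Real.rpow_inv_natCast_pow hθ0.le hT0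
  have hs : ∀ j k v, Ψ k ((transition Ac k j)ᵀ *ᵥ v) ≤ η ^ j * Ψ (k + j) v := by
    intro j
    induction j with
    | zero => intro k v; simp [transition]
    | succ j ih =>
      intro k v
      have h2 := ih k ((Ac (k + j))ᵀ *ᵥ v)
      rw [mulVec_mulVec, ← transpose_mul] at h2
      rw [transition, pow_succ, ← add_assoc k j 1]
      have h3 := mul_le_mul_of_nonneg_left (h1 (k + j) v) (by positivity : 0 ≤ η ^ j)
      linarith
  refine ⟨η ^ T / ρ ^ T, ρ, by positivity, hρ0, hρ1, fun k j => ?_⟩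
  induction j using Nat.strong_induction_on with
  | _ j ih =>
    intro v
    rcases lt_or_ge j T with hj | hj
    · refine (hs j k v).trans (mul_le_mul_of_nonneg_right ?_ (hΨ _ _))
      have h2 : η ^ j ≤ η ^ T := pow_le_pow_right₀ hη hj.le
      have h3 : ρ ^ T ≤ ρ ^ j := pow_le_pow_of_le_one hρ0.le hρ1.le hj.le
      rw [div_mul_eq_mul_div, le_div_iff₀ (by positivity)]
      gcongr
    · obtain ⟨i, rfl⟩ := Nat.exists_eq_add_of_le' hj
      rw [transition_add, transpose_mul, ← mulVec_mulVec]
      refine (ih i (by omega) _).trans ?_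
      have h2 := mul_le_mul_of_nonneg_left (hw (k + i) v)
        (by positivity : 0 ≤ η ^ T / ρ ^ T * ρ ^ i)
      refine h2.trans (le_of_eq ?_)
      rw [pow_add, hρT, ← add_assoc]
      ring

/-- If quadratic costs `V k ≤ c |·|²` decrease along the adjoint of the closed loop
`A - K C` by at least the output energy plus a multiple of the control energy, and `(A, B)` is
uniformly stabilizable, then the closed loop decays exponentially. -/
theorem UniformlyStabilizable.closed_loop_decay (hA : OpBdd A) {q r : ℕ → ℕ}
    {B : ∀ k, Matrix (Fin n) (Fin (r k)) ℝ} (hB : OpBdd B) (h : UniformlyStabilizable A B)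
    {C : ∀ k, Matrix (Fin (q k)) (Fin n) ℝ} (hC : OpBdd C)
    (K : ∀ k, Matrix (Fin n) (Fin (q k)) ℝ)
    {V : ℕ → (Fin n → ℝ) → ℝ} {κ c : ℝ} (hκ : 0 < κ) (hc : 0 ≤ c)
    (hV0 : ∀ k v, 0 ≤ V k v) (hVc : ∀ k v, V k v ≤ c * (v ⬝ᵥ v))
    (hV : ∀ k v, V k ((A k - K k * C k)ᵀ *ᵥ v) + ((B k)ᵀ *ᵥ v) ⬝ᵥ ((B k)ᵀ *ᵥ v)
      + κ * (((K k)ᵀ *ᵥ v) ⬝ᵥ ((K k)ᵀ *ᵥ v)) ≤ V (k + 1) v) :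
    ∃ M ρ : ℝ, 0 ≤ M ∧ 0 < ρ ∧ ρ < 1 ∧ ∀ k j v,
      (transition (fun k => A k - K k * C k) k j *ᵥ v) ⬝ᵥ
        (transition (fun k => A k - K k * C k) k j *ᵥ v) ≤ M * ρ ^ j * (v ⬝ᵥ v) := by
  obtain ⟨T, c₁, hT, hc₁, hw⟩ := h.exists_window hA
  obtain ⟨α', hα0', hα'⟩ := hA.transpose
  obtain ⟨β, hβ0, hβ⟩ := hB.transpose
  obtain ⟨γ, hγ0, hγ⟩ := hC.transpose
  set α := α' + 1
  have hα0 : 1 ≤ α := by simp [α, hα0']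
  have hα : ∀ k v, ((A k)ᵀ *ᵥ v) ⬝ᵥ ((A k)ᵀ *ᵥ v) ≤ α * (v ⬝ᵥ v) := fun k v =>
    (hα' k v).trans (mul_le_mul_of_nonneg_right (by simp [α]) (dotProduct_self_nonneg' v))
  set Ac : ℕ → Matrix (Fin n) (Fin n) ℝ := fun k => A k - K k * C k with hAc
  -- one window
  set E := (2 * α) ^ T * (2 * γ) with hE
  have hE0 : 0 ≤ E := by positivity
  -- `E` bounds the deviation of open from closed loop per unit of control energy, and a drop Δ of V
  -- bounds that energy by Δ/κ and the output energy by Δ. `D` collects these contributions, with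
  -- the weights 3/2 and 3 of the splitting of y T below.
  set D := 3 / 2 * (c₁ * (2 + 2 * β * (T * (E / κ)))) + 3 * (E / κ) with hD
  have hD0 : 0 ≤ D := by positivity
  have window : ∀ k v, ((transition Ac k T)ᵀ *ᵥ v) ⬝ᵥ ((transition Ac k T)ᵀ *ᵥ v) ≤
      3 / 4 * (v ⬝ᵥ v) + D * (V (k + T) v - V k ((transition Ac k T)ᵀ *ᵥ v)) := by
    intro k v
    set y : ℕ → Fin n → ℝ := fun i => (transition Ac (k + T - i) i)ᵀ *ᵥ v with hy
    set z : ℕ → Fin n → ℝ := fun i => (transition A (k + T - i) i)ᵀ *ᵥ v with hz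
    have y0 : y 0 = v := by simp [hy, transition]
    have z0 : z 0 = v := by simp [hz, transition]
    have ystep : ∀ i < T, y (i + 1) = (Ac (k + T - i - 1))ᵀ *ᵥ y i := fun i hi => by
      simp only [hy]
      rw [transition_succ', transpose_mul, ← mulVec_mulVec,
        show k + T - (i + 1) + 1 = k + T - i by omega,
        show k + T - (i + 1) = k + T - i - 1 by omega]
    have zstep : ∀ i < T, z (i + 1) = (A (k + T - i - 1))ᵀ *ᵥ z i := fun i hi => by
      simp only [hz]
      rw [transition_succ', transpose_mul, ← mulVec_mulVec,
        show k + T - (i + 1) + 1 = k + T - i by omega,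
        show k + T - (i + 1) = k + T - i - 1 by omega]
    set f : ℕ → ℝ := fun i => ((K (k + T - i - 1))ᵀ *ᵥ y i) ⬝ᵥ ((K (k + T - i - 1))ᵀ *ᵥ y i)
      with hf
    set g : ℕ → ℝ := fun i => ((B (k + T - i - 1))ᵀ *ᵥ y i) ⬝ᵥ ((B (k + T - i - 1))ᵀ *ᵥ y i)
      with hg
    set e : ℕ → ℝ := fun i => (z i - y i) ⬝ᵥ (z i - y i) with he
    have hf0 : ∀ i, 0 ≤ f i := fun i => dotProduct_self_nonneg' _
    have hg0 : ∀ i, 0 ≤ g i := fun i => dotProduct_self_nonneg' _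
    -- Telescoping the decrease of V charges the output energies g and control energies f of the
    -- closed-loop path `y` to the total drop of V.
    have hcost : ∀ j ≤ T, ∑ i ∈ Finset.range j, (g i + κ * f i) + V (k + T - j) (y j)
        ≤ V (k + T) v := by
      intro j
      induction j with
      | zero => intro _; simp [y0]
      | succ j ih =>
        intro hj
        have h1 := ih (by omega)
        have h2 := hV (k + T - j - 1) (y j)
        rw [show k + T - j - 1 + 1 = k + T - j by omega] at h2
        rw [Finset.sum_range_succ, ystep j (by omega),
          show k + T - (j + 1) = k + T - j - 1 by omega]
        have h3 : V (k + T - j - 1) ((Ac (k + T - j - 1))ᵀ *ᵥ y j) + g j + κ * f j ≤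
          V (k + T - j) (y j) := h2
        linarith
    have hyT : y T = (transition Ac k T)ᵀ *ᵥ v := by simp [hy]
    have hzT : z T = (transition A k T)ᵀ *ᵥ v := by simp [hz]
    have hcT := hcost T le_rfl
    rw [Nat.add_sub_cancel, Finset.sum_add_distrib, ← Finset.mul_sum] at hcT
    set Δ := V (k + T) v - V k (y T) with hΔ
    have hsf0 : 0 ≤ ∑ i ∈ Finset.range T, f i := Finset.sum_nonneg fun i _ => hf0 i
    have hsg0 : 0 ≤ ∑ i ∈ Finset.range T, g i := Finset.sum_nonneg fun i _ => hg0 i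
    have hsf : ∑ i ∈ Finset.range T, f i ≤ Δ / κ := by
      rw [le_div_iff₀ hκ]; linarith
    have hsg : ∑ i ∈ Finset.range T, g i ≤ Δ := by
      have := mul_nonneg hκ.le hsf0
      linarith
    have hΔ0 : 0 ≤ Δ := hsg0.trans hsg
    -- The open-loop path `z` and the closed-loop path `y` start together, and only the feedback Kᵀy
    -- drives them apart.
    have herec : ∀ i < T, e (i + 1) ≤ 2 * α * e i + 2 * γ * f i := by
      intro i hi
      have e1 : z (i + 1) - y (i + 1) = (A (k + T - i - 1))ᵀ *ᵥ (z i - y i) +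
          (C (k + T - i - 1))ᵀ *ᵥ ((K (k + T - i - 1))ᵀ *ᵥ y i) := by
        rw [ystep i hi, zstep i hi, hAc]
        simp only [transpose_sub, transpose_mul, sub_mulVec, mulVec_sub, mulVec_mulVec]
        abel
      simp only [he, hf]
      rw [e1]
      refine (dotProduct_add_self_le_two _ _).trans ?_
      have h2 := hα (k + T - i - 1) (z i - y i)
      have h3 := hγ (k + T - i - 1) ((K (k + T - i - 1))ᵀ *ᵥ y i)
      linarith
    have heb : ∀ i ≤ T, e i ≤ E / κ * Δ := by
      intro i hi
      have h1 := sum_bound_of_affine_recursion (by linarith : 1 ≤ 2 * α)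
        (by positivity : 0 ≤ 2 * γ) hf0 (by simp [he, y0, z0]) herec i hi
      have h2 := mul_le_mul_of_nonneg_left hsf hE0
      calc e i ≤ E * ∑ j ∈ Finset.range T, f j := h1
        _ ≤ E * (Δ / κ) := h2
        _ = E / κ * Δ := by ring
    have hw1 := hw (k + T) (by omega) v
    rw [Nat.add_sub_cancel] at hw1
    have hout : ∀ i ∈ Finset.range T,
        ((B (k + T - i - 1))ᵀ *ᵥ ((transition A (k + T - i) i)ᵀ *ᵥ v)) ⬝ᵥ
          ((B (k + T - i - 1))ᵀ *ᵥ ((transition A (k + T - i) i)ᵀ *ᵥ v)) ≤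
        2 * g i + 2 * β * (E / κ * Δ) := by
      intro i hi
      have e1 : (B (k + T - i - 1))ᵀ *ᵥ ((transition A (k + T - i) i)ᵀ *ᵥ v) =
          (B (k + T - i - 1))ᵀ *ᵥ y i + (B (k + T - i - 1))ᵀ *ᵥ (z i - y i) := by
        rw [← mulVec_add, add_sub_cancel]
      rw [e1]
      refine (dotProduct_add_self_le_two _ _).trans ?_
      have h2 := hβ (k + T - i - 1) (z i - y i)
      have h3 := mul_le_mul_of_nonneg_left (heb i (Finset.mem_range.1 hi).le) hβ0
      have h4 : β * ((z i - y i) ⬝ᵥ (z i - y i)) ≤ β * (E / κ * Δ) := h3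
      linarith
    have hout2 := Finset.sum_le_sum hout
    rw [Finset.sum_add_distrib, Finset.sum_const, Finset.card_range, nsmul_eq_mul,
      ← Finset.mul_sum] at hout2
    -- The unequal weight ½ keeps the factor 3/2 · ½ = 3/4 below one after the open-loop
    -- contraction.
    have hyz : y T ⬝ᵥ y T ≤ 3 / 2 * (z T ⬝ᵥ z T) + 3 * e T := by
      have h1 := dotProduct_add_self_le (by norm_num : (0 : ℝ) < 1 / 2) (z T) (y T - z T)
      rw [add_sub_cancel] at h1
      have h2 : (y T - z T) ⬝ᵥ (y T - z T) = e T := by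
        simp only [he]; rw [← neg_sub (z T) (y T), neg_dotProduct_neg]
      rw [h2] at h1
      norm_num at h1 ⊢
      exact h1
    rw [← hyT]
    rw [← hzT] at hw1
    have h5 := heb T le_rfl
    have h6 := mul_le_mul_of_nonneg_left hout2 hc₁.le
    have h7 := mul_le_mul_of_nonneg_left hsg hc₁.le
    have e8 : D * Δ = 3 / 2 * (c₁ * (2 * Δ + T * (2 * β * (E / κ * Δ)))) + 3 * (E / κ * Δ) := by
      rw [hD]; ring
    rw [e8]
    linarith
  -- one step
  set η := 2 * α + 2 * γ * (c / κ) with hη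
  have hη0 : 1 ≤ η := by
    have : 0 ≤ 2 * γ * (c / κ) := by positivity
    linarith
  have one : ∀ k v, ((Ac k)ᵀ *ᵥ v) ⬝ᵥ ((Ac k)ᵀ *ᵥ v) ≤ η * (v ⬝ᵥ v) := by
    intro k v
    have e1 : (Ac k)ᵀ *ᵥ v = (A k)ᵀ *ᵥ v - (C k)ᵀ *ᵥ ((K k)ᵀ *ᵥ v) := by
      simp only [hAc, transpose_sub, transpose_mul, sub_mulVec, mulVec_mulVec]
    rw [e1]
    refine (dotProduct_sub_self_le_two _ _).trans ?_
    have h1 := hα k v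
    have h2 := hγ k ((K k)ᵀ *ᵥ v)
    have h3 := hV k v
    have h4 := hVc (k + 1) v
    have h5 := hV0 k ((A k - K k * C k)ᵀ *ᵥ v)
    have h6 := dotProduct_self_nonneg' ((B k)ᵀ *ᵥ v)
    have h7 : ((K k)ᵀ *ᵥ v) ⬝ᵥ ((K k)ᵀ *ᵥ v) ≤ c / κ * (v ⬝ᵥ v) := by
      rw [div_mul_eq_mul_div, le_div_iff₀ hκ]; linarith
    have h8 := mul_le_mul_of_nonneg_left h7 hγ0
    have e9 : η * (v ⬝ᵥ v) = 2 * (α * (v ⬝ᵥ v)) + 2 * (γ * (c / κ * (v ⬝ᵥ v))) := by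
      rw [hη]; ring
    rw [e9]
    linarith
  -- the Lyapunov function
  set Ψ : ℕ → (Fin n → ℝ) → ℝ := fun k v => D * V k v + v ⬝ᵥ v with hΨ
  have hΨ0 : ∀ k v, 0 ≤ Ψ k v := fun k v =>
    add_nonneg (mul_nonneg hD0 (hV0 k v)) (dotProduct_self_nonneg' v)
  have hΨlow : ∀ k v, v ⬝ᵥ v ≤ Ψ k v := fun k v =>
    le_add_of_nonneg_left (mul_nonneg hD0 (hV0 k v))
  set G := D * c + 1 with hG
  have hG0 : 1 ≤ G := by
    have : 0 ≤ D * c := by positivity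
    linarith
  have hΨup : ∀ k v, Ψ k v ≤ G * (v ⬝ᵥ v) := fun k v => by
    have := mul_le_mul_of_nonneg_left (hVc k v) hD0
    simp only [hΨ, hG]
    linarith
  -- The window estimate lowers Ψ by at least ¼|v|², and |v|² ≥ Ψ/G, whence θ = 1 - 1/(4G).
  obtain ⟨M, ρ, hM, hρ0, hρ1, hdecay⟩ := geometric_decay_of_window (Ac := Ac) (Ψ := Ψ) hT
    (η := G * η) (θ := 1 - 1 / (4 * G)) (by nlinarith)
    (by
      have : 1 / (4 * G) ≤ 1 / 4 := by
        apply one_div_le_one_div_of_le <;> linarith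
      linarith)
    (by
      have : 0 < 1 / (4 * G) := by positivity
      linarith) hΨ0
    (fun k v => by
      have h1 := mul_le_mul_of_nonneg_left (one k v) (by linarith : 0 ≤ G)
      have h2 := mul_le_mul_of_nonneg_left (hΨlow (k + 1) v) (by positivity : 0 ≤ G * η)
      have h3 := hΨup k ((Ac k)ᵀ *ᵥ v)
      linarith)
    (fun k v => by
      have h1 := window k v
      have h2 : 1 / (4 * G) * Ψ (k + T) v ≤ 1 / 4 * (v ⬝ᵥ v) := by
        have h3 := hΨup (k + T) v
        rw [div_mul_eq_mul_div, div_le_iff₀ (by positivity)]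
        linarith
      have e1 : Ψ (k + T) v = D * V (k + T) v + v ⬝ᵥ v := rfl
      have e2 : Ψ k ((transition Ac k T)ᵀ *ᵥ v) = D * V k ((transition Ac k T)ᵀ *ᵥ v) +
        ((transition Ac k T)ᵀ *ᵥ v) ⬝ᵥ ((transition Ac k T)ᵀ *ᵥ v) := rfl
      linarith)
  refine ⟨M * G, ρ, by positivity, hρ0, hρ1, fun k j v => ?_⟩
  have h1 : ∀ v, ((transition Ac k j)ᵀ *ᵥ v) ⬝ᵥ ((transition Ac k j)ᵀ *ᵥ v) ≤
      M * G * ρ ^ j * (v ⬝ᵥ v) := fun v => by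
    have h2 := mul_le_mul_of_nonneg_left (hΨup (k + j) v) (by positivity : 0 ≤ M * ρ ^ j)
    have h3 := (hΨlow _ _).trans (hdecay k j v)
    linarith
  -- The estimate so far concerns the adjoint; the transpose has the same operator norm bound.
  have h2 := transpose_mulVec_sq_le (by positivity) h1 v
  rwa [transpose_transpose] at h2

end

/-! ### Completing the square for a filter gain -/

section

variable {a b : Type*} [Fintype a] [Fintype b]

theorem quad_add_of_symm {P : Matrix a a ℝ} (hP : Pᵀ = P) (x y : a → ℝ) :
    (x + y) ⬝ᵥ (P *ᵥ (x + y)) = x ⬝ᵥ (P *ᵥ x) + 2 * (x ⬝ᵥ (P *ᵥ y)) + y ⬝ᵥ (P *ᵥ y) := by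
  have h : y ⬝ᵥ (P *ᵥ x) = x ⬝ᵥ (P *ᵥ y) := by
    rw [dotProduct_mulVec, ← mulVec_transpose, hP, dotProduct_comm]
  rw [mulVec_add, add_dotProduct, dotProduct_add, dotProduct_add, h]; ring

variable [DecidableEq a]

theorem quad_gain_eq (P : Matrix a a ℝ) (R : Matrix b b ℝ) (C : Matrix b a ℝ) (N : Matrix a b ℝ)
    (μ : a → ℝ) :
    μ ⬝ᵥ (((1 - N * C) * P * (1 - N * C)ᵀ + N * R * Nᵀ) *ᵥ μ) =
      (μ - Cᵀ *ᵥ (Nᵀ *ᵥ μ)) ⬝ᵥ (P *ᵥ (μ - Cᵀ *ᵥ (Nᵀ *ᵥ μ))) +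
        (Nᵀ *ᵥ μ) ⬝ᵥ (R *ᵥ (Nᵀ *ᵥ μ)) := by
  rw [add_mulVec, dotProduct_add, dotProduct_mul_mul_transpose_mulVec,
    dotProduct_mul_mul_transpose_mulVec, transpose_sub, transpose_one, transpose_mul, sub_mulVec,
    one_mulVec, ← mulVec_mulVec]

/-- A gain satisfying the orthogonality principle along `δ` is not improved by `δ`. -/
theorem quad_gain_le {P : Matrix a a ℝ} {R : Matrix b b ℝ} {C : Matrix b a ℝ} {N : Matrix a b ℝ}
    (hP : P.PosSemidef) (hR : R.PosSemidef) {δ : b → ℝ}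
    (h : (N * (C * P * Cᵀ + R) - P * Cᵀ) *ᵥ δ = 0) (μ : a → ℝ) :
    μ ⬝ᵥ (((1 - N * C) * P * (1 - N * C)ᵀ + N * R * Nᵀ) *ᵥ μ) ≤
      (μ - Cᵀ *ᵥ (Nᵀ *ᵥ μ + δ)) ⬝ᵥ (P *ᵥ (μ - Cᵀ *ᵥ (Nᵀ *ᵥ μ + δ))) +
        (Nᵀ *ᵥ μ + δ) ⬝ᵥ (R *ᵥ (Nᵀ *ᵥ μ + δ)) := by
  rw [quad_gain_eq]
  set β := Nᵀ *ᵥ μ with hβ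
  have e1 : μ - Cᵀ *ᵥ (β + δ) = (μ - Cᵀ *ᵥ β) + -(Cᵀ *ᵥ δ) := by
    rw [mulVec_add]; abel
  rw [e1, quad_add_of_symm hP.transpose_eq, quad_add_of_symm hR.transpose_eq, mulVec_neg,
    dotProduct_neg, neg_dotProduct_neg]
  have h1 := hP.quad_nonneg (Cᵀ *ᵥ δ)
  have h2 := hR.quad_nonneg δ
  have h3 := congrArg (μ ⬝ᵥ ·) h
  simp only [dotProduct_zero] at h3
  -- Orthogonality tested against μ: the terms linear in δ cancel, leaving the nonnegative forms of
  -- `h1` and `h2` as the excess cost.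
  have h4 : β ⬝ᵥ (R *ᵥ δ) = (μ - Cᵀ *ᵥ β) ⬝ᵥ (P *ᵥ (Cᵀ *ᵥ δ)) := by
    have t1 : ∀ v, μ ⬝ᵥ (N *ᵥ v) = β ⬝ᵥ v := fun v => by
      rw [hβ, mulVec_transpose, dotProduct_mulVec]
    have t2 : ∀ v, (Cᵀ *ᵥ β) ⬝ᵥ v = β ⬝ᵥ (C *ᵥ v) := fun v => by
      rw [mulVec_transpose, dotProduct_mulVec]
    rw [sub_mulVec, ← mulVec_mulVec, dotProduct_sub, t1, add_mulVec, dotProduct_add,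
      ← mulVec_mulVec, ← mulVec_mulVec, ← mulVec_mulVec, ← t2] at h3
    rw [sub_dotProduct]
    linarith
  linarith

end

theorem OpBdd.const {n : ℕ} (M : Matrix (Fin n) (Fin n) ℝ) :
    ∃ c : ℝ, 0 ≤ c ∧ ∀ v, v ⬝ᵥ (M *ᵥ v) ≤ c * (v ⬝ᵥ v) := by
  have h : BoundedSeq fun _ : ℕ => M :=
    ⟨∑ i, ∑ j, |M i j|, fun _ i j => (Finset.single_le_sum (f := fun j => |M i j|)
      (fun j _ => abs_nonneg _) (Finset.mem_univ j)).trans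
      (Finset.single_le_sum (f := fun i => ∑ j, |M i j|)
        (fun i _ => Finset.sum_nonneg fun j _ => abs_nonneg _) (Finset.mem_univ i))⟩
  obtain ⟨c, hc, h⟩ := (OpBdd.of_boundedSeq h (D := n) (fun _ => le_rfl) fun _ => le_rfl).quad
  exact ⟨c, hc, h 0⟩

namespace LinSys

variable {n m p l : ℕ} {S : LinSys n m p l} {F : ∀ k, SVD (S.H k)}

/-! ### Uniform bounds for the transformed system -/

namespace Standing

variable (hS : S.Standing F)
include hS

theorem opBdd_A : OpBdd S.A :=
  .of_boundedSeq hS.bdd_A (D := n) (fun _ => le_rfl) fun _ => le_rfl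

theorem opBdd_C : OpBdd S.C :=
  .of_boundedSeq hS.bdd_C (D := n + l) (fun _ => by simp) fun _ => by simp

theorem opBdd_G : OpBdd S.G :=
  .of_boundedSeq hS.bdd_G (D := n + p) (fun _ => by simp) fun _ => by simp

theorem opBdd_Q : OpBdd S.Q :=
  .of_boundedSeq hS.bdd_Q (D := n) (fun _ => le_rfl) fun _ => le_rfl

theorem opBdd_R : OpBdd S.R :=
  .of_boundedSeq hS.bdd_R (D := l) (fun _ => le_rfl) fun _ => le_rfl

theorem opBdd_Rinv : OpBdd fun k => (S.R k)⁻¹ :=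
  .of_boundedSeq hS.bdd_Rinv (D := l) (fun _ => le_rfl) fun _ => le_rfl

theorem opBdd_M1 : OpBdd (S.M1 F) :=
  .of_boundedSeq hS.bdd_Siginv (D := l) (fun k => (S.H k).rank_le_height)
    fun k => (S.H k).rank_le_height

theorem opBdd_Mtil : OpBdd (S.Mtil F) :=
  .of_boundedSeq hS.bdd_Mtil (D := p + l) (fun k => by omega) fun k => by omega

omit hS in
theorem opBdd_U1 : OpBdd fun k => (F k).U1 := .of_isometry fun k => (F k).U_blocks.1

omit hS in
theorem opBdd_U2 : OpBdd fun k => (F k).U2 := .of_isometry fun k => (F k).U_blocks.2.2.2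

omit hS in
theorem opBdd_V1 : OpBdd fun k => (F k).V1 := .of_isometry fun k => (F k).V_blocks.1

omit hS in
theorem opBdd_V2 : OpBdd fun k => (F k).V2 := .of_isometry fun k => (F k).V_blocks.2.2.2

theorem opBdd_G1 : OpBdd (S.G1 F) := hS.opBdd_G.mul opBdd_V1

theorem opBdd_G2 : OpBdd (S.G2 F) := hS.opBdd_G.mul opBdd_V2

omit hS in
theorem opBdd_T2 : OpBdd (S.T2 F) := opBdd_U2.transpose

theorem opBdd_C2 : OpBdd (S.C2 F) := opBdd_T2.mul hS.opBdd_C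

theorem opBdd_R2 : OpBdd (S.R2 F) := (opBdd_T2.mul hS.opBdd_R).mul opBdd_T2.transpose

theorem R2_ge : ∃ r : ℝ, 0 < r ∧ ∀ k v, r * (v ⬝ᵥ v) ≤ v ⬝ᵥ (S.R2 F k *ᵥ v) := by
  obtain ⟨r, hr, h⟩ := hS.opBdd_Rinv.quad_ge_of_inv hS.R_posDef
  refine ⟨r, hr, fun k v => ?_⟩
  have h1 := h k ((F k).U2 *ᵥ v)
  rw [← dotProduct_transpose_mul_mulVec, (F k).U_blocks.2.2.2, one_mulVec] at h1
  rw [R2, T2, dotProduct_mul_mul_transpose_mulVec, transpose_transpose]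
  exact h1

/-- The inverse occurring in T₁ is R₂⁻¹, bounded because R₂ inherits the uniform lower bound of R
through the isometry U₂. -/
theorem opBdd_T1 : OpBdd (S.T1 F) := by
  obtain ⟨r, hr, h⟩ := hS.R2_ge
  have h1 : OpBdd fun k => (S.R2 F k)⁻¹ :=
    .inv_of_quad_ge (fun k => R2_posDef hS.R_posDef k) hr h
  have h2 : OpBdd fun k => ((F k).U2ᵀ * S.R k * (F k).U2)⁻¹ := by
    simpa only [R2, T2, transpose_transpose] using h1
  exact opBdd_U1.transpose.sub
    ((((opBdd_U1.transpose.mul hS.opBdd_R).mul opBdd_U2).mul h2).mul opBdd_U2.transpose)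

theorem opBdd_C1 : OpBdd (S.C1 F) := hS.opBdd_T1.mul hS.opBdd_C

theorem opBdd_R1 : OpBdd (S.R1 F) := (hS.opBdd_T1.mul hS.opBdd_R).mul hS.opBdd_T1.transpose

theorem opBdd_Ahat : OpBdd (S.Ahat F) :=
  hS.opBdd_A.sub ((hS.opBdd_G1.mul hS.opBdd_M1).mul hS.opBdd_C1)

theorem opBdd_Qhat : OpBdd (S.Qhat F) :=
  ((((hS.opBdd_G1.mul hS.opBdd_M1).mul hS.opBdd_R1).mul hS.opBdd_M1.transpose).mul
    hS.opBdd_G1.transpose).add hS.opBdd_Q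

theorem opBdd_Etil : OpBdd (S.Etil F) :=
  (hS.opBdd_G2.mul hS.opBdd_Mtil).mul hS.opBdd_C2.succ

theorem opBdd_one_sub_Etil : OpBdd fun k => 1 - S.Etil F k :=
  (OpBdd.one (α := fun _ => Fin n)).sub hS.opBdd_Etil

theorem opBdd_Acheck : OpBdd fun k => (1 - S.Etil F (k + 1)) * S.Ahat F (k + 1) :=
  hS.opBdd_one_sub_Etil.succ.mul hS.opBdd_Ahat.succ

theorem opBdd_Atil : OpBdd (S.Atil F) := hS.opBdd_Acheck.add hS.opBdd_Etil

theorem opBdd_Qtil : OpBdd (S.Qtil F) :=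
  (hS.opBdd_one_sub_Etil.succ.mul hS.opBdd_Qhat.succ).mul hS.opBdd_one_sub_Etil.succ.transpose

theorem opBdd_projection : OpBdd fun k => 1 - S.C2 F (k + 1) * S.G2 F k * S.Mtil F k :=
  (OpBdd.one (α := fun k => Fin (l - S.pH (k + 1)))).sub
    ((hS.opBdd_C2.succ.mul hS.opBdd_G2).mul hS.opBdd_Mtil)

theorem Qtil_posSemidef (k : ℕ) : (S.Qtil F k).PosSemidef :=
  (Qhat_posSemidef hS.Q_posSemidef hS.R_posDef (k + 1)).mul_mul_transpose _

end Standing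

/-! ### The prediction covariance -/

variable (S F) in
/-- The covariance `(I - E) P̃ (I - E)ᵀ` of the part of the prediction error that is not affected
by the unknown input. -/
noncomputable def Fcov (k : ℕ) (P : Matrix (Fin n) (Fin n) ℝ) : Matrix (Fin n) (Fin n) ℝ :=
  (1 - S.Etil F k) * S.Ptil F k P * (1 - S.Etil F k)ᵀ

/-- M̃ is a left inverse of C₂G₂, so E is an oblique projection, along ker C₂-related directions
fixed by M̃, that fixes the columns of G₂. -/
theorem Etil_mul_Etil (hrank : ∀ k, (S.C2 F (k + 1) * S.G2 F k).rank = p - S.pH k) (k : ℕ) :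
    S.Etil F k * S.Etil F k = S.Etil F k := by
  calc S.Etil F k * S.Etil F k
      = S.G2 F k * (S.Mtil F k * (S.C2 F (k + 1) * S.G2 F k)) * S.Mtil F k * S.C2 F (k + 1) := by
        simp only [Etil, Matrix.mul_assoc]
    _ = S.Etil F k := by rw [Mtil_mul hrank, Matrix.mul_one]; rfl

/-- This is where Q̃ enters: after the projection I - E, the next prediction covariance is a
congruence of P^x plus Q̃. -/
theorem Fcov_succ (k : ℕ) (P : Matrix (Fin n) (Fin n) ℝ) : S.Fcov F (k + 1) P =
    (1 - S.Etil F (k + 1)) * S.Ahat F (k + 1) * P *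
      ((1 - S.Etil F (k + 1)) * S.Ahat F (k + 1))ᵀ + S.Qtil F k := by
  rw [Fcov, Ptil, Qtil]
  simp only [Matrix.mul_add, Matrix.add_mul, transpose_mul, Matrix.mul_assoc]

/-- The costate after a correction along the unknown input and a free control `u`. -/
theorem costate_eq (k : ℕ) (μ : Fin n → ℝ) (u : Fin (l - S.pH (k + 1)) → ℝ) :
    μ - (S.C2 F (k + 1))ᵀ *ᵥ ((S.Mtil F k)ᵀ *ᵥ ((S.G2 F k)ᵀ *ᵥ μ) +
      (1 - S.C2 F (k + 1) * S.G2 F k * S.Mtil F k)ᵀ *ᵥ u) =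
    (1 - S.Etil F k)ᵀ *ᵥ (μ - (S.C2 F (k + 1))ᵀ *ᵥ u) := by
  simp only [Etil, transpose_sub, transpose_one, transpose_mul, sub_mulVec, mulVec_sub,
    mulVec_add, one_mulVec, mulVec_mulVec, Matrix.mul_assoc, Matrix.sub_mul, Matrix.one_mul]
  abel

/-- The extra summand E of Ã is invisible behind (I - E)ᵀ because E is idempotent. This allows Ã,
the matrix of the detectability assumption, to replace (I - E)Â in the cost recursion. -/
theorem one_sub_Etil_transpose_mulVec
    (hrank : ∀ k, (S.C2 F (k + 1) * S.G2 F k).rank = p - S.pH k) (k : ℕ) (v x : Fin n → ℝ) :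
    (1 - S.Etil F k)ᵀ *ᵥ (((1 - S.Etil F (k + 1)) * S.Ahat F (k + 1))ᵀ *ᵥ v - x) =
      (1 - S.Etil F k)ᵀ *ᵥ ((S.Atil F k)ᵀ *ᵥ v - x) := by
  have h : (1 - S.Etil F k)ᵀ * (S.Etil F k)ᵀ = 0 := by
    rw [← transpose_mul, Matrix.mul_sub, Matrix.mul_one, Etil_mul_Etil hrank, sub_self,
      transpose_zero]
  have h2 : (1 - S.Etil F k)ᵀ *ᵥ ((S.Etil F k)ᵀ *ᵥ v) = 0 := by
    rw [mulVec_mulVec, h, zero_mulVec]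
  rw [Atil, transpose_add, add_mulVec, mulVec_sub, mulVec_sub, mulVec_add, h2, add_zero]

theorem quad_Fcov (k : ℕ) (P : Matrix (Fin n) (Fin n) ℝ) (v : Fin n → ℝ) :
    v ⬝ᵥ (S.Fcov F k P *ᵥ v) = ((1 - S.Etil F k)ᵀ *ᵥ v) ⬝ᵥ (S.Ptil F k P *ᵥ
      ((1 - S.Etil F k)ᵀ *ᵥ v)) :=
  dotProduct_mul_mul_transpose_mulVec _ _ _

section Covariance

variable (hS : S.Standing F) (hrank : ∀ k, (S.C2 F (k + 1) * S.G2 F k).rank = p - S.pH k)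
include hS hrank

/-- The vectors w = M̃ᵀG₂ᵀμ + (I - XM̃)ᵀu satisfy the dual constraint Xᵀw = G₂ᵀμ, where X = C₂G₂. So
w - Nᵀμ lies in ker Xᵀ, where optimality of N applies, and `costate_eq` rewrites the resulting
costate. -/
theorem quad_Pnext_le (k : ℕ) {P : Matrix (Fin n) (Fin n) ℝ} (hP : P.PosSemidef) (μ : Fin n → ℝ)
    (u : Fin (l - S.pH (k + 1)) → ℝ) :
    μ ⬝ᵥ (S.Pnext F k P *ᵥ μ) ≤
      (μ - (S.C2 F (k + 1))ᵀ *ᵥ u) ⬝ᵥ (S.Fcov F k P *ᵥ (μ - (S.C2 F (k + 1))ᵀ *ᵥ u)) +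
      ((S.Mtil F k)ᵀ *ᵥ ((S.G2 F k)ᵀ *ᵥ μ) +
        (1 - S.C2 F (k + 1) * S.G2 F k * S.Mtil F k)ᵀ *ᵥ u) ⬝ᵥ (S.R2 F (k + 1) *ᵥ
      ((S.Mtil F k)ᵀ *ᵥ ((S.G2 F k)ᵀ *ᵥ μ) +
        (1 - S.C2 F (k + 1) * S.G2 F k * S.Mtil F k)ᵀ *ᵥ u)) := by
  set X := S.C2 F (k + 1) * S.G2 F k with hX
  set w := (S.Mtil F k)ᵀ *ᵥ ((S.G2 F k)ᵀ *ᵥ μ) + (1 - X * S.Mtil F k)ᵀ *ᵥ u with hw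
  have hMX : S.Mtil F k * X = 1 := Mtil_mul hrank k
  have hNX : S.Ngain F k P * X = S.G2 F k :=
    Ngain_mul hS.Q_posSemidef hS.R_posDef k hP hrank
  have hXw : Xᵀ *ᵥ w = (S.G2 F k)ᵀ *ᵥ μ := by
    have h1 : Xᵀ * (1 - X * S.Mtil F k)ᵀ = 0 := by
      rw [← transpose_mul, Matrix.sub_mul, Matrix.mul_assoc, hMX, Matrix.one_mul, Matrix.mul_one,
        sub_self, transpose_zero]
    rw [hw, mulVec_add, mulVec_mulVec, mulVec_mulVec _ Xᵀ, h1, zero_mulVec, add_zero,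
      ← transpose_mul, hMX, transpose_one, one_mulVec]
  have hδ : Xᵀ *ᵥ (w - (S.Ngain F k P)ᵀ *ᵥ μ) = 0 := by
    rw [mulVec_sub, hXw, mulVec_mulVec, ← transpose_mul, hNX, sub_self]
  have h := quad_gain_le (Ptil_posSemidef hS.Q_posSemidef hS.R_posDef k hP)
    (R2_posDef hS.R_posDef (k + 1)).posSemidef
    (Ngain_orthogonal hS.Q_posSemidef hS.R_posDef k hP hδ) μ
  rw [← Pnext_eq hS.Q_posSemidef hS.R_posDef k hP, add_sub_cancel, hw, hX, costate_eq,
    ← quad_Fcov] at h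
  exact h

/-- The control that ULISE itself uses is u = Λᵀμ with Λ = N - G₂M̃. As ΛX = 0, the corresponding w
is exactly Nᵀμ, so the upper bound for general u is attained. -/
theorem quad_Pnext_eq (k : ℕ) {P : Matrix (Fin n) (Fin n) ℝ} (hP : P.PosSemidef)
    (μ : Fin n → ℝ) :
    μ ⬝ᵥ (S.Pnext F k P *ᵥ μ) =
      (μ - (S.C2 F (k + 1))ᵀ *ᵥ ((S.Ngain F k P - S.G2 F k * S.Mtil F k)ᵀ *ᵥ μ)) ⬝ᵥ
        (S.Fcov F k P *ᵥ (μ - (S.C2 F (k + 1))ᵀ *ᵥ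
          ((S.Ngain F k P - S.G2 F k * S.Mtil F k)ᵀ *ᵥ μ))) +
      ((S.Ngain F k P)ᵀ *ᵥ μ) ⬝ᵥ (S.R2 F (k + 1) *ᵥ ((S.Ngain F k P)ᵀ *ᵥ μ)) := by
  set X := S.C2 F (k + 1) * S.G2 F k with hX
  set Λ := S.Ngain F k P - S.G2 F k * S.Mtil F k with hΛ
  have hMX : S.Mtil F k * X = 1 := Mtil_mul hrank k
  have hNX : S.Ngain F k P * X = S.G2 F k :=
    Ngain_mul hS.Q_posSemidef hS.R_posDef k hP hrank
  have hΛX : Λ * X = 0 := by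
    rw [hΛ, Matrix.sub_mul, hNX, Matrix.mul_assoc, hMX, Matrix.mul_one, sub_self]
  have hb : (S.Ngain F k P)ᵀ *ᵥ μ = (S.Mtil F k)ᵀ *ᵥ ((S.G2 F k)ᵀ *ᵥ μ) +
      (1 - X * S.Mtil F k)ᵀ *ᵥ (Λᵀ *ᵥ μ) := by
    have h1 : Λ * (1 - X * S.Mtil F k) = Λ := by
      rw [Matrix.mul_sub, ← Matrix.mul_assoc, hΛX, Matrix.zero_mul, Matrix.mul_one, sub_zero]
    rw [mulVec_mulVec, mulVec_mulVec, ← transpose_mul, ← transpose_mul, h1, hΛ, transpose_sub,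
      sub_mulVec, add_sub_cancel]
  rw [quad_Fcov, ← costate_eq, ← hX, ← hb, Pnext_eq hS.Q_posSemidef hS.R_posDef k hP,
    quad_gain_eq]

/-- Since N X = G₂, one has Λ = N(I - XM̃); the measurement cost of Nᵀμ thereby dominates the
control energy |Λᵀμ|². -/
theorem gain_deviation_eq (k : ℕ) {P : Matrix (Fin n) (Fin n) ℝ} (hP : P.PosSemidef)
    (μ : Fin n → ℝ) :
    (S.Ngain F k P - S.G2 F k * S.Mtil F k)ᵀ *ᵥ μ =
      (1 - S.C2 F (k + 1) * S.G2 F k * S.Mtil F k)ᵀ *ᵥ ((S.Ngain F k P)ᵀ *ᵥ μ) := by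
  have hNX : S.Ngain F k P * (S.C2 F (k + 1) * S.G2 F k) = S.G2 F k :=
    Ngain_mul hS.Q_posSemidef hS.R_posDef k hP hrank
  rw [mulVec_mulVec, ← transpose_mul, Matrix.mul_sub, ← Matrix.mul_assoc, hNX, Matrix.mul_one]

variable {P0 : Matrix (Fin n) (Fin n) ℝ} (hP0 : P0.PosSemidef)
  (hdet : UniformlyDetectable (S.Atil F) (fun k => S.C2 F (k + 1)))
include hP0 hdet

theorem exists_Fcov_bound : ∃ c : ℝ, 0 ≤ c ∧ ∀ k v,
    v ⬝ᵥ (S.Fcov F k (S.Px F P0 k) *ᵥ v) ≤ c * (v ⬝ᵥ v) := by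
  obtain ⟨c₀, -, h0⟩ := OpBdd.const (S.Fcov F 0 (S.Px F P0 0))
  obtain ⟨r, hr0, hr⟩ := hS.opBdd_R2.quad
  obtain ⟨g, hg0, hg⟩ :=
    (hS.opBdd_Mtil.transpose.mul (hS.opBdd_G2.transpose.mul hS.opBdd_Acheck.transpose))
  obtain ⟨z, hz0, hz⟩ := hS.opBdd_projection.transpose
  obtain ⟨q, hq0, hq⟩ := hS.opBdd_Qtil.quad
  refine hdet.riccati_bounded hS.opBdd_Atil hS.opBdd_C2.succ
    (V := fun k v => v ⬝ᵥ (S.Fcov F k (S.Px F P0 k) *ᵥ v))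
    -- q bounds the Q̃ cost of v. r bounds R₂, applied to w with |w|² ≤ 2g|v|² + 2z|u|².
    (κ := q + r * (2 * g + 2 * z)) (by positivity) (fun k v u => ?_) h0
  have hP := Px_posSemidef (F := F) hS.Q_posSemidef hS.R_posDef hP0 k
  set μ := ((1 - S.Etil F (k + 1)) * S.Ahat F (k + 1))ᵀ *ᵥ v with hμ
  have e1 : v ⬝ᵥ (S.Fcov F (k + 1) (S.Px F P0 (k + 1)) *ᵥ v) =
      μ ⬝ᵥ (S.Pnext F k (S.Px F P0 k) *ᵥ μ) + v ⬝ᵥ (S.Qtil F k *ᵥ v) := by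
    rw [Fcov_succ, add_mulVec, dotProduct_add, dotProduct_mul_mul_transpose_mulVec]; rfl
  have h1 := quad_Pnext_le hS hrank k hP μ u
  rw [quad_Fcov, one_sub_Etil_transpose_mulVec hrank, ← quad_Fcov] at h1
  set w := (S.Mtil F k)ᵀ *ᵥ ((S.G2 F k)ᵀ *ᵥ μ) +
        (1 - S.C2 F (k + 1) * S.G2 F k * S.Mtil F k)ᵀ *ᵥ u with hw
  have h2 := hr (k + 1) w
  have h3 : w ⬝ᵥ w ≤ 2 * (g * (v ⬝ᵥ v)) + 2 * (z * (u ⬝ᵥ u)) := by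
    have h4 := hg k v
    rw [← mulVec_mulVec, ← mulVec_mulVec] at h4
    have h5 := hz k u
    have h6 := dotProduct_add_self_le_two ((S.Mtil F k)ᵀ *ᵥ ((S.G2 F k)ᵀ *ᵥ μ))
      ((1 - S.C2 F (k + 1) * S.G2 F k * S.Mtil F k)ᵀ *ᵥ u)
    linarith
  have h4 := hq k v
  have h5 := mul_le_mul_of_nonneg_left h3 hr0
  have hv := dotProduct_self_nonneg' v
  have hu := dotProduct_self_nonneg' u
  rw [e1]
  have a1 : 0 ≤ q * (u ⬝ᵥ u) := by positivity
  have a2 : 0 ≤ r * (g * (u ⬝ᵥ u)) := by positivity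
  have a3 : 0 ≤ r * (z * (v ⬝ᵥ v)) := by positivity
  linarith

theorem exists_Px_bound : ∃ c : ℝ, 0 ≤ c ∧ ∀ k v,
    v ⬝ᵥ (S.Px F P0 k *ᵥ v) ≤ c * (v ⬝ᵥ v) := by
  obtain ⟨c₀, hc0, h0⟩ := OpBdd.const P0
  obtain ⟨c, hc, h⟩ := exists_Fcov_bound hS hrank hP0 hdet
  obtain ⟨r, hr0, hr⟩ := hS.opBdd_R2.quad
  obtain ⟨g, hg0, hg⟩ := hS.opBdd_Mtil.transpose.mul hS.opBdd_G2.transpose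
  refine ⟨c₀ + c + r * g, by positivity, fun k v => ?_⟩
  have hv := dotProduct_self_nonneg' v
  have a1 : 0 ≤ c₀ * (v ⬝ᵥ v) := by positivity
  have a2 : 0 ≤ c * (v ⬝ᵥ v) := by positivity
  have a3 : 0 ≤ r * (g * (v ⬝ᵥ v)) := by positivity
  cases k with
  | zero => have := h0 v; simp only [Px]; linarith
  | succ k =>
    have hP := Px_posSemidef (F := F) hS.Q_posSemidef hS.R_posDef hP0 k
    -- Zero control compares ULISE with the admissible gain G₂M̃.
    have h1 := quad_Pnext_le hS hrank k hP v 0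
    rw [mulVec_zero, mulVec_zero, sub_zero, add_zero] at h1
    have h2 := hr (k + 1) ((S.Mtil F k)ᵀ *ᵥ ((S.G2 F k)ᵀ *ᵥ v))
    have h3 := hg k v
    rw [← mulVec_mulVec] at h3
    have h4 := h k v
    have h5 := mul_le_mul_of_nonneg_left h3 hr0
    simp only [Px]
    linarith

theorem opBdd_Px : OpBdd (S.Px F P0) := by
  obtain ⟨c, -, h⟩ := exists_Px_bound hS hrank hP0 hdet
  refine .of_boundedSeq ⟨c, fun k i j => ?_⟩ (D := n) (fun _ => le_rfl) fun _ => le_rfl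
  exact (Px_posSemidef hS.Q_posSemidef hS.R_posDef hP0 k).abs_apply_le (h k) i j

/-- The covariance contains N R₂ Nᵀ and R₂ is uniformly positive, so a bound on P^x bounds N. -/
theorem opBdd_Ngain : OpBdd fun k => S.Ngain F k (S.Px F P0 k) := by
  obtain ⟨c, hc, h⟩ := exists_Px_bound hS hrank hP0 hdet
  obtain ⟨r, hr0, hr⟩ := hS.R2_ge
  have h1 : OpBdd fun k => (S.Ngain F k (S.Px F P0 k))ᵀ := by
    refine ⟨c / r, by positivity, fun k μ => ?_⟩
    have hP := Px_posSemidef (F := F) hS.Q_posSemidef hS.R_posDef hP0 k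
    have h2 := h (k + 1) μ
    rw [Px, Pnext_eq hS.Q_posSemidef hS.R_posDef k hP, quad_gain_eq] at h2
    have h3 := (Ptil_posSemidef (F := F) hS.Q_posSemidef hS.R_posDef k hP).quad_nonneg
      (μ - (S.C2 F (k + 1))ᵀ *ᵥ ((S.Ngain F k (S.Px F P0 k))ᵀ *ᵥ μ))
    have h4 := hr (k + 1) ((S.Ngain F k (S.Px F P0 k))ᵀ *ᵥ μ)
    rw [div_mul_eq_mul_div, le_div_iff₀ hr0]
    linarith
  simpa only [transpose_transpose] using h1.transpose

/-- M₂ is the left inverse of X = C₂G₂ of least R̃₂-variance, so M₂R̃₂M₂ᵀ ≤ M̃R̃₂M̃ᵀ. The right side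
is bounded, and R̃₂ ≥ R₂ is uniformly positive. -/
theorem opBdd_M2 : OpBdd fun k => S.M2 F k (S.Px F P0 k) := by
  have hPx := opBdd_Px hS hrank hP0 hdet
  have hPt : OpBdd fun k => S.Ptil F k (S.Px F P0 k) :=
    ((hS.opBdd_Ahat.mul hPx).mul hS.opBdd_Ahat.transpose).add hS.opBdd_Qhat
  have hRt : OpBdd fun k => S.Rtil2 F k (S.Px F P0 k) :=
    ((hS.opBdd_C2.succ.mul hPt).mul hS.opBdd_C2.succ.transpose).add hS.opBdd_R2.succ
  obtain ⟨c, hc, h⟩ := ((hS.opBdd_Mtil.mul hRt).mul hS.opBdd_Mtil.transpose).quad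
  obtain ⟨r, hr0, hr⟩ := hS.R2_ge
  have h1 : OpBdd fun k => (S.M2 F k (S.Px F P0 k))ᵀ := by
    refine ⟨c / r, by positivity, fun k μ => ?_⟩
    have hP := Px_posSemidef (F := F) hS.Q_posSemidef hS.R_posDef hP0 k
    have hRpd := Rtil2_posDef (F := F) hS.Q_posSemidef hS.R_posDef k hP
    have hM2 := M2_mul hS.Q_posSemidef hS.R_posDef hrank k hP
    have hMt := Mtil_mul (F := F) hrank k
    have h2 := h k μ
    rw [dotProduct_mul_mul_transpose_mulVec] at h2
    set P := S.Px F P0 k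
    set X := S.C2 F (k + 1) * S.G2 F k with hX
    set β := (S.M2 F k P)ᵀ *ᵥ μ with hβ
    set δ := (S.Mtil F k)ᵀ *ᵥ μ - β with hδ
    have e1 : (S.Mtil F k)ᵀ *ᵥ μ = β + δ := by rw [hδ, add_sub_cancel]
    have hXδ : Xᵀ *ᵥ δ = 0 := by
      rw [hδ, hβ, mulVec_sub, mulVec_mulVec, mulVec_mulVec, ← transpose_mul, ← transpose_mul,
        hMt, hM2, sub_self]
    -- M₂R̃₂ is a multiple of Xᵀ, which kills the difference δ of the two left inverses; the square
    -- then splits orthogonally.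
    have hcross : β ⬝ᵥ (S.Rtil2 F k P *ᵥ δ) = 0 := by
      have e2 : S.M2 F k P * S.Rtil2 F k P = S.Pd2 F k P * Xᵀ := by
        rw [M2_eq, Matrix.mul_assoc, Matrix.mul_assoc,
          nonsing_inv_mul _ ((isUnit_iff_isUnit_det _).1 hRpd.isUnit), Matrix.mul_one]
      rw [hβ, mulVec_transpose, ← dotProduct_mulVec, mulVec_mulVec, e2, ← mulVec_mulVec, hXδ,
        mulVec_zero, dotProduct_zero]
    rw [e1, quad_add_of_symm hRpd.posSemidef.transpose_eq, hcross] at h2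
    have h3 := hRpd.posSemidef.quad_nonneg δ
    have h4 : r * (β ⬝ᵥ β) ≤ β ⬝ᵥ (S.Rtil2 F k P *ᵥ β) := by
      have h5 := hr (k + 1) β
      have h6 := ((Ptil_posSemidef (F := F) hS.Q_posSemidef hS.R_posDef k hP).mul_mul_transpose
        (S.C2 F (k + 1))).quad_nonneg β
      rw [Rtil2, add_mulVec, dotProduct_add]
      linarith
    rw [div_mul_eq_mul_div, le_div_iff₀ hr0]
    linarith
  simpa only [transpose_transpose] using h1.transpose

end Covariance

end LinSys

namespace SVD

variable {l p : ℕ} {H : Matrix (Fin l) (Fin p) ℝ} (f : SVD H)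

theorem U1_transpose_mul : f.U1ᵀ * H = diagonal f.σ * f.V1ᵀ := by
  refine (congrArg (f.U1ᵀ * ·) f.H_eq).trans ?_
  rw [← Matrix.mul_assoc, ← Matrix.mul_assoc, f.U_blocks.1, Matrix.one_mul]

theorem U2_transpose_mul : f.U2ᵀ * H = 0 := by
  refine (congrArg (f.U2ᵀ * ·) f.H_eq).trans ?_
  rw [← Matrix.mul_assoc, ← Matrix.mul_assoc, f.U_blocks.2.2.1, Matrix.zero_mul, Matrix.zero_mul]

end SVD

namespace LinSys

variable {n m p l : ℕ} {S : LinSys n m p l} {F : ∀ k, SVD (S.H k)}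

/-! ### The error dynamics -/

variable (S F) in
/-- The transition matrix `(I - N C₂) Â` of the estimation error. -/
noncomputable def errTransition (k : ℕ) (P : Matrix (Fin n) (Fin n) ℝ) :
    Matrix (Fin n) (Fin n) ℝ :=
  (1 - S.Ngain F k P * S.C2 F (k + 1)) * S.Ahat F k

section Decay

variable (hS : S.Standing F) (hrank : ∀ k, (S.C2 F (k + 1) * S.G2 F k).rank = p - S.pH k)
  {P0 : Matrix (Fin n) (Fin n) ℝ} (hP0 : P0.PosSemidef)
  (hdet : UniformlyDetectable (S.Atil F) (fun k => S.C2 F (k + 1)))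
  (hstab : UniformlyStabilizable (S.Atil F) (fun k => CFC.sqrt (S.Qtil F k)))
include hS hrank hP0 hdet hstab

theorem exists_closed_loop_decay : ∃ M ρ : ℝ, 0 ≤ M ∧ 0 < ρ ∧ ρ < 1 ∧ ∀ k j v,
      (transition (fun k => S.Atil F k - (1 - S.Etil F (k + 1)) * S.Ahat F (k + 1) *
        (S.Ngain F k (S.Px F P0 k) - S.G2 F k * S.Mtil F k) * S.C2 F (k + 1)) k j *ᵥ v) ⬝ᵥ
      (transition (fun k => S.Atil F k - (1 - S.Etil F (k + 1)) * S.Ahat F (k + 1) *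
        (S.Ngain F k (S.Px F P0 k) - S.G2 F k * S.Mtil F k) * S.C2 F (k + 1)) k j *ᵥ v) ≤
      M * ρ ^ j * (v ⬝ᵥ v) := by
  have hsq : ∀ k v, ((CFC.sqrt (S.Qtil F k))ᵀ *ᵥ v) ⬝ᵥ ((CFC.sqrt (S.Qtil F k))ᵀ *ᵥ v) =
      v ⬝ᵥ (S.Qtil F k *ᵥ v) := fun k v => by
    have h1 : (CFC.sqrt (S.Qtil F k)).PosSemidef :=
      Matrix.nonneg_iff_posSemidef.1 (CFC.sqrt_nonneg _)
    have h2 : CFC.sqrt (S.Qtil F k) * CFC.sqrt (S.Qtil F k) = S.Qtil F k :=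
      CFC.sqrt_mul_sqrt_self _ (Matrix.nonneg_iff_posSemidef.2 (hS.Qtil_posSemidef k))
    rw [← dotProduct_transpose_mul_mulVec, transpose_transpose, h1.transpose_eq, h2]
  have hB : OpBdd fun k => CFC.sqrt (S.Qtil F k) := by
    obtain ⟨q, hq0, hq⟩ := hS.opBdd_Qtil.quad
    have : OpBdd fun k => (CFC.sqrt (S.Qtil F k))ᵀ :=
      ⟨q, hq0, fun k v => by rw [hsq]; exact hq k v⟩
    simpa only [transpose_transpose] using this.transpose
  obtain ⟨c, hc, hV⟩ := exists_Fcov_bound hS hrank hP0 hdet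
  obtain ⟨r, hr0, hr⟩ := hS.R2_ge
  obtain ⟨z, hz0, hz⟩ := hS.opBdd_projection.transpose
  have hP := Px_posSemidef (F := F) hS.Q_posSemidef hS.R_posDef hP0
  refine hstab.closed_loop_decay hS.opBdd_Atil hB hS.opBdd_C2.succ
    (fun k => (1 - S.Etil F (k + 1)) * S.Ahat F (k + 1) *
      (S.Ngain F k (S.Px F P0 k) - S.G2 F k * S.Mtil F k))
    (V := fun k v => v ⬝ᵥ (S.Fcov F k (S.Px F P0 k) *ᵥ v)) (κ := r / (z + 1)) (c := c)
    (by positivity) hc ?_ hV ?_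
  · intro k v
    exact ((Ptil_posSemidef hS.Q_posSemidef hS.R_posDef k (hP k)).mul_mul_transpose _).quad_nonneg v
  · intro k v
    set Λ := S.Ngain F k (S.Px F P0 k) - S.G2 F k * S.Mtil F k with hΛ
    set μ := ((1 - S.Etil F (k + 1)) * S.Ahat F (k + 1))ᵀ *ᵥ v with hμ
    have eK : ((1 - S.Etil F (k + 1)) * S.Ahat F (k + 1) * Λ)ᵀ *ᵥ v = Λᵀ *ᵥ μ := by
      rw [transpose_mul _ Λ, ← mulVec_mulVec]
    have e1 : v ⬝ᵥ (S.Fcov F (k + 1) (S.Px F P0 (k + 1)) *ᵥ v) =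
        μ ⬝ᵥ (S.Pnext F k (S.Px F P0 k) *ᵥ μ) + v ⬝ᵥ (S.Qtil F k *ᵥ v) := by
      rw [Fcov_succ, add_mulVec, dotProduct_add, dotProduct_mul_mul_transpose_mulVec]; rfl
    have e2 : (S.Atil F k - (1 - S.Etil F (k + 1)) * S.Ahat F (k + 1) * Λ * S.C2 F (k + 1))ᵀ *ᵥ v
        = (S.Atil F k)ᵀ *ᵥ v - (S.C2 F (k + 1))ᵀ *ᵥ (Λᵀ *ᵥ μ) := by
      rw [transpose_sub, transpose_mul _ (S.C2 F (k + 1)), sub_mulVec, ← mulVec_mulVec, eK]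
    have e3 := quad_Pnext_eq hS hrank k (hP k) μ
    rw [← hΛ, quad_Fcov, one_sub_Etil_transpose_mulVec hrank, ← quad_Fcov, ← e2] at e3
    rw [e1, e3, hsq, eK]
    have h1 := hr (k + 1) ((S.Ngain F k (S.Px F P0 k))ᵀ *ᵥ μ)
    have h2 := hz k ((S.Ngain F k (S.Px F P0 k))ᵀ *ᵥ μ)
    rw [← gain_deviation_eq hS hrank k (hP k), ← hΛ] at h2
    have hb := dotProduct_self_nonneg' ((S.Ngain F k (S.Px F P0 k))ᵀ *ᵥ μ)
    -- |Λᵀμ|² ≤ z|Nᵀμ|², and z + 1 avoids division by zero. The Lyapunov decrease thus includes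
    -- control energy with weight r/(z + 1).
    have h3 : r / (z + 1) * ((Λᵀ *ᵥ μ) ⬝ᵥ (Λᵀ *ᵥ μ)) ≤
        r * (((S.Ngain F k (S.Px F P0 k))ᵀ *ᵥ μ) ⬝ᵥ ((S.Ngain F k (S.Px F P0 k))ᵀ *ᵥ μ)) := by
      rw [div_mul_eq_mul_div, div_le_iff₀ (by positivity), mul_assoc]
      refine mul_le_mul_of_nonneg_left ?_ hr0.le
      linarith
    linarith

/-- Because ΛC₂E = 0, the factor I - NC₂ equals (I - ΛC₂)(I - E). So f = (I - E)Âe gives e⁺ = (I -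
ΛC₂)f; as Ef = 0, Ã acts on f as (I - E)Â and f follows the closed loop. The bounded maps from e to
f and back cost one time step, hence the division by ρ. -/
theorem exists_error_decay : ∃ M ρ : ℝ, 0 ≤ M ∧ 0 < ρ ∧ ρ < 1 ∧ ∀ e : ℕ → Fin n → ℝ,
    (∀ k, e (k + 1) = S.errTransition F k (S.Px F P0 k) *ᵥ e k) →
    ∀ j k, j ≤ k → e k ⬝ᵥ e k ≤ M * ρ ^ (k - j) * (e j ⬝ᵥ e j) := by
  obtain ⟨M, ρ, hM, hρ0, hρ1, h⟩ := exists_closed_loop_decay hS hrank hP0 hdet hstab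
  have hΛ : OpBdd fun k => 1 - (S.Ngain F k (S.Px F P0 k) - S.G2 F k * S.Mtil F k) *
      S.C2 F (k + 1) :=
    (OpBdd.one (α := fun _ => Fin n)).sub (((opBdd_Ngain hS hrank hP0 hdet).sub
      (hS.opBdd_G2.mul hS.opBdd_Mtil)).mul hS.opBdd_C2.succ)
  obtain ⟨a, ha0, ha⟩ := hΛ
  obtain ⟨b, hb0, hb⟩ := hS.opBdd_one_sub_Etil.mul hS.opBdd_Ahat
  have hP := Px_posSemidef (F := F) hS.Q_posSemidef hS.R_posDef hP0
  set Acl := fun k => S.Atil F k - (1 - S.Etil F (k + 1)) * S.Ahat F (k + 1) *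
        (S.Ngain F k (S.Px F P0 k) - S.G2 F k * S.Mtil F k) * S.C2 F (k + 1) with hAcl
  refine ⟨1 + a * (M * b) / ρ, ρ, by positivity, hρ0, hρ1, fun e he j k hjk => ?_⟩
  set f : ℕ → Fin n → ℝ := fun k => ((1 - S.Etil F k) * S.Ahat F k) *ᵥ e k with hf
  have hef : ∀ k, e (k + 1) = (1 - (S.Ngain F k (S.Px F P0 k) - S.G2 F k * S.Mtil F k) *
      S.C2 F (k + 1)) *ᵥ f k := fun k => by
    have hNX := Ngain_mul hS.Q_posSemidef hS.R_posDef k (hP k) hrank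
    have hMX := Mtil_mul (F := F) hrank k
    have h0 : (S.Ngain F k (S.Px F P0 k) - S.G2 F k * S.Mtil F k) * S.C2 F (k + 1) *
        S.Etil F k = 0 := by
      calc _ = ((S.Ngain F k (S.Px F P0 k) * (S.C2 F (k + 1) * S.G2 F k)) -
              S.G2 F k * (S.Mtil F k * (S.C2 F (k + 1) * S.G2 F k))) *
            (S.Mtil F k * S.C2 F (k + 1)) := by
            simp only [Etil, Matrix.sub_mul, Matrix.mul_assoc]
        _ = 0 := by rw [hNX, hMX, Matrix.mul_one, sub_self, Matrix.zero_mul]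
    rw [he, errTransition, hf, mulVec_mulVec, ← Matrix.mul_assoc, Matrix.mul_sub (1 - _ * _),
      Matrix.sub_mul 1 _ (S.Etil F k), h0, Matrix.mul_one, Etil]
    congr 2
    simp only [Matrix.sub_mul, Matrix.one_mul, sub_zero]
    abel
  have hff : ∀ k, f (k + 1) = Acl k *ᵥ f k := fun k => by
    have h0 : S.Etil F k *ᵥ f k = 0 := by
      rw [hf, mulVec_mulVec, ← Matrix.mul_assoc, Matrix.mul_sub, Matrix.mul_one,
        Etil_mul_Etil hrank, sub_self, Matrix.zero_mul, zero_mulVec]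
    have h1 : f (k + 1) = ((1 - S.Etil F (k + 1)) * S.Ahat F (k + 1)) *ᵥ e (k + 1) := rfl
    rw [h1, hef, hAcl]
    simp only [Atil, sub_mulVec, add_mulVec, h0, add_zero, mulVec_sub, one_mulVec, mulVec_mulVec,
      Matrix.mul_assoc]
  have hft : ∀ i, f (j + i) = transition Acl j i *ᵥ f j := fun i => by
    induction i with
    | zero => simp [transition]
    | succ i ih => rw [← add_assoc, hff, ih, transition, mulVec_mulVec]
  have hej := dotProduct_self_nonneg' (e j)
  obtain ⟨i, rfl⟩ := Nat.exists_eq_add_of_le hjk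
  rw [Nat.add_sub_cancel_left]
  cases i with
  | zero =>
    rw [pow_zero, mul_one, add_zero]
    refine le_mul_of_one_le_left hej ?_
    have : 0 ≤ a * (M * b) / ρ := by positivity
    linarith
  | succ i =>
    have h1 := ha (j + i) (f (j + i))
    rw [← hef, hft] at h1
    have h2 := h j i (f j)
    have h3 := hb j (e j)
    have h4 := mul_le_mul_of_nonneg_left h2 ha0
    have h5 := mul_le_mul_of_nonneg_left h3 (by positivity : 0 ≤ a * (M * ρ ^ i))
    have h6 : a * (M * ρ ^ i) * (b * (e j ⬝ᵥ e j)) ≤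
        (1 + a * (M * b) / ρ) * ρ ^ (i + 1) * (e j ⬝ᵥ e j) := by
      have : (1 + a * (M * b) / ρ) * ρ ^ (i + 1) * (e j ⬝ᵥ e j) =
          ρ ^ (i + 1) * (e j ⬝ᵥ e j) + a * (M * ρ ^ i) * (b * (e j ⬝ᵥ e j)) := by
        rw [pow_succ]; field_simp
      rw [this]
      have : 0 ≤ ρ ^ (i + 1) * (e j ⬝ᵥ e j) := by positivity
      linarith
    rw [← add_assoc]
    linarith

end Decay

/-! ### Pointwise error recursions -/

section Errors

variable {Ω : Type u} (x0 : Ω → Fin n → ℝ) (u : ℕ → Ω → Fin m → ℝ) (d : ℕ → Ω → Fin p → ℝ)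
  (w : ℕ → Ω → Fin n → ℝ) (v : ℕ → Ω → Fin l → ℝ) (P0 : Matrix (Fin n) (Fin n) ℝ)
  (xh0 : Fin n → ℝ)

theorem T1_mul_H (k : ℕ) : S.T1 F k * S.H k = S.Sig F k * (F k).V1ᵀ := by
  rw [T1, Matrix.sub_mul, Matrix.mul_assoc _ (F k).U2ᵀ, (F k).U2_transpose_mul,
    (F k).U1_transpose_mul, Matrix.mul_zero, sub_zero, Sig]

theorem T2_mul_H (k : ℕ) : S.T2 F k * S.H k = 0 := (F k).U2_transpose_mul

/-- T₁H = ΣV₁ᵀ and M₁ = Σ⁻¹, so the estimate is the true V₁ᵀd plus a linear error in which no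
unknown input occurs. -/
theorem d1est_eq (k : ℕ) (ω : Ω) (xh : Fin n → ℝ) :
    S.d1est F (fun j => u j ω) (fun j => S.output x0 u d w v j ω) k xh =
      S.M1 F k *ᵥ (S.C1 F k *ᵥ (S.state x0 u d w k ω - xh) + S.T1 F k *ᵥ v k ω)
        + (F k).V1ᵀ *ᵥ d k ω := by
  have h1 : S.M1 F k *ᵥ (S.T1 F k *ᵥ (S.H k *ᵥ d k ω)) = (F k).V1ᵀ *ᵥ d k ω := by
    rw [mulVec_mulVec _ (S.T1 F k), T1_mul_H, mulVec_mulVec, ← Matrix.mul_assoc, M1, Sig,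
      (F k).diagonal_inv_mul, Matrix.one_mul]
  rw [d1est, output, ← h1]
  simp only [C1, D1, mulVec_add, mulVec_sub, mulVec_mulVec]
  abel

theorem state_sub_xpred (k : ℕ) (ω : Ω) (xh : Fin n → ℝ) :
    S.state x0 u d w (k + 1) ω -
        S.xpred F (fun j => u j ω) (fun j => S.output x0 u d w v j ω) k xh =
      S.Ahat F k *ᵥ (S.state x0 u d w k ω - xh) + w k ω -
        (S.G1 F k * S.M1 F k * S.T1 F k) *ᵥ v k ω + S.G2 F k *ᵥ ((F k).V2ᵀ *ᵥ d k ω) := by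
  have h1 : S.G k *ᵥ d k ω = S.G1 F k *ᵥ ((F k).V1ᵀ *ᵥ d k ω) +
      S.G2 F k *ᵥ ((F k).V2ᵀ *ᵥ d k ω) := by
    conv_lhs => rw [← one_mulVec (d k ω), ← (F k).V_sum]
    simp only [G1, G2, mulVec_add, add_mulVec, mulVec_mulVec, Matrix.mul_assoc]
  rw [xpred, d1est_eq, state]
  simp only [h1, Ahat]
  simp only [mulVec_add, mulVec_sub, sub_mulVec, mulVec_mulVec, Matrix.mul_assoc]
  abel

section

variable (hQ : ∀ k, (S.Q k).PosSemidef) (hR : ∀ k, (S.R k).PosDef)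
  (hrank : ∀ k, (S.C2 F (k + 1) * S.G2 F k).rank = p - S.pH k) {P0} (hP0 : P0.PosSemidef)
include hQ hR hrank hP0

/-- T₂H = 0 hides the new unknown input, and M₂C₂G₂ = I recovers the delayed V₂ᵀd exactly apart from
state error and noise. -/
theorem d2est_eq (k : ℕ) (ω : Ω) (xh : Fin n → ℝ) :
    S.d2est F P0 (fun j => u j ω) (fun j => S.output x0 u d w v j ω) k xh =
      S.M2 F k (S.Px F P0 k) *ᵥ (S.C2 F (k + 1) *ᵥ
        (S.Ahat F k *ᵥ (S.state x0 u d w k ω - xh) + w k ω -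
          (S.G1 F k * S.M1 F k * S.T1 F k) *ᵥ v k ω) + S.T2 F (k + 1) *ᵥ v (k + 1) ω)
      + (F k).V2ᵀ *ᵥ d k ω := by
  have hM := M2_mul hQ hR hrank k (Px_posSemidef (F := F) hQ hR hP0 k)
  have h1 : S.M2 F k (S.Px F P0 k) *ᵥ (S.C2 F (k + 1) *ᵥ
      (S.G2 F k *ᵥ ((F k).V2ᵀ *ᵥ d k ω))) = (F k).V2ᵀ *ᵥ d k ω := by
    rw [mulVec_mulVec _ (S.C2 F (k + 1)), mulVec_mulVec, hM, one_mulVec]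
  have h2 := state_sub_xpred (F := F) x0 u d w v k ω xh
  have h3 : S.T2 F (k + 1) *ᵥ (S.H (k + 1) *ᵥ d (k + 1) ω) = 0 := by
    rw [mulVec_mulVec, T2_mul_H, zero_mulVec]
  rw [← h1, ← mulVec_add, d2est]
  congr 1
  rw [add_right_comm, ← mulVec_add, ← h2, output]
  simp only [mulVec_add, h3, mulVec_sub, C2, D2, mulVec_mulVec]
  abel

/-- The first correction cancels the G₂ part of the past input, and LH = 0 keeps out the present
one. Known and unknown inputs may therefore be arbitrary, even non-measurable, without affecting the
error. -/
theorem xErr_succ (k : ℕ) (ω : Ω) :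
    S.xErr F x0 u d w v P0 xh0 (k + 1) ω =
      (1 - S.Ngain F k (S.Px F P0 k) * S.C2 F (k + 1)) *ᵥ
        (S.Ahat F k *ᵥ S.xErr F x0 u d w v P0 xh0 k ω + w k ω -
          (S.G1 F k * S.M1 F k * S.T1 F k) *ᵥ v k ω) -
      (S.Ngain F k (S.Px F P0 k) * S.T2 F (k + 1)) *ᵥ v (k + 1) ω := by
  have hP := Px_posSemidef (F := F) hQ hR hP0 k
  have hL := Lgain_mul_U2_mul (F := F) hQ hR k hP
  have hLH : S.Lgain F k (S.Px F P0 k) *ᵥ (S.H (k + 1) *ᵥ d (k + 1) ω) = 0 := by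
    have := T2_mul_H (F := F) (k + 1)
    rw [T2] at this
    rw [mulVec_mulVec, ← hL, Matrix.mul_assoc, this, Matrix.mul_zero, zero_mulVec]
  set xh := S.xhat F P0 (fun j => u j ω) (fun j => S.output x0 u d w v j ω) xh0 k with hxh
  have he : S.xErr F x0 u d w v P0 xh0 k ω = S.state x0 u d w k ω - xh := rfl
  have h1 := state_sub_xpred (F := F) x0 u d w v k ω xh
  have h2 := d2est_eq (F := F) x0 u d w v hQ hR hrank hP0 k ω xh
  rw [he]
  set η := S.Ahat F k *ᵥ (S.state x0 u d w k ω - xh) + w k ω -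
    (S.G1 F k * S.M1 F k * S.T1 F k) *ᵥ v k ω with hη
  set xs := S.xstar F P0 (fun j => u j ω) (fun j => S.output x0 u d w v j ω) k xh with hxs
  have h3 : S.state x0 u d w (k + 1) ω - xs =
      (1 - S.G2 F k * S.M2 F k (S.Px F P0 k) * S.C2 F (k + 1)) *ᵥ η -
        (S.G2 F k * S.M2 F k (S.Px F P0 k)) *ᵥ (S.T2 F (k + 1) *ᵥ v (k + 1) ω) := by
    rw [hxs, xstar, ← sub_sub, h1, h2]
    simp only [mulVec_add, sub_mulVec, one_mulVec, mulVec_mulVec, Matrix.mul_assoc]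
    abel
  have h4 : S.xErr F x0 u d w v P0 xh0 (k + 1) ω =
      (1 - S.Lgain F k (S.Px F P0 k) * S.C (k + 1)) *ᵥ (S.state x0 u d w (k + 1) ω - xs) -
        S.Lgain F k (S.Px F P0 k) *ᵥ v (k + 1) ω := by
    rw [xErr, xhat, ← hxh, ← hxs, output]
    simp only [mulVec_add, mulVec_sub, sub_mulVec, one_mulVec, hLH, ← mulVec_mulVec]
    abel
  have h5 : S.Lgain F k (S.Px F P0 k) *ᵥ v (k + 1) ω =
      (S.Lgain F k (S.Px F P0 k) * (F (k + 1)).U2) *ᵥ (S.T2 F (k + 1) *ᵥ v (k + 1) ω) := by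
    conv_lhs => rw [← hL]
    rw [T2, mulVec_mulVec]
  rw [h4, h3, h5, one_sub_Ngain_mul hQ hR k hP, Ngain_eq hQ hR k hP]
  simp only [mulVec_sub, add_mulVec, Matrix.add_mul, mulVec_mulVec, Matrix.mul_assoc]
  abel

theorem dErr_eq (k : ℕ) (ω : Ω) :
    S.dErr F x0 u d w v P0 xh0 k ω =
      -((F k).V1 *ᵥ (S.M1 F k *ᵥ (S.C1 F k *ᵥ S.xErr F x0 u d w v P0 xh0 k ω +
        S.T1 F k *ᵥ v k ω))) -
      (F k).V2 *ᵥ (S.M2 F k (S.Px F P0 k) *ᵥ (S.C2 F (k + 1) *ᵥ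
        (S.Ahat F k *ᵥ S.xErr F x0 u d w v P0 xh0 k ω + w k ω -
          (S.G1 F k * S.M1 F k * S.T1 F k) *ᵥ v k ω) + S.T2 F (k + 1) *ᵥ v (k + 1) ω)) := by
  set xh := S.xhat F P0 (fun j => u j ω) (fun j => S.output x0 u d w v j ω) xh0 k with hxh
  have he : S.xErr F x0 u d w v P0 xh0 k ω = S.state x0 u d w k ω - xh := rfl
  have h1 : d k ω = (F k).V1 *ᵥ ((F k).V1ᵀ *ᵥ d k ω) + (F k).V2 *ᵥ ((F k).V2ᵀ *ᵥ d k ω) := by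
    conv_lhs => rw [← one_mulVec (d k ω), ← (F k).V_sum]
    rw [add_mulVec, mulVec_mulVec, mulVec_mulVec]
  rw [he, dErr, dhat, ← hxh, d1est_eq, d2est_eq x0 u d w v hQ hR hrank hP0,
    mulVec_add (F k).V1, mulVec_add (F k).V2]
  conv_lhs => enter [1]; rw [h1]
  abel

end

end Errors

end LinSys

/-! ### Cross moments of square integrable random vectors -/

section CrossMoment

variable {Ω : Type*} [MeasurableSpace Ω] {μ : Measure Ω} {a b c : ℕ}

theorem MeasureTheory.MemLp.mulVec {q : ENNReal} {f : Ω → Fin b → ℝ} (hf : MemLp f q μ)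
    (M : Matrix (Fin a) (Fin b) ℝ) : MemLp (fun ω => M *ᵥ f ω) q μ :=
  (LinearMap.toContinuousLinearMap M.mulVecLin).comp_memLp' hf

theorem integral_mulVec {f : Ω → Fin b → ℝ} (hf : Integrable f μ)
    (M : Matrix (Fin a) (Fin b) ℝ) : ∫ ω, M *ᵥ f ω ∂μ = M *ᵥ ∫ ω, f ω ∂μ :=
  (LinearMap.toContinuousLinearMap M.mulVecLin).integral_comp_comm hf

theorem integral_combination {q₁ q₂ q₃ q₄ : ℕ} {f₁ : Ω → Fin q₁ → ℝ} {f₂ : Ω → Fin q₂ → ℝ}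
    {f₃ : Ω → Fin q₃ → ℝ} {f₄ : Ω → Fin q₄ → ℝ} (h₁ : Integrable f₁ μ) (h₂ : Integrable f₂ μ)
    (h₃ : Integrable f₃ μ) (h₄ : Integrable f₄ μ) (z₂ : ∫ ω, f₂ ω ∂μ = 0)
    (z₃ : ∫ ω, f₃ ω ∂μ = 0) (z₄ : ∫ ω, f₄ ω ∂μ = 0)
    (M₁ : Matrix (Fin a) (Fin q₁) ℝ) (M₂ : Matrix (Fin a) (Fin q₂) ℝ)
    (M₃ : Matrix (Fin a) (Fin q₃) ℝ) (M₄ : Matrix (Fin a) (Fin q₄) ℝ) :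
    ∫ ω, M₁ *ᵥ f₁ ω + M₂ *ᵥ f₂ ω + M₃ *ᵥ f₃ ω + M₄ *ᵥ f₄ ω ∂μ = M₁ *ᵥ ∫ ω, f₁ ω ∂μ := by
  have j : ∀ {b : ℕ} {f : Ω → Fin b → ℝ} (_ : Integrable f μ) (M : Matrix (Fin a) (Fin b) ℝ),
      Integrable (fun ω => M *ᵥ f ω) μ := fun h M =>
    (LinearMap.toContinuousLinearMap M.mulVecLin).integrable_comp h
  have h12 : Integrable (fun ω => M₁ *ᵥ f₁ ω + M₂ *ᵥ f₂ ω) μ := (j h₁ M₁).add (j h₂ M₂)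
  have h123 : Integrable (fun ω => M₁ *ᵥ f₁ ω + M₂ *ᵥ f₂ ω + M₃ *ᵥ f₃ ω) μ := h12.add (j h₃ M₃)
  rw [integral_add h123 (j h₄ M₄), integral_add h12 (j h₃ M₃), integral_add (j h₁ M₁) (j h₂ M₂),
    integral_mulVec h₁, integral_mulVec h₂, integral_mulVec h₃, integral_mulVec h₄, z₂, z₃, z₄,
    mulVec_zero, mulVec_zero, mulVec_zero]
  simp only [add_zero]

theorem integral_eval {f : Ω → Fin b → ℝ} (hf : Integrable f μ) (i : Fin b) :
    ∫ ω, f ω i ∂μ = (∫ ω, f ω ∂μ) i :=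
  (ContinuousLinearMap.proj (R := ℝ) (φ := fun _ : Fin b => ℝ) i).integral_comp_comm hf

/-- The matrix `E[f gᵀ]`. -/
noncomputable def crossMoment (μ : Measure Ω) (f : Ω → Fin a → ℝ) (g : Ω → Fin b → ℝ) :
    Matrix (Fin a) (Fin b) ℝ :=
  Matrix.of fun i j => ∫ ω, f ω i * g ω j ∂μ

theorem crossMoment_transpose (f : Ω → Fin a → ℝ) (g : Ω → Fin b → ℝ) :
    (crossMoment μ f g)ᵀ = crossMoment μ g f := by
  ext i j
  simp only [crossMoment, transpose_apply, of_apply, mul_comm]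

variable {f f' : Ω → Fin a → ℝ} {g : Ω → Fin b → ℝ}

theorem integrable_mul_eval (hf : MemLp f 2 μ) (hg : MemLp g 2 μ) (i : Fin a) (j : Fin b) :
    Integrable (fun ω => f ω i * g ω j) μ :=
  (hf.eval i).integrable_mul (hg.eval j)

theorem crossMoment_add_left (hf : MemLp f 2 μ) (hf' : MemLp f' 2 μ) (hg : MemLp g 2 μ) :
    crossMoment μ (fun ω => f ω + f' ω) g = crossMoment μ f g + crossMoment μ f' g := by
  ext i j
  simp only [crossMoment, of_apply, Matrix.add_apply, Pi.add_apply, add_mul]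
  exact integral_add (integrable_mul_eval hf hg i j) (integrable_mul_eval hf' hg i j)

theorem crossMoment_mulVec_left (hf : MemLp f 2 μ) (hg : MemLp g 2 μ)
    (M : Matrix (Fin c) (Fin a) ℝ) :
    crossMoment μ (fun ω => M *ᵥ f ω) g = M * crossMoment μ f g := by
  ext i j
  simp only [crossMoment, of_apply, Matrix.mul_apply, Matrix.mulVec, dotProduct, Finset.sum_mul]
  rw [integral_finsetSum _ fun k _ => by
    simpa only [mul_assoc] using (integrable_mul_eval hf hg k j).const_mul (M i k)]
  simp only [mul_assoc, integral_const_mul]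

theorem crossMoment_combination {q₁ q₂ q₃ q₄ : ℕ} {f₁ : Ω → Fin q₁ → ℝ} {f₂ : Ω → Fin q₂ → ℝ}
    {f₃ : Ω → Fin q₃ → ℝ} {f₄ : Ω → Fin q₄ → ℝ} (h₁ : MemLp f₁ 2 μ) (h₂ : MemLp f₂ 2 μ)
    (h₃ : MemLp f₃ 2 μ) (h₄ : MemLp f₄ 2 μ) (hg : MemLp g 2 μ)
    (M₁ : Matrix (Fin a) (Fin q₁) ℝ) (M₂ : Matrix (Fin a) (Fin q₂) ℝ)
    (M₃ : Matrix (Fin a) (Fin q₃) ℝ) (M₄ : Matrix (Fin a) (Fin q₄) ℝ) :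
    crossMoment μ (fun ω => M₁ *ᵥ f₁ ω + M₂ *ᵥ f₂ ω + M₃ *ᵥ f₃ ω + M₄ *ᵥ f₄ ω) g =
      M₁ * crossMoment μ f₁ g + M₂ * crossMoment μ f₂ g + M₃ * crossMoment μ f₃ g +
        M₄ * crossMoment μ f₄ g := by
  have h12 : MemLp (fun ω => M₁ *ᵥ f₁ ω + M₂ *ᵥ f₂ ω) 2 μ := (h₁.mulVec M₁).add (h₂.mulVec M₂)
  have h123 : MemLp (fun ω => M₁ *ᵥ f₁ ω + M₂ *ᵥ f₂ ω + M₃ *ᵥ f₃ ω) 2 μ := h12.add (h₃.mulVec M₃)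
  rw [← crossMoment_mulVec_left h₁ hg, ← crossMoment_mulVec_left h₂ hg,
    ← crossMoment_mulVec_left h₃ hg, ← crossMoment_mulVec_left h₄ hg,
    ← crossMoment_add_left (h₁.mulVec M₁) (h₂.mulVec M₂) hg,
    ← crossMoment_add_left h12 (h₃.mulVec M₃) hg,
    ← crossMoment_add_left h123 (h₄.mulVec M₄) hg]

theorem crossMoment_eq_zero_of_indepFun [IsProbabilityMeasure μ] (h : IndepFun f g μ)
    (hf : MemLp f 2 μ) (hg : MemLp g 2 μ) (hg0 : ∫ ω, g ω ∂μ = 0) (x : Fin a → ℝ) :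
    crossMoment μ (fun ω => f ω - x) g = 0 := by
  ext i j
  have h1 : IndepFun (fun ω => f ω i - x i) (fun ω => g ω j) μ :=
    h.comp (φ := fun y : Fin a → ℝ => y i - x i) (ψ := fun y : Fin b → ℝ => y j)
      (by fun_prop) (by fun_prop)
  have h2 := h1.integral_mul_eq_mul_integral
    ((hf.eval i).aestronglyMeasurable.sub aestronglyMeasurable_const)
    (hg.eval j).aestronglyMeasurable
  have h3 : ∫ ω, g ω j ∂μ = 0 := by
    rw [integral_eval (hg.integrable (by norm_num)), hg0, Pi.zero_apply]
  rw [h3, mul_zero] at h2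
  exact h2

end CrossMoment

/-! ### Means and second moments of the estimation errors -/

namespace LinSys

variable {n m p l : ℕ} {S : LinSys n m p l} {F : ∀ k, SVD (S.H k)}

/-- T₁ subtracts from U₁ᵀv its linear regression on U₂ᵀv, which makes the noises of z₁ and z₂
uncorrelated. -/
theorem T2_mul_R_mul_T1 (hR : ∀ k, (S.R k).PosDef) (k : ℕ) :
    S.T2 F k * S.R k * (S.T1 F k)ᵀ = 0 := by
  have h := R2_posDef (F := F) hR k
  have hs := (hR k).posSemidef.transpose_eq
  rw [R2, T2, transpose_transpose] at h
  have h1 : S.T1 F k * S.R k * (F k).U2 = 0 := by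
    have h2 := nonsing_inv_mul _ ((isUnit_iff_isUnit_det _).1 h.isUnit)
    rw [Matrix.mul_assoc (F k).U2ᵀ] at h2
    rw [T1, Matrix.sub_mul, Matrix.sub_mul]
    simp only [Matrix.mul_assoc] at h2 ⊢
    rw [h2, Matrix.mul_one, sub_self]
  have h3 := congrArg transpose h1
  rw [transpose_mul, transpose_mul, hs, transpose_zero, ← Matrix.mul_assoc] at h3
  exact h3

section Stochastic

variable {Ω : Type u} [MeasurableSpace Ω] {μ : Measure Ω} [IsProbabilityMeasure μ]
  {x0 : Ω → Fin n → ℝ} (u : ℕ → Ω → Fin m → ℝ) (d : ℕ → Ω → Fin p → ℝ)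
  {w : ℕ → Ω → Fin n → ℝ} {v : ℕ → Ω → Fin l → ℝ} {P0 : Matrix (Fin n) (Fin n) ℝ}
  (xh0 : Fin n → ℝ)
  (hQ : ∀ k, (S.Q k).PosSemidef) (hR : ∀ k, (S.R k).PosDef)
  (hrank : ∀ k, (S.C2 F (k + 1) * S.G2 F k).rank = p - S.pH k) (hP0 : P0.PosSemidef)
  (hN : S.Noise x0 w v μ)
include hQ hR hrank hP0

omit [MeasurableSpace Ω] in
theorem xErr_succ_combination (k : ℕ) (ω : Ω) :
    S.xErr F x0 u d w v P0 xh0 (k + 1) ω =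
      S.errTransition F k (S.Px F P0 k) *ᵥ S.xErr F x0 u d w v P0 xh0 k ω +
      (1 - S.Ngain F k (S.Px F P0 k) * S.C2 F (k + 1)) *ᵥ w k ω +
      (-((1 - S.Ngain F k (S.Px F P0 k) * S.C2 F (k + 1)) *
        (S.G1 F k * S.M1 F k * S.T1 F k))) *ᵥ v k ω +
      (-(S.Ngain F k (S.Px F P0 k) * S.T2 F (k + 1))) *ᵥ v (k + 1) ω := by
  rw [xErr_succ x0 u d w v xh0 hQ hR hrank hP0, errTransition]
  simp only [mulVec_add, mulVec_sub, mulVec_mulVec, neg_mulVec]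
  abel

include hN

theorem memLp_xErr (k : ℕ) : MemLp (S.xErr F x0 u d w v P0 xh0 k) 2 μ := by
  induction k with
  | zero => exact hN.memLp_x0.sub (memLp_const xh0)
  | succ k ih =>
    have h : S.xErr F x0 u d w v P0 xh0 (k + 1) = _ :=
      funext fun ω => xErr_succ_combination u d xh0 hQ hR hrank hP0 k ω
    rw [h]
    exact (((ih.mulVec _).add ((hN.memLp_w k).mulVec _)).add ((hN.memLp_v k).mulVec _)).add
      ((hN.memLp_v (k + 1)).mulVec _)

theorem memLp_dErr (k : ℕ) : MemLp (S.dErr F x0 u d w v P0 xh0 k) 2 μ := by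
  have h : S.dErr F x0 u d w v P0 xh0 k = _ :=
    funext fun ω => dErr_eq x0 u d w v xh0 hQ hR hrank hP0 k ω
  rw [h]
  have he := memLp_xErr u d xh0 hQ hR hrank hP0 hN k
  exact ((((he.mulVec _).add ((hN.memLp_v k).mulVec _)).mulVec _).mulVec _).neg.sub
    ((((((he.mulVec _).add (hN.memLp_w k)).sub ((hN.memLp_v k).mulVec _)).mulVec _).add
      ((hN.memLp_v (k + 1)).mulVec _)).mulVec _ |>.mulVec _)

theorem integral_xErr_succ (k : ℕ) :
    ∫ ω, S.xErr F x0 u d w v P0 xh0 (k + 1) ω ∂μ =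
      S.errTransition F k (S.Px F P0 k) *ᵥ ∫ ω, S.xErr F x0 u d w v P0 xh0 k ω ∂μ := by
  simp only [xErr_succ_combination u d xh0 hQ hR hrank hP0]
  have i1 := (memLp_xErr (F := F) u d xh0 hQ hR hrank hP0 hN k).integrable (by norm_num)
  have i2 := (hN.memLp_w k).integrable (by norm_num)
  have i3 := (hN.memLp_v k).integrable (by norm_num)
  have i4 := (hN.memLp_v (k + 1)).integrable (by norm_num)
  exact integral_combination i1 i2 i3 i4 (hN.mean_w _) (hN.mean_v _) (hN.mean_v _) _ _ _ _

theorem integral_dErr (k : ℕ) :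
    ∫ ω, S.dErr F x0 u d w v P0 xh0 k ω ∂μ =
      -((F k).V1 * S.M1 F k * S.C1 F k +
        (F k).V2 * S.M2 F k (S.Px F P0 k) * S.C2 F (k + 1) * S.Ahat F k) *ᵥ
        ∫ ω, S.xErr F x0 u d w v P0 xh0 k ω ∂μ := by
  have i1 := (memLp_xErr (F := F) u d xh0 hQ hR hrank hP0 hN k).integrable (by norm_num)
  have i2 := (hN.memLp_w k).integrable (by norm_num)
  have i3 := (hN.memLp_v k).integrable (by norm_num)
  have i4 := (hN.memLp_v (k + 1)).integrable (by norm_num)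
  set Y := (F k).V2 * S.M2 F k (S.Px F P0 k) * S.C2 F (k + 1)
  have h : ∀ ω, S.dErr F x0 u d w v P0 xh0 k ω =
      (-((F k).V1 * S.M1 F k * S.C1 F k + Y * S.Ahat F k)) *ᵥ S.xErr F x0 u d w v P0 xh0 k ω +
      (-Y) *ᵥ w k ω + (Y * (S.G1 F k * S.M1 F k * S.T1 F k) -
        (F k).V1 * S.M1 F k * S.T1 F k) *ᵥ v k ω +
      (-((F k).V2 * S.M2 F k (S.Px F P0 k) * S.T2 F (k + 1))) *ᵥ v (k + 1) ω := fun ω => by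
    rw [dErr_eq x0 u d w v xh0 hQ hR hrank hP0]
    simp only [Y, mulVec_add, mulVec_sub, add_mulVec, sub_mulVec, mulVec_mulVec, neg_mulVec,
      Matrix.mul_assoc]
    abel
  simp only [h]
  exact integral_combination i1 i2 i3 i4 (hN.mean_w _) (hN.mean_v _) (hN.mean_v _) _ _ _ _

/-- The second moment of the estimation error is the ULISE error covariance; the error is
uncorrelated with the future noises and with the part `T₁ v` of the current one. -/
theorem crossMoment_xErr
    (hcov : ∀ i j, ∫ ω, (x0 ω i - xh0 i) * (x0 ω j - xh0 j) ∂μ = P0 i j) (k : ℕ) :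
    crossMoment μ (S.xErr F x0 u d w v P0 xh0 k) (S.xErr F x0 u d w v P0 xh0 k) = S.Px F P0 k ∧
    (∀ j, k ≤ j → crossMoment μ (S.xErr F x0 u d w v P0 xh0 k) (w j) = 0) ∧
    (∀ j, k < j → crossMoment μ (S.xErr F x0 u d w v P0 xh0 k) (v j) = 0) ∧
    crossMoment μ (S.xErr F x0 u d w v P0 xh0 k) (v k) * (S.T1 F k)ᵀ = 0 := by
  have hww : ∀ i, crossMoment μ (w i) (w i) = S.Q i := fun i => by
    ext a b; exact hN.cov_w i a b
  have hvv : ∀ i, crossMoment μ (v i) (v i) = S.R i := fun i => by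
    ext a b; exact hN.cov_v i a b
  have hww' : ∀ i j, i ≠ j → crossMoment μ (w i) (w j) = 0 := fun i j h => by
    ext a b; exact hN.white_w i j h a b
  have hvv' : ∀ i j, i ≠ j → crossMoment μ (v i) (v j) = 0 := fun i j h => by
    ext a b; exact hN.white_v i j h a b
  have hwv : ∀ i j, crossMoment μ (w i) (v j) = 0 := fun i j => by
    ext a b; exact hN.uncorr_wv i j a b
  have hvw : ∀ i j, crossMoment μ (v i) (w j) = 0 := fun i j => by
    rw [← crossMoment_transpose, hwv, transpose_zero]
  induction k with
  | zero =>
    have hv0 : ∀ j, crossMoment μ (S.xErr F x0 u d w v P0 xh0 0) (v j) = 0 := fun j =>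
      crossMoment_eq_zero_of_indepFun (hN.indep_v j) hN.memLp_x0 (hN.memLp_v j) (hN.mean_v j) xh0
    refine ⟨?_, fun j _ => ?_, fun j _ => hv0 j, ?_⟩
    · ext i j; exact hcov i j
    · exact crossMoment_eq_zero_of_indepFun (hN.indep_w j) hN.memLp_x0 (hN.memLp_w j)
        (hN.mean_w j) xh0
    · rw [hv0, Matrix.zero_mul]
  | succ k ih =>
    obtain ⟨ih1, ih2, ih3, ih4⟩ := ih
    have hL := memLp_xErr (F := F) u d xh0 hQ hR hrank hP0 hN
    set e := S.xErr F x0 u d w v P0 xh0 k with he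
    set e' := S.xErr F x0 u d w v P0 xh0 (k + 1) with he'
    set N := S.Ngain F k (S.Px F P0 k) with hNg
    set I := 1 - N * S.C2 F (k + 1) with hI
    set Φ := S.errTransition F k (S.Px F P0 k) with hΦ
    set Γ := S.G1 F k * S.M1 F k with hΓ
    have hrec : ∀ {q : ℕ} {g : Ω → Fin q → ℝ}, MemLp g 2 μ → crossMoment μ e' g =
        Φ * crossMoment μ e g + I * crossMoment μ (w k) g +
        (-(I * (Γ * S.T1 F k))) * crossMoment μ (v k) g +
        (-(N * S.T2 F (k + 1))) * crossMoment μ (v (k + 1)) g := fun hg => by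
      rw [← crossMoment_combination (hL k) (hN.memLp_w k) (hN.memLp_v k) (hN.memLp_v (k + 1)) hg]
      congr 1
      exact funext fun ω => xErr_succ_combination u d xh0 hQ hR hrank hP0 k ω
    have hv1 : crossMoment μ e' (v (k + 1)) = -(N * S.T2 F (k + 1)) * S.R (k + 1) := by
      rw [hrec (hN.memLp_v _), ih3 _ (by omega), hwv, hvv' k (k + 1) (by omega), hvv]
      simp only [Matrix.mul_zero, zero_add]
    have hw0 : crossMoment μ e' (w k) = I * S.Q k := by
      rw [hrec (hN.memLp_w _), ih2 _ le_rfl, hww, hvw, hvw]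
      simp only [Matrix.mul_zero, zero_add, add_zero]
    have hv0 : crossMoment μ e' (v k) = Φ * crossMoment μ e (v k) +
        -(I * (Γ * S.T1 F k)) * S.R k := by
      rw [hrec (hN.memLp_v _), hwv, hvv, hvv' (k + 1) k (by omega)]
      simp only [Matrix.mul_zero, add_zero]
    -- The error at time k contains v_k, which also drives the next step, but there v_k appears only
    -- through T₁. This orthogonality removes their cross terms.
    have h4' : S.T1 F k * crossMoment μ (v k) e = 0 := by
      have := congrArg transpose ih4
      rwa [transpose_mul, transpose_transpose, crossMoment_transpose, transpose_zero] at this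
    have hee : crossMoment μ e' e = Φ * S.Px F P0 k := by
      rw [hrec (hL k), ih1, ← crossMoment_transpose e (w k), ih2 _ le_rfl,
        ← crossMoment_transpose e (v (k + 1)), ih3 _ (by omega)]
      have : -(I * (Γ * S.T1 F k)) * crossMoment μ (v k) e = 0 := by
        rw [Matrix.neg_mul, Matrix.mul_assoc, Matrix.mul_assoc, h4', Matrix.mul_zero,
          Matrix.mul_zero, neg_zero]
      rw [this]
      simp only [Matrix.mul_zero, transpose_zero, add_zero]
    refine ⟨?_, fun j hj => ?_, fun j hj => ?_, ?_⟩
    · rw [hrec (hL (k + 1)), ← crossMoment_transpose e' e, hee, ← crossMoment_transpose e' (w k),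
        hw0, ← crossMoment_transpose e' (v k), hv0, ← crossMoment_transpose e' (v (k + 1)), hv1]
      have hPs := (Px_posSemidef (F := F) hQ hR hP0 k)
      rw [Px, Pnext_eq hQ hR k hPs, ← hNg, ← hI, Ptil, Qhat, ← hΓ, R1, R2, hΦ, errTransition,
        ← hNg, ← hI]
      have z : S.T1 F k * (crossMoment μ e (v k))ᵀ = 0 := by rw [crossMoment_transpose, h4']
      have z' : ∀ {q : ℕ} (Z : Matrix (Fin n) (Fin q) ℝ),
          S.T1 F k * ((crossMoment μ e (v k))ᵀ * Z) = 0 := fun Z => by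
        rw [← Matrix.mul_assoc, z, Matrix.zero_mul]
      simp only [transpose_mul, transpose_add, transpose_neg, Matrix.mul_add, Matrix.add_mul,
        Matrix.mul_neg, Matrix.neg_mul, neg_neg, Matrix.mul_assoc, hPs.transpose_eq,
        (hQ k).transpose_eq, (hR k).posSemidef.transpose_eq,
        (hR (k + 1)).posSemidef.transpose_eq, z', Matrix.mul_zero, neg_zero, zero_add]
      rw [hΓ]
      simp only [transpose_mul, Matrix.mul_assoc]
      abel
    · rw [hrec (hN.memLp_w _), ih2 _ (by omega), hww' k j (by omega), hvw, hvw]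
      simp only [Matrix.mul_zero, add_zero]
    · rw [hrec (hN.memLp_v _), ih3 _ (by omega), hwv, hvv' k j (by omega),
        hvv' (k + 1) j (by omega)]
      simp only [Matrix.mul_zero, add_zero]
    -- The new error meets v_{k+1} only through T₂v_{k+1}, which is uncorrelated with T₁v_{k+1}.
    · rw [hv1, Matrix.neg_mul, Matrix.neg_mul, Matrix.mul_assoc, Matrix.mul_assoc,
        ← Matrix.mul_assoc (S.T2 F (k + 1)), T2_mul_R_mul_T1 hR, Matrix.mul_zero, neg_zero]

end Stochastic

end LinSys

/-! ### From squared bounds to the stability theorem -/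

theorem le_sqrt_mul_pow_of_sq_le {c ρ X Y : ℝ} (hc : 0 ≤ c) (hρ : 0 ≤ ρ) (hY : 0 ≤ Y) {i : ℕ}
    (h : X ^ 2 ≤ c * ρ ^ i * Y ^ 2) : X ≤ √c * √ρ ^ i * Y := by
  refine le_of_sq_le_sq ?_ (by positivity)
  rw [mul_pow, mul_pow, ← pow_mul, mul_comm i 2, pow_mul, Real.sq_sqrt hc, Real.sq_sqrt hρ]
  exact h

theorem mainTheorem2 {n m p l : ℕ} (S : LinSys n m p l) (F : ∀ k, SVD (S.H k))
    (hS : S.Standing F)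
    (hrank : ∀ k, (S.C2 F (k + 1) * S.G2 F k).rank = p - S.pH k)
    (hdet : UniformlyDetectable (S.Atil F) (fun k => S.C2 F (k + 1)))
    (P0 : Matrix (Fin n) (Fin n) ℝ) (hP0 : P0.PosSemidef) :
    (∃ c : ℝ, (∀ k i j, |S.Px F P0 k i j| ≤ c) ∧
      ∀ (Ω : Type u) [MeasurableSpace Ω] (μ : Measure Ω) [IsProbabilityMeasure μ]
        (x0 : Ω → Fin n → ℝ) (u : ℕ → Ω → Fin m → ℝ) (d : ℕ → Ω → Fin p → ℝ)
        (w : ℕ → Ω → Fin n → ℝ) (v : ℕ → Ω → Fin l → ℝ) (xh0 : Fin n → ℝ),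
        S.Noise x0 w v μ →
        ∫ ω, x0 ω ∂μ = xh0 →
        (∀ i j, ∫ ω, (x0 ω i - xh0 i) * (x0 ω j - xh0 j) ∂μ = P0 i j) →
        ∀ k, MemLp (S.xErr F x0 u d w v P0 xh0 k) 2 μ ∧
          ∀ i j, |∫ ω, S.xErr F x0 u d w v P0 xh0 k ω i *
            S.xErr F x0 u d w v P0 xh0 k ω j ∂μ| ≤ c) ∧
    (UniformlyStabilizable (S.Atil F) (fun k => CFC.sqrt (S.Qtil F k)) →
      ∃ K ρ : ℝ, 0 ≤ ρ ∧ ρ < 1 ∧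
        ∀ (Ω : Type u) [MeasurableSpace Ω] (μ : Measure Ω) [IsProbabilityMeasure μ]
          (x0 : Ω → Fin n → ℝ) (u : ℕ → Ω → Fin m → ℝ) (d : ℕ → Ω → Fin p → ℝ)
          (w : ℕ → Ω → Fin n → ℝ) (v : ℕ → Ω → Fin l → ℝ) (xh0 : Fin n → ℝ),
          S.Noise x0 w v μ →
          (∀ k, Integrable (S.xErr F x0 u d w v P0 xh0 k) μ ∧
            Integrable (S.dErr F x0 u d w v P0 xh0 k) μ) ∧
          ∀ j k, j ≤ k →
            ‖∫ ω, S.xErr F x0 u d w v P0 xh0 k ω ∂μ‖ ≤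
              K * ρ ^ (k - j) * ‖∫ ω, S.xErr F x0 u d w v P0 xh0 j ω ∂μ‖ ∧
            ‖∫ ω, S.dErr F x0 u d w v P0 xh0 k ω ∂μ‖ ≤
              K * ρ ^ (k - j) * ‖∫ ω, S.xErr F x0 u d w v P0 xh0 j ω ∂μ‖) := by
  have hQ := hS.Q_posSemidef
  have hR := hS.R_posDef
  refine ⟨?_, fun hstab => ?_⟩
  · obtain ⟨c, -, hc⟩ := LinSys.exists_Px_bound hS hrank hP0 hdet
    have hb : ∀ k i j, |S.Px F P0 k i j| ≤ c := fun k i j =>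
      (LinSys.Px_posSemidef hQ hR hP0 k).abs_apply_le (hc k) i j
    refine ⟨c, hb, ?_⟩
    intro Ω _ μ _ x0 u d w v xh0 hN _ hcov k
    refine ⟨LinSys.memLp_xErr u d xh0 hQ hR hrank hP0 hN k, fun i j => ?_⟩
    have h1 := (LinSys.crossMoment_xErr u d xh0 hQ hR hrank hP0 hN hcov k).1
    have h2 := congrFun (congrFun h1 i) j
    simp only [crossMoment, of_apply] at h2
    rw [h2]
    exact hb k i j
  · obtain ⟨M, ρ, hM, hρ0, hρ1, hdecay⟩ := LinSys.exists_error_decay hS hrank hP0 hdet hstab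
    have hD : OpBdd fun k => -((F k).V1 * S.M1 F k * S.C1 F k +
        (F k).V2 * S.M2 F k (S.Px F P0 k) * S.C2 F (k + 1) * S.Ahat F k) :=
      (((LinSys.Standing.opBdd_V1.mul hS.opBdd_M1).mul hS.opBdd_C1).add
        (((LinSys.Standing.opBdd_V2.mul (LinSys.opBdd_M2 hS hrank hP0 hdet)).mul
          hS.opBdd_C2.succ).mul hS.opBdd_Ahat)).neg
    obtain ⟨D, hD0, hD⟩ := hD
    -- The decay estimate is for squared Euclidean norms, hence the roots. n pays for passing from
    -- the sup norm of the initial mean to its Euclidean norm, and 1 + D serves the state and the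
    -- input error at once.
    refine ⟨√((1 + D) * M * n), √ρ, Real.sqrt_nonneg _,
      (Real.sqrt_lt' one_pos).2 (by rwa [one_pow]), ?_⟩
    intro Ω _ μ _ x0 u d w v xh0 hN
    refine ⟨fun k => ⟨(LinSys.memLp_xErr u d xh0 hQ hR hrank hP0 hN k).integrable (by norm_num),
      (LinSys.memLp_dErr u d xh0 hQ hR hrank hP0 hN k).integrable (by norm_num)⟩,
      fun j k hjk => ?_⟩
    set e : ℕ → Fin n → ℝ := fun k => ∫ ω, S.xErr F x0 u d w v P0 xh0 k ω ∂μ with he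
    have h1 := hdecay e (LinSys.integral_xErr_succ u d xh0 hQ hR hrank hP0 hN) j k hjk
    have h2 := dotProduct_self_le_norm_sq (e j)
    have h3 : e k ⬝ᵥ e k ≤ M * n * ρ ^ (k - j) * ‖e j‖ ^ 2 := by
      have := mul_le_mul_of_nonneg_left h2 (by positivity : 0 ≤ M * ρ ^ (k - j))
      linarith
    have h0 : 0 ≤ M * n * ρ ^ (k - j) * ‖e j‖ ^ 2 := by positivity
    constructor
    · refine le_sqrt_mul_pow_of_sq_le (by positivity) hρ0.le (norm_nonneg _) ?_
      have h4 := norm_sq_le_dotProduct (e k)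
      have h5 := mul_nonneg hD0 h0
      linarith
    · refine le_sqrt_mul_pow_of_sq_le (by positivity) hρ0.le (norm_nonneg _) ?_
      rw [LinSys.integral_dErr u d xh0 hQ hR hrank hP0 hN]
      have h4 := (norm_sq_le_dotProduct _).trans (hD k (e k))
      have h5 := mul_le_mul_of_nonneg_left h3 hD0
      linarith
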